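/- **Conventions.** A gate is an arbitrary unitary on one or two qubits. An $(\alpha,a,\varepsilon)$-block-encoding of an operator $A$ on $s$ qubits is a unitary $U$ on $a+s$ qubits with $\|A-\alpha(\langle 0^a|\otimes I)U(|0^a\rangle\otimes I)\|_2\le\varepsilon$. Let $H$ be a Hermitian operator on $s$ qubits, and let $U_H$ be an $(\alpha_{H},a,0)$-block-encoding of $H$ that is given by a circuit of $G_{H}$ gates. (For a chain of coupled oscillators, $H$ is its Hamiltonian.) A simulation circuit acts on the $a+s$ qubits of $U_H$ and on $b$ further ancillas. It consists of gates and of controlled uses of $U_H$ or $U_H^\dagger$. Each such use is charged $G_{H}$; every other gate is charged $1$. For $\alpha_{H}\ge 0$, $\alpha_{\mathrm{HS}}\ge 2$, $0<\varepsilon<1$, $t\ge 0$ and a nonzero initial vector $\psi_0$ put $$G_{\mathrm{HS+AA}}(t)=\Bigl(2\Bigl\lceil \tfrac{|\alpha_{\mathrm{HS}}|}{\|\psi_0\|_2}\Bigr\rceil+1\Bigr)\Bigl(2\bigl\lceil 2.8\,\alpha_{H}t+\ln(1/\varepsilon)\bigr\rceil-1\Bigr)G_{H}.$$ **Statement.**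 There is an absolute constant $C$ such that the following holds. Let $t_i\ge 0$, $\Delta t>0$, and let $M=(t_f-t_i)/\Delta t$ be a nonnegative integer; put $t_j=t_i+j\Delta t$. There are simulation circuits $V_j$ and $S_j$, $j=0,\dots,M$, with a common number $b$ of further ancillas, that depend only on $s,a,\alpha_{H},\alpha_{\mathrm{HS}},\varepsilon,\|\psi_0\|_2,t_i,\Delta t,M$ (not on $H$, $U_H$ or the direction of $\psi_0$), such that for all $H$, $U_H$, $\psi_0$ as above and all $j$: 1. $V_j$ is an $(\alpha_{\mathrm{HS}},a+b,\varepsilon)$-block-encoding of $e^{-iHt_j}$ with exactly $2\lceil 2.8\,\alpha_{H}t_j+\ln(1/\varepsilon)\rceil-1$ uses of $U_H^{\pm1}$. 2. $S_j$ is an $\varepsilon$-close simulation at time $t_j$: when it is run on $|0^{a+b}\rangle\otimes\psi_0/\|\psi_0\|$, all ancillas are measured to be $0$ with probability at least $1-\varepsilon$, and the normalized state of the signal qubits is then within $\varepsilon$, in norm, of $e^{-iHt_j}\psi_0/\|\psi_0\|$. It has exactly $2\lceil|\alpha_{\mathrm{HS}}|/\|\psi_0\|\rceil+1$ times as many uses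 of $U_H^{\pm1}$ as $V_j$. 3. $V_j$ and $S_j$ have at most $C(a+1)$ other gates per use of $U_H^{\pm1}$. Consequently the total cost of the uses of the block-encoding in the whole simulation $S_0,\dots,S_M$ is exactly $$G_{\mathrm{sim}}=\sum_{j=0}^{M}G_{\mathrm{HS+AA}}(t_i+j\Delta t),$$ and the total number of gates, with all other gates counted, is at most $G_{\mathrm{sim}}+C(a+1)\,G_{\mathrm{sim}}/G_{H}$, where $G_{\mathrm{sim}}/G_{H}$ denotes the same sum with $G_{H}$ replaced by $1$. -/

import Mathlib

open scoped Matrix Matrix.Norms.L2Operator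

noncomputable section

namespace OscSim

/-! Computational basis states of a register whose qubits are indexed by `ι` are the functions
`ι → Bool` (`false` is `|0⟩`, `true` is `|1⟩`); operators on the register are matrices indexed by
them. `‖A‖` is the spectral norm of a matrix. -/

/-- Operators on the register with set of qubits `ι`. -/
abbrev QOp (ι : Type) : Type := Matrix (ι → Bool) (ι → Bool) ℂ

/-- State vectors of the register with set of qubits `ι`, with the Euclidean norm. -/
abbrev QVec (ι : Type) [Fintype ι] [DecidableEq ι] : Type := EuclideanSpace ℂ (ι → Bool)

/-- An elementary gate: an arbitrary unitary on one qubit or on two distinct qubits. -/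
inductive Gate (ι : Type) : Type
  | one (q : ι) (u : Matrix.unitaryGroup Bool ℂ) : Gate ι
  | two (p q : ι) (hpq : p ≠ q) (u : Matrix.unitaryGroup (Bool × Bool) ℂ) : Gate ι

/-- The operator on the whole register: the gate on its qubits, the identity on all others. -/
def Gate.toOp {ι : Type} [Fintype ι] [DecidableEq ι] : Gate ι → QOp ι
  | .one q u => fun x y => if ∀ i, i ≠ q → x i = y i then u.1 (x q) (y q) else 0
  | .two p q _ u => fun x y =>
      if ∀ i, i ≠ p → i ≠ q → x i = y i then u.1 (x p, x q) (y p, y q) else 0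

/-- The operator of a gate list; the head of the list is applied first. -/
def circuitOp {ι : Type} [Fintype ι] [DecidableEq ι] : List (Gate ι) → QOp ι
  | [] => 1
  | g :: c => circuitOp c * g.toOp

/-- `(⟨0| ⊗ I) U (|0⟩ ⊗ I)`, for ancilla qubits `κ` and signal qubits `σ`. -/
def zeroBlock {κ σ : Type} (U : QOp (κ ⊕ σ)) : QOp σ :=
  fun x y => U (Sum.elim (fun _ => false) x) (Sum.elim (fun _ => false) y)

/-- `U` is an `(α, |κ|, ε)`-block-encoding of `A`. -/
structure IsBlockEncoding {κ σ : Type} [Fintype κ] [DecidableEq κ] [Fintype σ] [DecidableEq σ]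
    (α ε : ℝ) (A : QOp σ) (U : QOp (κ ⊕ σ)) : Prop where
  alpha_nonneg : 0 ≤ α
  eps_nonneg : 0 ≤ ε
  unitary : U ∈ Matrix.unitaryGroup (κ ⊕ σ → Bool) ℂ
  error_le : ‖A - (α : ℂ) • zeroBlock U‖ ≤ ε

/-- The qubits of a simulation circuit: `b` further ancillas, the `a` ancillas of the
block-encoding of the Hamiltonian, and the `s` signal qubits. -/
abbrev Wires (b a s : ℕ) : Type := (Fin b ⊕ Fin a) ⊕ Fin s

/-- The part of a basis state that lies in the register of the block-encoding. -/
def bePart {b a s : ℕ} (x : Wires b a s → Bool) : Fin a ⊕ Fin s → Bool :=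
  Sum.elim (fun i => x (Sum.inl (Sum.inr i))) (fun i => x (Sum.inr i))

/-- One step of a simulation circuit: an elementary gate, or one use of the block-encoding `U` of
the Hamiltonian (or of its adjoint, if `adj`), controlled by one of the further ancillas. -/
inductive Step (b a s : ℕ) : Type
  | gate (g : Gate (Wires b a s)) : Step b a s
  | call (c : Fin b) (adj : Bool) : Step b a s

/-- The operator of a step, when the block-encoding is `U`. -/
def Step.toOp {b a s : ℕ} (U : QOp (Fin a ⊕ Fin s)) : Step b a s → QOp (Wires b a s)
  | .gate g => g.toOp
  | .call c adj => fun x y =>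
      if ∀ i : Fin b, x (Sum.inl (Sum.inl i)) = y (Sum.inl (Sum.inl i)) then
        if y (Sum.inl (Sum.inl c)) = true then
          (if adj = true then Uᴴ else U) (bePart x) (bePart y)
        else (1 : QOp (Fin a ⊕ Fin s)) (bePart x) (bePart y)
      else 0

/-- A simulation circuit. It does not depend on the block-encoding that it calls. -/
abbrev Program (b a s : ℕ) : Type := List (Step b a s)

/-- The operator of a simulation circuit; the head of the list is applied first. -/
def Program.toOp {b a s : ℕ} (U : QOp (Fin a ⊕ Fin s)) : Program b a s → QOp (Wires b a s)
  | [] => 1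
  | st :: P => Program.toOp U P * st.toOp U

/-- The number of uses of the block-encoding (or of its adjoint). -/
def Program.calls {b a s : ℕ} : Program b a s → ℕ
  | [] => 0
  | .gate _ :: P => Program.calls P
  | .call _ _ :: P => Program.calls P + 1

/-- The number of elementary gates outside of the uses of the block-encoding. -/
def Program.otherGates {b a s : ℕ} : Program b a s → ℕ
  | [] => 0
  | .gate _ :: P => Program.otherGates P + 1
  | .call _ _ :: P => Program.otherGates P

/-- The gate complexity of a simulation circuit: a use of the block-encoding costs the number `G`
of gates of the block-encoding circuit, every other gate costs `1`. -/
def Program.gateComplexity {b a s : ℕ} (G : ℕ) (P : Program b a s) : ℕ :=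
  G * Program.calls P + Program.otherGates P

/-- The operator `exp (-i H t)`. -/
def evolution {s : ℕ} (H : QOp (Fin s)) (t : ℝ) : QOp (Fin s) :=
  NormedSpace.exp ((-(Complex.I * (t : ℂ))) • H)

/-- `(⟨0| ⊗ I) W (|0⟩ ⊗ ψ)`: the unnormalized state of the signal qubits when the circuit `W` is run
on `|0⟩ ⊗ ψ` and all ancillas are then measured to be `0`. Its squared norm is the probability of
that outcome if `ψ` is a unit vector. -/
def postselect {κ σ : Type} [Fintype σ] [DecidableEq σ] (W : QOp (κ ⊕ σ)) (ψ : QVec σ) : QVec σ :=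
  Matrix.toEuclideanLin (zeroBlock W) ψ

/-- Number of uses of the block-encoding of `H` in one block-encoding of `exp (-i H t)`. -/
def evolutionCalls (αH ε t : ℝ) : ℤ :=
  2 * ⌈2.8 * αH * t + Real.log (1 / ε)⌉ - 1

/-- Number of uses of the block-encoding of `exp (-i H t)` in amplitude amplification, for an initial
state of norm `ν`. -/
def amplificationCalls (αHS ν : ℝ) : ℤ :=
  2 * ⌈|αHS| / ν⌉ + 1

/-- `G_{HS+AA}` at the simulation time `t`, for a block-encoding of `H` with `G` gates. -/
def costHSAA (αH αHS ε ν : ℝ) (G : ℕ) (t : ℝ) : ℤ :=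
  amplificationCalls αHS ν * evolutionCalls αH ε t * (G : ℤ)

/-- `G_sim`: the sum of `G_{HS+AA}` over the times `ti + j Δt`, `j = 0, …, M`. -/
def costSim (αH αHS ε ν : ℝ) (G : ℕ) (ti Δt : ℝ) (M : ℕ) : ℤ :=
  ∑ j ∈ Finset.range (M + 1), costHSAA αH αHS ε ν G (ti + j * Δt)

end OscSim

end

/-! Let `J` be the isometry that adds zero ancillas and `R = 2 J Jᴴ - 1`. Consider alternating
products of `U` and `Uᴴ` with `R` between the factors (`word`). As `H` is Hermitian, `U` and `Uᴴ`
have the same block `H / α`. Reflecting after a query instead of before it multiplies the word on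
the right by one fixed unitary, `walkSq` (`reflection_queryOp_word`), and averaging the two orders
inserts one factor `H / α` into the block (`block_word_succ`). With `z ^ 2` for `walkSq` and `x = (z
+ 1 / z) / 2` for `H / α`, polynomials in `H` of fixed parity thus become blocks of a word times a
polynomial in `walkSq` (`block_expPoly`).

A signal qubit that selects one of the two orders applies `diag (1, walkSq)` at each query.
Interleaved with one-qubit gates, this generates every polynomial that is less than `1` on the unit
circle (`exists_signalPoly`): the Fejér-Riesz theorem supplies a complementary polynomial, and the
degree of the pair is lowered one gate at a time.

Let `n = ⌈2.8 α t + ln (1 / ε)⌉`. The even and the odd part of the Taylor polynomial of degree `2 n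
- 1`, scaled by `1 / (1 + ε / 6)`, take `2 n - 2` and `2 n - 1` queries. A selection qubit between
Hadamard gates adds them, and only the last query is conditioned on it, so the count is exactly `2 n
- 1`. The block is close to `exp (-i H t) / 2`, since `e < 2.8` makes the remainder small
(`taylor_remainder_le`).

For `V`, a rotation of a spare ancilla damps `1 / 2` to `1 / αHS`, which is possible because `αHS ≥
2`. For `S`, one round of oblivious amplitude amplification with three uses raises the amplitude `1
/ 2 = sin 30°` to `1 = sin 90°` (`amplification_block`, `norm_amplified_sub_le`). This suffices for
all `αHS` and `ν`; the prescribed number of uses is at least three, and the surplus consists of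
calls whose control is `0` (`idleCalls`). Each reflection takes a number of gates linear in `a`
(`ladder`). -/

noncomputable section

namespace OscSim

/-! ### Polynomials on the unit circle and the Fejér-Riesz theorem -/

open Polynomial

/-- The polynomial `X ^ N * conj p (1 / X)`. -/
def conjReflect (N : ℕ) (p : ℂ[X]) : ℂ[X] := reflect N (p.map (starRingEnd ℂ))

theorem natDegree_conjReflect_le {N : ℕ} {p : ℂ[X]} (hp : p.natDegree ≤ N) :
    (conjReflect N p).natDegree ≤ N := by
  refine natDegree_reflect_le.trans (max_le le_rfl ?_)
  exact (natDegree_map_le).trans hp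

theorem eval_conjReflect {N : ℕ} {p : ℂ[X]} (hp : p.natDegree ≤ N) {z : ℂ} (hz : z ≠ 0) :
    (conjReflect N p).eval z = z ^ N * starRingEnd ℂ (p.eval (starRingEnd ℂ z)⁻¹) := by
  let _ : Invertible z⁻¹ := invertibleOfNonzero (inv_ne_zero hz)
  have h := eval₂_reflect_mul_pow (RingHom.id ℂ) z⁻¹ N (p.map (starRingEnd ℂ))
    ((natDegree_map_le).trans hp)
  have h1 : ⅟(z⁻¹) = z := by simp
  rw [h1, ← eval, ← eval, inv_pow] at h
  have h2 : (p.map (starRingEnd ℂ)).eval z⁻¹ = starRingEnd ℂ (p.eval (starRingEnd ℂ z)⁻¹) := by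
    have h3 : z⁻¹ = starRingEnd ℂ ((starRingEnd ℂ z)⁻¹) := by simp
    conv_lhs => rw [h3]
    exact eval_map_apply _ _
  rw [← h2, ← h]
  have : z ^ N ≠ 0 := pow_ne_zero _ hz
  simp only [conjReflect]
  field_simp

theorem conj_inv_of_norm_one {w : ℂ} (hw : ‖w‖ = 1) : (starRingEnd ℂ w)⁻¹ = w := by
  have h : w * starRingEnd ℂ w = 1 := by
    rw [Complex.mul_conj, Complex.normSq_eq_norm_sq, hw]; simp
  exact (eq_inv_of_mul_eq_one_left h).symm

theorem ne_zero_of_norm_one {w : ℂ} (hw : ‖w‖ = 1) : w ≠ 0 := by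
  rintro rfl; simp at hw

theorem eval_conjReflect_of_norm_one {N : ℕ} {p : ℂ[X]} (hp : p.natDegree ≤ N) {w : ℂ}
    (hw : ‖w‖ = 1) : (conjReflect N p).eval w = w ^ N * starRingEnd ℂ (p.eval w) := by
  rw [eval_conjReflect hp (ne_zero_of_norm_one hw), conj_inv_of_norm_one hw]

/-- On the circle `1 / conj w = w`, so the product represents `|p|²` as an ordinary polynomial,
shifted by `w ^ N`. In this form trigonometric polynomials are handled throughout. -/
theorem eval_mul_conjReflect {N : ℕ} {p : ℂ[X]} (hp : p.natDegree ≤ N) {w : ℂ} (hw : ‖w‖ = 1) :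
    (p * conjReflect N p).eval w = w ^ N * ((‖p.eval w‖ ^ 2 : ℝ) : ℂ) := by
  rw [eval_mul, eval_conjReflect_of_norm_one hp hw, mul_left_comm, Complex.mul_conj,
    Complex.normSq_eq_norm_sq]

theorem coeff_conjReflect (N i : ℕ) (p : ℂ[X]) :
    (conjReflect N p).coeff i = starRingEnd ℂ (p.coeff (revAt N i)) := by
  rw [conjReflect, coeff_reflect, coeff_map]

theorem infinite_unit_circle : Set.Infinite {w : ℂ | ‖w‖ = 1} := by
  have h : (Metric.sphere (0 : ℂ) 1).Infinite := by
    refine IsPreconnected.infinite_of_nontrivial ?_ ⟨1, by simp, -1, by simp, ?_⟩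
    · refine isPreconnected_sphere ?_ 0 1
      simp
    · intro h
      have := congrArg Complex.re h
      norm_num at this
  convert h using 1
  ext w; simp

theorem eq_of_eval_unit_circle {p q : ℂ[X]} (h : ∀ w : ℂ, ‖w‖ = 1 → p.eval w = q.eval w) :
    p = q :=
  eq_of_infinite_eval_eq p q (infinite_unit_circle.mono fun w hw => h w hw)

/-- The Fejér-Riesz theorem for strictly positive trigonometric polynomials. -/
theorem fejer_riesz (d : ℕ) : ∀ G : ℂ[X], G.natDegree ≤ 2 * d →
    (∀ w : ℂ, ‖w‖ = 1 → ∃ ρ : ℝ, 0 < ρ ∧ G.eval w = w ^ d * (ρ : ℂ)) →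
    ∃ q : ℂ[X], q.natDegree ≤ d ∧
      ∀ w : ℂ, ‖w‖ = 1 → G.eval w = w ^ d * ((‖q.eval w‖ ^ 2 : ℝ) : ℂ) := by
  induction d with
  | zero =>
    intro G hG hpos
    obtain ⟨ρ, hρ, h1⟩ := hpos 1 (by simp)
    have hC : G = C (G.coeff 0) := eq_C_of_natDegree_le_zero (by simpa using hG)
    rw [hC] at h1 ⊢
    simp only [eval_C, pow_zero, one_mul] at h1
    refine ⟨C ((√ρ : ℝ) : ℂ), by simp, fun w _ => ?_⟩
    simp only [eval_C, pow_zero, one_mul, Complex.norm_real, Real.norm_eq_abs, sq_abs,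
      Real.sq_sqrt hρ.le, h1]
  | succ d ih =>
    intro G hG hpos
    -- `G w / w ^ (d + 1)` is real on the circle, so `G` is its own conjugate reflection: roots `z`
    -- and `1 / conj z` come in pairs, and the top coefficient is conjugate to the constant one.
    have hself : conjReflect (2 * (d + 1)) G = G := by
      refine eq_of_eval_unit_circle fun w hw => ?_
      obtain ⟨ρ, hρ, h1⟩ := hpos w hw
      rw [eval_conjReflect_of_norm_one hG hw, h1]
      have h2 : w * starRingEnd ℂ w = 1 := by
        rw [Complex.mul_conj, Complex.normSq_eq_norm_sq, hw]; simp
      have h3 : w ^ (2 * (d + 1)) * (starRingEnd ℂ w) ^ (d + 1) = w ^ (d + 1) := by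
        rw [two_mul, pow_add, mul_assoc, ← mul_pow, h2, one_pow, mul_one]
      rw [map_mul, map_pow, Complex.conj_ofReal, ← mul_assoc, h3]
    have hcoeff : G.coeff (2 * (d + 1)) = starRingEnd ℂ (G.coeff 0) := by
      conv_lhs => rw [← hself]
      rw [coeff_conjReflect, revAt_le le_rfl, Nat.sub_self]
    -- If the constant coefficient vanishes, so does the top one, and division by `X` lowers the
    -- degree bound by two.
    by_cases h0 : G.coeff 0 = 0
    · obtain ⟨G1, rfl⟩ := X_dvd_iff.2 h0
      have hlt : (X * G1).natDegree ≤ 2 * d + 1 := by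
        rw [h0, map_zero] at hcoeff
        exact natDegree_le_pred hG hcoeff
      obtain ⟨q, hq, hqe⟩ := ih G1 (by
        by_cases hG1 : G1 = 0
        · simp [hG1]
        · rw [natDegree_X_mul hG1] at hlt; omega) (by
        intro w hw
        obtain ⟨ρ, hρ, h1⟩ := hpos w hw
        refine ⟨ρ, hρ, mul_left_cancel₀ (ne_zero_of_norm_one hw) ?_⟩
        rw [eval_mul, eval_X] at h1
        rw [h1, pow_succ]; ring)
      refine ⟨q, hq.trans d.le_succ, fun w hw => ?_⟩
      rw [eval_mul, eval_X, hqe w hw]; ring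
    · have hdeg : 0 < G.degree := by
        refine natDegree_pos_iff_degree_pos.1 ?_
        have : 2 * (d + 1) ≤ G.natDegree := le_natDegree_of_ne_zero (by
          rw [hcoeff]; simpa using h0)
        omega
      obtain ⟨z, hz⟩ := Complex.exists_root hdeg
      have hz0 : z ≠ 0 := by
        rintro rfl
        exact h0 (by rw [coeff_zero_eq_eval_zero]; exact hz)
      -- Strict positivity enters here: it excludes roots on the circle, which would be their own
      -- partners.
      have hz1 : ‖z‖ ≠ 1 := by
        intro h
        obtain ⟨ρ, hρ, h1⟩ := hpos z h
        rw [hz.eq_zero] at h1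
        exact mul_ne_zero (pow_ne_zero _ hz0) (by exact_mod_cast hρ.ne') h1.symm
      have hcz : starRingEnd ℂ z ≠ 0 := by simpa using hz0
      set y : ℂ := (starRingEnd ℂ z)⁻¹ with hy
      have hyr : G.IsRoot y := by
        have h := eval_conjReflect hG (z := y) (inv_ne_zero hcz)
        rw [hself] at h
        rw [IsRoot, h, hy]
        simp [hz.eq_zero]
      have hyz : y ≠ z := by
        intro h
        apply hz1
        have h2 : z * starRingEnd ℂ z = 1 :=
          (congrArg (· * starRingEnd ℂ z) h.symm).trans (inv_mul_cancel₀ hcz)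
        rw [Complex.mul_conj, Complex.normSq_eq_norm_sq] at h2
        have h3 : ‖z‖ ^ 2 = 1 := by exact_mod_cast h2
        exact (pow_eq_one_iff_of_nonneg (norm_nonneg z) two_ne_zero).1 h3
      obtain ⟨G1, rfl⟩ := dvd_iff_isRoot.2 hz
      have hy1 : G1.IsRoot y := by
        have h := hyr.eq_zero
        rw [eval_mul, eval_sub, eval_X, eval_C] at h
        exact (mul_eq_zero.1 h).resolve_left (sub_ne_zero.2 hyz)
      obtain ⟨G2, rfl⟩ := dvd_iff_isRoot.2 hy1
      have hG2 : G2 ≠ 0 := by rintro rfl; simp at h0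
      rw [natDegree_mul (X_sub_C_ne_zero z) (mul_ne_zero (X_sub_C_ne_zero y) hG2),
        natDegree_mul (X_sub_C_ne_zero y) hG2, natDegree_X_sub_C, natDegree_X_sub_C] at hG
      -- On the circle the two paired factors amount to `w |w - z|²` up to the constant `-y`. The
      -- constant joins the cofactor `G2`, and `X - C z` joins the square root.
      have key : ∀ w : ℂ, ‖w‖ = 1 → (w - z) * (w - y) = -y * (w * ((‖w - z‖ ^ 2 : ℝ) : ℂ)) := by
        intro w hw
        have h2 : w * starRingEnd ℂ w = 1 := by
          rw [Complex.mul_conj, Complex.normSq_eq_norm_sq, hw]; simp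
        have h4 : y * starRingEnd ℂ z = 1 := inv_mul_cancel₀ hcz
        rw [← Complex.normSq_eq_norm_sq, ← Complex.mul_conj, map_sub]
        linear_combination (w - z) * (y * h2) - (w - z) * w * h4
      obtain ⟨q, hq, hqe⟩ := ih (C (-y) * G2) (by
        rw [natDegree_C_mul (neg_ne_zero.2 (inv_ne_zero hcz))]; omega) (by
        intro w hw
        obtain ⟨ρ, hρ, h1⟩ := hpos w hw
        have hwz : w - z ≠ 0 := sub_ne_zero.2 (by rintro rfl; exact hz1 hw)
        have hn : 0 < ‖w - z‖ ^ 2 := by positivity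
        have hnc : ((‖w - z‖ ^ 2 : ℝ) : ℂ) ≠ 0 := by exact_mod_cast hn.ne'
        refine ⟨ρ / ‖w - z‖ ^ 2, div_pos hρ hn, ?_⟩
        simp only [eval_mul, eval_sub, eval_X, eval_C] at h1 ⊢
        rw [← mul_assoc, key w hw] at h1
        refine mul_left_cancel₀ (mul_ne_zero (ne_zero_of_norm_one hw) hnc) ?_
        rw [Complex.ofReal_div]
        field_simp
        linear_combination h1)
      refine ⟨(X - C z) * q, ?_, fun w hw => ?_⟩
      · refine natDegree_mul_le.trans ?_
        rw [natDegree_X_sub_C]; omega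
      · have h := hqe w hw
        simp only [eval_mul, eval_sub, eval_X, eval_C] at h ⊢
        rw [← mul_assoc, key w hw, norm_mul, mul_pow]
        push_cast at h ⊢
        linear_combination w * (‖w - z‖ : ℂ) ^ 2 * h

/-! ### Quantum signal processing on one qubit -/

/-- The polynomials generated by the one-qubit gates `A 0, …, A d`, interleaved with the operator
`diag (1, X)` and applied to `|0⟩`. -/
def signalPoly (A : ℕ → Matrix.unitaryGroup Bool ℂ) : ℕ → Bool → ℂ[X]
  | 0, i => C ((A 0).1 i false)
  | d + 1, i => C ((A (d + 1)).1 i false) * signalPoly A d false +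
      C ((A (d + 1)).1 i true) * (X * signalPoly A d true)

theorem signalPoly_congr {A B : ℕ → Matrix.unitaryGroup Bool ℂ} {d : ℕ}
    (h : ∀ k ≤ d, A k = B k) : signalPoly A d = signalPoly B d := by
  induction d with
  | zero => ext1 i; simp [signalPoly, h 0 le_rfl]
  | succ d ih => ext1 i; simp [signalPoly, h (d + 1) le_rfl, ih fun k hk => h k (hk.trans d.le_succ)]

/-- The unitary with first column `(x, y)`, up to completion. -/
def columnMatrix (x y : ℂ) : Matrix Bool Bool ℂ := fun i j =>
  match i, j with
  | false, false => x
  | true, false => y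
  | false, true => -starRingEnd ℂ y
  | true, true => starRingEnd ℂ x

theorem columnMatrix_mem {x y : ℂ} (h : ‖x‖ ^ 2 + ‖y‖ ^ 2 = 1) :
    columnMatrix x y ∈ Matrix.unitaryGroup Bool ℂ := by
  rw [Matrix.mem_unitaryGroup_iff]
  have h1 : x * starRingEnd ℂ x + y * starRingEnd ℂ y = 1 := by
    rw [Complex.mul_conj, Complex.mul_conj, Complex.normSq_eq_norm_sq, Complex.normSq_eq_norm_sq]
    exact_mod_cast h
  ext i j
  cases i <;> cases j <;>
    simp [Matrix.mul_apply, columnMatrix, Matrix.star_apply] <;>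
    first | ring1 | linear_combination h1

theorem exists_unitary_of_norm_ne_zero {x y : ℂ} (h : ¬(x = 0 ∧ y = 0)) :
    ∃ u v : ℂ, ∃ c : ℂ, ‖u‖ ^ 2 + ‖v‖ ^ 2 = 1 ∧ x = c * u ∧ y = c * v ∧ c ≠ 0 := by
  have hpos : 0 < ‖x‖ ^ 2 + ‖y‖ ^ 2 := by
    by_contra hc
    have hx := sq_nonneg ‖x‖
    have hy := sq_nonneg ‖y‖
    refine h ⟨?_, ?_⟩
    · exact norm_eq_zero.1 (pow_eq_zero_iff two_ne_zero |>.1 (by linarith))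
    · exact norm_eq_zero.1 (pow_eq_zero_iff two_ne_zero |>.1 (by linarith))
  set n := √(‖x‖ ^ 2 + ‖y‖ ^ 2) with hn
  have hn0 : 0 < n := Real.sqrt_pos.2 hpos
  have hnc : (n : ℂ) ≠ 0 := by exact_mod_cast hn0.ne'
  refine ⟨x / n, y / n, n, ?_, by field_simp, by field_simp, hnc⟩
  rw [norm_div, norm_div, Complex.norm_real, Real.norm_of_nonneg hn0.le, div_pow, div_pow,
    ← add_div, hn, Real.sq_sqrt hpos.le, div_self hpos.ne']

/-- Two orthogonal vectors of `ℂ²` are rotated onto the coordinate axes by a unitary. -/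
theorem exists_unitary_axes {a b c d : ℂ}
    (h : c * starRingEnd ℂ a + d * starRingEnd ℂ b = 0) :
    ∃ u : Matrix.unitaryGroup Bool ℂ,
      starRingEnd ℂ (u.1 false true) * a + starRingEnd ℂ (u.1 true true) * b = 0 ∧
      starRingEnd ℂ (u.1 false false) * c + starRingEnd ℂ (u.1 true false) * d = 0 := by
  by_cases h1 : a = 0 ∧ b = 0
  · by_cases h2 : c = 0 ∧ d = 0
    · exact ⟨1, by simp [h1], by simp [h2]⟩
    · obtain ⟨x, y, k, hxy, rfl, rfl, -⟩ := exists_unitary_of_norm_ne_zero h2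
      refine ⟨⟨columnMatrix (starRingEnd ℂ y) (-starRingEnd ℂ x), columnMatrix_mem (by
        simpa [add_comm] using hxy)⟩, by simp [h1], ?_⟩
      simp [columnMatrix]; ring
  · obtain ⟨x, y, k, hxy, rfl, rfl, hk⟩ := exists_unitary_of_norm_ne_zero h1
    refine ⟨⟨columnMatrix x y, columnMatrix_mem hxy⟩, by simp [columnMatrix]; ring, ?_⟩
    have hk' : starRingEnd ℂ k ≠ 0 := by simpa using hk
    simp only [columnMatrix]
    refine mul_left_cancel₀ hk' ?_
    rw [map_mul, map_mul] at h
    linear_combination h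

/-- Normalization on the circle makes the vectors of leading and of constant coefficients
orthogonal. One unitary rotates both onto the axes; undoing it leaves a pair in which one factor `X`
splits off the second component and the first has lower degree. -/
theorem exists_signalPoly_pair (d : ℕ) : ∀ P : Bool → ℂ[X], (∀ i, (P i).natDegree ≤ d) →
    (∀ w : ℂ, ‖w‖ = 1 → ‖(P false).eval w‖ ^ 2 + ‖(P true).eval w‖ ^ 2 = 1) →
    ∃ A : ℕ → Matrix.unitaryGroup Bool ℂ, signalPoly A d = P := by
  induction d with
  | zero =>
    intro P hP h
    have hC : ∀ i, P i = C ((P i).coeff 0) := fun i => eq_C_of_natDegree_le_zero (hP i)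
    have h1 := h 1 (by simp)
    rw [hC false, hC true, eval_C, eval_C] at h1
    refine ⟨fun _ => ⟨_, columnMatrix_mem h1⟩, ?_⟩
    ext1 i
    rw [hC i]
    cases i <;> simp [signalPoly, columnMatrix]
  | succ d ih =>
    intro P hP h
    have hprod : P false * conjReflect (d + 1) (P false) + P true * conjReflect (d + 1) (P true)
        = X ^ (d + 1) := by
      refine eq_of_eval_unit_circle fun w hw => ?_
      rw [eval_add, eval_mul_conjReflect (hP _) hw, eval_mul_conjReflect (hP _) hw, ← mul_add,
        ← Complex.ofReal_add, h w hw]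
      simp
    -- Comparison of the coefficients of degree `2 (d + 1)`, which is larger than `d + 1`, so that
    -- the right-hand side contributes `0`.
    have horth : (P false).coeff (d + 1) * starRingEnd ℂ ((P false).coeff 0) +
        (P true).coeff (d + 1) * starRingEnd ℂ ((P true).coeff 0) = 0 := by
      have h1 := congrArg (fun p => p.coeff ((d + 1) + (d + 1))) hprod
      simp only [coeff_add] at h1
      rw [coeff_mul_add_eq_of_natDegree_le (hP _) (natDegree_conjReflect_le (hP _)),
        coeff_mul_add_eq_of_natDegree_le (hP _) (natDegree_conjReflect_le (hP _)), coeff_conjReflect,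
        coeff_conjReflect, revAt_le le_rfl, Nat.sub_self, coeff_X_pow, if_neg (by omega)] at h1
      exact h1
    obtain ⟨u, hu0, hu1⟩ := exists_unitary_axes horth
    -- `Q` is `uᴴ P`. The induction hypothesis is applied to the pair `Q false`, `Q true / X`.
    set Q : Bool → ℂ[X] := fun j => C (starRingEnd ℂ (u.1 false j)) * P false +
      C (starRingEnd ℂ (u.1 true j)) * P true with hQ
    have hQdeg : ∀ j, (Q j).natDegree ≤ d + 1 := fun j =>
      (natDegree_add_le _ _).trans (max_le ((natDegree_C_mul_le _ _).trans (hP _))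
        ((natDegree_C_mul_le _ _).trans (hP _)))
    have hQ0 : (Q true).coeff 0 = 0 := by simpa [hQ] using hu0
    have hQd : (Q false).natDegree ≤ d := natDegree_le_pred (hQdeg false) (by simpa [hQ] using hu1)
    obtain ⟨Q1, hQ1⟩ := X_dvd_iff.2 hQ0
    have huu : ∀ i j, ∑ k, u.1 i k * starRingEnd ℂ (u.1 j k) = if i = j then 1 else 0 := by
      intro i j
      have := congrFun (congrFun (Matrix.mem_unitaryGroup_iff.1 u.2) i) j
      simpa [Matrix.mul_apply, Matrix.one_apply] using this
    have huu' : ∀ i j, ∑ k, starRingEnd ℂ (u.1 k i) * u.1 k j = if i = j then 1 else 0 := by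
      intro i j
      have := congrFun (congrFun (Matrix.mem_unitaryGroup_iff'.1 u.2) i) j
      simpa [Matrix.mul_apply, Matrix.one_apply] using this
    have hPQ : ∀ i, P i = C (u.1 i false) * Q false + C (u.1 i true) * Q true := by
      intro i
      have e0 := congrArg C (huu i false)
      have e1 := congrArg C (huu i true)
      simp only [Fintype.univ_bool, Finset.mem_singleton, Bool.true_eq_false, not_false_eq_true,
        Finset.sum_insert, Finset.sum_singleton, map_add, map_mul] at e0 e1
      simp only [hQ]
      cases i <;> simp at e0 e1 <;> linear_combination (-P false) * e0 + (-P true) * e1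
    obtain ⟨A, hA⟩ := ih (fun i => if i then Q1 else Q false) (by
      intro i
      cases i
      · simpa using hQd
      · have h1 := hQdeg true
        by_cases h0 : Q1 = 0
        · simp [h0]
        · rw [hQ1, natDegree_X_mul h0] at h1
          simpa using h1) (by
      intro w hw
      have hnorm : ‖Q1.eval w‖ = ‖(Q true).eval w‖ := by rw [hQ1]; simp [hw]
      simp only [Bool.false_eq_true, if_false, if_true, hnorm]
      rw [← h w hw, ← Complex.normSq_eq_norm_sq, ← Complex.normSq_eq_norm_sq,
        ← Complex.normSq_eq_norm_sq, ← Complex.normSq_eq_norm_sq]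
      apply Complex.ofReal_injective
      push_cast
      simp only [← Complex.mul_conj]
      have e00 := huu false false
      have e01 := huu false true
      have e10 := huu true false
      have e11 := huu true true
      simp only [Fintype.univ_bool, Finset.mem_singleton, Bool.true_eq_false, not_false_eq_true,
        Finset.sum_insert, Finset.sum_singleton, if_true, if_false, Bool.false_eq_true]
        at e00 e01 e10 e11
      simp only [hQ, eval_add, eval_mul, eval_C, map_add, map_mul, Complex.conj_conj]
      generalize (P false).eval w = x
      generalize (P true).eval w = y
      linear_combination (x * starRingEnd ℂ x) * e00 + (y * starRingEnd ℂ x) * e01 +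
        (x * starRingEnd ℂ y) * e10 + (y * starRingEnd ℂ y) * e11)
    refine ⟨fun k => if k = d + 1 then u else A k, ?_⟩
    ext1 i
    rw [signalPoly, signalPoly_congr (B := A) (fun k hk => if_neg (by omega)), hA, hPQ i]
    simp [hQ1]

/-- Quantum signal processing: every polynomial that is less than `1` on the unit circle is
generated by one-qubit gates. -/
theorem exists_signalPoly {d : ℕ} {p : ℂ[X]} (hp : p.natDegree ≤ d)
    (h : ∀ w : ℂ, ‖w‖ = 1 → ‖p.eval w‖ < 1) :
    ∃ A : ℕ → Matrix.unitaryGroup Bool ℂ, signalPoly A d false = p := by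
  have heval : ∀ w : ℂ, ‖w‖ = 1 → (X ^ d - p * conjReflect d p).eval w =
      w ^ d * ((1 - ‖p.eval w‖ ^ 2 : ℝ) : ℂ) := fun w hw => by
    rw [eval_sub, eval_mul_conjReflect hp hw]; simp [mul_sub]
  -- `q` is the complementary polynomial, with `|p|² + |q|² = 1` on the circle; the strict bound on
  -- `p` provides the positivity that `fejer_riesz` needs.
  obtain ⟨q, hq, hqe⟩ := fejer_riesz d (X ^ d - p * conjReflect d p) (by
    refine (natDegree_sub_le _ _).trans (max_le ?_ ?_)
    · rw [natDegree_X_pow]; omega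
    · refine natDegree_mul_le.trans ?_
      have := natDegree_conjReflect_le hp
      omega) (fun w hw => ⟨1 - ‖p.eval w‖ ^ 2, by
        have h1 := h w hw
        have h2 := norm_nonneg (p.eval w)
        nlinarith, heval w hw⟩)
  obtain ⟨A, hA⟩ := exists_signalPoly_pair d (fun i => if i then q else p)
    (fun i => by cases i <;> simp [hp, hq]) (fun w hw => by
      have h1 := hqe w hw
      rw [heval w hw] at h1
      have h2 := mul_left_cancel₀ (pow_ne_zero d (ne_zero_of_norm_one hw)) h1
      have h3 : 1 - ‖p.eval w‖ ^ 2 = ‖q.eval w‖ ^ 2 := by exact_mod_cast h2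
      simp only [Bool.false_eq_true, if_false, if_true]
      linarith)
  exact ⟨A, by rw [hA]; simp⟩

/-! ### Qubitization: alternating products of queries and reflections -/

section Words

open Polynomial

variable {m n : Type} [Fintype m] [DecidableEq m] [Fintype n] [DecidableEq n]

/-- The reflection about the range of the isometry `J`. -/
def reflection (J : Matrix m n ℂ) : Matrix m m ℂ := (2 : ℂ) • (J * Jᴴ) - 1

/-- `U` or its adjoint. -/
def queryOp (U : Matrix m m ℂ) (adj : Bool) : Matrix m m ℂ := if adj = true then Uᴴ else U

/-- The product of `k` alternating factors `U R`, `Uᴴ R`. -/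
def word (J : Matrix m n ℂ) (U : Matrix m m ℂ) : ℕ → Matrix m m ℂ
  | 0 => 1
  | k + 1 => queryOp U k.bodd * (reflection J * word J U k)

/-- The square of the qubitization walk. -/
def walkSq (J : Matrix m n ℂ) (U : Matrix m m ℂ) : Matrix m m ℂ :=
  reflection J * (Uᴴ * (reflection J * U))

variable {J : Matrix m n ℂ} {U : Matrix m m ℂ}

theorem reflection_mul_self (hJ : Jᴴ * J = 1) : reflection J * reflection J = 1 := by
  have h : (J * Jᴴ) * (J * Jᴴ) = J * Jᴴ := by
    rw [Matrix.mul_assoc, ← Matrix.mul_assoc Jᴴ, hJ, Matrix.one_mul]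
  simp only [reflection, sub_mul, mul_sub, Matrix.smul_mul, Matrix.mul_smul, h, one_mul, mul_one]
  module

theorem reflection_mul_cancel (hJ : Jᴴ * J = 1) {l : Type} (A : Matrix m l ℂ) :
    reflection J * (reflection J * A) = A := by
  rw [← Matrix.mul_assoc, reflection_mul_self hJ, Matrix.one_mul]

theorem conjTranspose_mul_reflection (hJ : Jᴴ * J = 1) : Jᴴ * reflection J = Jᴴ := by
  rw [reflection, Matrix.mul_sub, Matrix.mul_smul, ← Matrix.mul_assoc, hJ, Matrix.one_mul,
    Matrix.mul_one]
  module

theorem queryOp_not_mul (hU : U ∈ Matrix.unitaryGroup m ℂ) (b : Bool) :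
    queryOp U (!b) * queryOp U b = 1 := by
  have h1 : U * Uᴴ = 1 := Matrix.mem_unitaryGroup_iff.1 hU
  have h2 : Uᴴ * U = 1 := Matrix.mem_unitaryGroup_iff'.1 hU
  cases b <;> simp [queryOp, h1, h2]

theorem queryOp_not_mul_cancel (hU : U ∈ Matrix.unitaryGroup m ℂ) (b : Bool) {l : Type}
    (A : Matrix m l ℂ) : queryOp U (!b) * (queryOp U b * A) = A := by
  rw [← Matrix.mul_assoc, queryOp_not_mul hU, Matrix.one_mul]

/-- The two orders of query and reflection differ by the same right factor at every length. Both
sides unfold by cancellation of `R R = 1` and `U Uᴴ = 1`; this is what lets one signal qubit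
multiply by `walkSq`. -/
theorem reflection_queryOp_word (hJ : Jᴴ * J = 1) (hU : U ∈ Matrix.unitaryGroup m ℂ) (k : ℕ) :
    reflection J * (queryOp U k.bodd * word J U k) = word J U (k + 1) * walkSq J U := by
  induction k with
  | zero =>
    have h := queryOp_not_mul_cancel hU true (reflection J * U)
    simp only [queryOp, Bool.not_true, Bool.false_eq_true, if_false, if_true] at h
    simp [word, walkSq, queryOp, Matrix.mul_assoc, reflection_mul_cancel hJ, h]
  | succ k ih =>
    rw [word.eq_2 J U (k + 1), Matrix.mul_assoc, Matrix.mul_assoc (reflection J), ← ih,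
      reflection_mul_cancel hJ, word, Nat.bodd_succ, queryOp_not_mul_cancel hU,
      queryOp_not_mul_cancel hU, reflection_mul_cancel hJ]

theorem word_mul_walkSq (hJ : Jᴴ * J = 1) (hU : U ∈ Matrix.unitaryGroup m ℂ) (k : ℕ) :
    word J U (k + 2) * walkSq J U = word J U k := by
  rw [← reflection_queryOp_word hJ hU, word, Nat.bodd_succ, queryOp_not_mul_cancel hU,
    reflection_mul_cancel hJ]

theorem word_mul_walkSq_pow (hJ : Jᴴ * J = 1) (hU : U ∈ Matrix.unitaryGroup m ℂ) (j : ℕ) :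
    word J U (2 * j) * walkSq J U ^ j = 1 := by
  induction j with
  | zero => simp [word]
  | succ j ih => rw [pow_succ', ← Matrix.mul_assoc, mul_add, mul_one, word_mul_walkSq hJ hU, ih]

/-- The average of the two orders is `Q (R + 1) / 2` under `Jᴴ`, since `Jᴴ R = Jᴴ`, and `(R + 1) / 2
= J Jᴴ` cuts the product into two blocks. -/
theorem block_word_succ (hJ : Jᴴ * J = 1) (hU : U ∈ Matrix.unitaryGroup m ℂ) (k : ℕ) :
    Jᴴ * (word J U (k + 1) * ((1 / 2 : ℂ) • (1 + walkSq J U))) =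
      (Jᴴ * (queryOp U k.bodd * J)) * (Jᴴ * word J U k) := by
  have h1 : reflection J + 1 = (2 : ℂ) • (J * Jᴴ) := by simp [reflection]
  rw [Matrix.mul_smul, Matrix.mul_add, Matrix.mul_one, ← reflection_queryOp_word hJ hU, word,
    Matrix.mul_smul, Matrix.mul_add, ← Matrix.mul_assoc Jᴴ (reflection J),
    conjTranspose_mul_reflection hJ, ← Matrix.mul_add, ← Matrix.mul_add]
  have h2 : reflection J * word J U k + word J U k = (2 : ℂ) • (J * (Jᴴ * word J U k)) := by
    rw [← Matrix.mul_assoc, ← Matrix.smul_mul, ← h1, Matrix.add_mul, Matrix.one_mul]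
  rw [h2]
  simp only [Matrix.mul_smul, smul_smul, Matrix.mul_assoc]
  norm_num

/-- Each power of `walkSq` cancels two letters of the word. Hence all monomials of one parity can be
written with words of the same length. -/
theorem block_word_pow (hJ : Jᴴ * J = 1) (hU : U ∈ Matrix.unitaryGroup m ℂ) {α : ℂ}
    {H : Matrix n n ℂ} (hH : ∀ b, α • (Jᴴ * (queryOp U b * J)) = H) (j k : ℕ) :
    α ^ k • (Jᴴ * (word J U (2 * j + k) *
      (walkSq J U ^ j * ((1 / 2 : ℂ) • (1 + walkSq J U)) ^ k))) = H ^ k * Jᴴ := by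
  induction k with
  | zero => simp [word_mul_walkSq_pow hJ hU]
  | succ k ih =>
    have hc : Commute (walkSq J U ^ j) ((1 / 2 : ℂ) • (1 + walkSq J U)) :=
      (((Commute.one_right _).add_right (Commute.refl _)).smul_right _).pow_left _
    rw [pow_succ' ((1 / 2 : ℂ) • (1 + walkSq J U)), ← mul_assoc (walkSq J U ^ j), hc.eq, mul_assoc,
      ← add_assoc, ← Matrix.mul_assoc (word J U _), ← Matrix.mul_assoc Jᴴ,
      block_word_succ hJ hU, pow_succ' H, Matrix.mul_assoc H, ← ih, ← hH (2 * j + k).bodd]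
    simp only [Matrix.mul_smul, Matrix.smul_mul, smul_smul, Matrix.mul_assoc, pow_succ]

/-- The part of parity `par` of the truncated Taylor series of `s * exp (-i τ x)` with `2 n` terms,
for `x = (z + 1 / z) / 2`, multiplied by `z ^ (2 * (n - 1) + par)`, as a polynomial in `z ^ 2`. -/
def expPoly (s τ : ℂ) (n par : ℕ) : ℂ[X] :=
  ∑ i ∈ Finset.range n, C (s * (-(Complex.I * τ)) ^ (2 * i + par) / (2 * i + par).factorial) *
    (X ^ (n - 1 - i) * (C (1 / 2) * (1 + X)) ^ (2 * i + par))

theorem natDegree_expPoly_le (s τ : ℂ) (n par : ℕ) :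
    (expPoly s τ n par).natDegree ≤ 2 * (n - 1) + par := by
  refine natDegree_sum_le_of_forall_le _ _ fun i hi => ?_
  have hi' := Finset.mem_range.1 hi
  refine (natDegree_C_mul_le _ _).trans (natDegree_mul_le.trans ?_)
  rw [natDegree_X_pow]
  have h1 : (C (1 / 2 : ℂ) * (1 + X)).natDegree ≤ 1 := by
    refine (natDegree_C_mul_le _ _).trans ?_
    rw [add_comm]
    exact (natDegree_add_le _ _).trans (by simp)
  have h2 := natDegree_pow_le_of_le (2 * i + par) h1
  omega

/-- In `expPoly` the monomial `x ^ m` is padded with powers of `z ^ 2` to the common length, and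
`block_word_pow` evaluates it with `z ^ 2 = walkSq`. -/
theorem block_expPoly (hJ : Jᴴ * J = 1) (hU : U ∈ Matrix.unitaryGroup m ℂ) {α : ℂ}
    {H : Matrix n n ℂ} (hH : ∀ b, α • (Jᴴ * (queryOp U b * J)) = H) (s t : ℂ) (N par : ℕ) :
    Jᴴ * (word J U (2 * (N - 1) + par) * aeval (walkSq J U) (expPoly s (α * t) N par)) =
      s • ((∑ i ∈ Finset.range N, ((2 * i + par).factorial : ℂ)⁻¹ •
        ((-(Complex.I * t)) • H) ^ (2 * i + par)) * Jᴴ) := by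
  simp only [expPoly, map_sum, Matrix.mul_sum, Matrix.sum_mul, Finset.smul_sum]
  refine Finset.sum_congr rfl fun i hi => ?_
  have hi' := Finset.mem_range.1 hi
  have h := block_word_pow hJ hU hH (N - 1 - i) (2 * i + par)
  rw [show 2 * (N - 1 - i) + (2 * i + par) = 2 * (N - 1) + par by omega] at h
  have h1 : aeval (walkSq J U) (C (1 / 2 : ℂ) * (1 + X)) = (1 / 2 : ℂ) • (1 + walkSq J U) := by
    simp [Algebra.smul_def]
  rw [map_mul, aeval_C, map_mul, map_pow, map_pow, h1, aeval_X, ← Algebra.smul_def, _root_.smul_pow (-(Complex.I * t)) H,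
    Matrix.smul_mul, Matrix.smul_mul, ← h, Matrix.mul_smul, Matrix.mul_smul, smul_smul, smul_smul,
    smul_smul]
  congr 1
  rw [show -(Complex.I * (α * t)) = -(Complex.I * t) * α by ring, mul_pow]
  ring

end Words

/-! ### Truncated exponential series -/

section Taylor

/-- The tail is dominated term by term by the scalar tail at `τ`, for which `Complex.exp_bound'`
gives twice the first omitted term. -/
theorem norm_exp_sub_sum_le {𝔸 : Type*} [NormedRing 𝔸] [NormedAlgebra ℂ 𝔸] [CompleteSpace 𝔸]
    {A : 𝔸} {τ : ℝ} (hA : ‖A‖ ≤ τ) {N : ℕ} (hN : 0 < N) (hτ : τ / (N + 1 : ℕ) ≤ 1 / 2) :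
    ‖NormedSpace.exp A - ∑ k ∈ Finset.range N, (k.factorial : ℂ)⁻¹ • A ^ k‖ ≤
      2 * (τ ^ N / N.factorial) := by
  have hτ0 : 0 ≤ τ := (norm_nonneg A).trans hA
  have hs := NormedSpace.expSeries_summable' (𝕂 := ℂ) A
  have h1 : NormedSpace.exp A = ∑' k : ℕ, (k.factorial : ℂ)⁻¹ • A ^ k :=
    congrFun (NormedSpace.exp_eq_tsum ℂ) A
  have h2 : NormedSpace.exp A - ∑ k ∈ Finset.range N, (k.factorial : ℂ)⁻¹ • A ^ k =
      ∑' k : ℕ, ((k + N).factorial : ℂ)⁻¹ • A ^ (k + N) := by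
    rw [h1, ← hs.sum_add_tsum_nat_add N, add_sub_cancel_left]
  have hr : Summable fun k : ℕ => τ ^ k / (k.factorial : ℝ) := Real.summable_pow_div_factorial τ
  have hr' : Summable fun k : ℕ => τ ^ (k + N) / ((k + N).factorial : ℝ) :=
    (summable_nat_add_iff (f := fun k : ℕ => τ ^ k / (k.factorial : ℝ)) N).2 hr
  have h3 : ‖∑' k : ℕ, ((k + N).factorial : ℂ)⁻¹ • A ^ (k + N)‖ ≤
      ∑' k : ℕ, τ ^ (k + N) / ((k + N).factorial : ℝ) := by
    refine tsum_of_norm_bounded hr'.hasSum fun k => ?_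
    rw [norm_smul, norm_inv, Complex.norm_natCast, div_eq_inv_mul]
    gcongr
    exact (norm_pow_le' A (by omega)).trans (pow_le_pow_left₀ (norm_nonneg _) hA _)
  have h4 : ∑' k : ℕ, τ ^ (k + N) / ((k + N).factorial : ℝ) =
      Real.exp τ - ∑ k ∈ Finset.range N, τ ^ k / (k.factorial : ℝ) := by
    rw [Real.exp_eq_exp_ℝ, congrFun NormedSpace.exp_eq_tsum_div τ, ← hr.sum_add_tsum_nat_add N,
      add_sub_cancel_left]
  have h5 := Complex.exp_bound' (x := (τ : ℂ)) (n := N) (by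
    rw [Complex.norm_real, Real.norm_of_nonneg hτ0]; exact hτ)
  rw [Complex.norm_real, Real.norm_of_nonneg hτ0] at h5
  have h6 : Complex.exp (τ : ℂ) - ∑ k ∈ Finset.range N, (τ : ℂ) ^ k / (k.factorial : ℂ) =
      ((Real.exp τ - ∑ k ∈ Finset.range N, τ ^ k / (k.factorial : ℝ) : ℝ) : ℂ) := by
    push_cast; rfl
  rw [h6, Complex.norm_real, Real.norm_eq_abs] at h5
  rw [h2]
  refine h3.trans (h4.le.trans ((le_abs_self _).trans (h5.trans_eq ?_)))
  ring

theorem sum_range_two_mul {M : Type*} [AddCommMonoid M] (f : ℕ → M) (n : ℕ) :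
    ∑ k ∈ Finset.range (2 * n), f k =
      ∑ i ∈ Finset.range n, f (2 * i) + ∑ i ∈ Finset.range n, f (2 * i + 1) := by
  induction n with
  | zero => simp
  | succ n ih =>
    rw [mul_add, mul_one, Finset.sum_range_succ, Finset.sum_range_succ, ih,
      Finset.sum_range_succ, Finset.sum_range_succ]
    abel

/-- The remainder of the Taylor polynomial of degree `2 n - 1` is small compared with `ε`. -/
theorem taylor_remainder_le {τ ε : ℝ} {n : ℕ} (hτ : 0 ≤ τ) (hε : 0 < ε) (hε1 : ε < 1) (hn : 1 ≤ n)
    (h : 2.8 * τ + Real.log (1 / ε) ≤ n) :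
    2 * (τ ^ (2 * n) / (2 * n).factorial) ≤ ε / 7 := by
  obtain ⟨k, rfl⟩ : ∃ k, n = k + 1 := ⟨n - 1, by omega⟩
  have hlog : 0 < Real.log (1 / ε) := Real.log_pos ((one_lt_div hε).2 hε1)
  set y := 2.8 * τ with hy
  have hy0 : 0 ≤ y := by positivity
  have hyn : y ≤ (k + 1 : ℕ) := by linarith
  have hε' : Real.exp (y - (k + 1 : ℕ)) ≤ ε := by
    have h1 : y - (k + 1 : ℕ) ≤ Real.log ε := by
      rw [one_div, Real.log_inv] at h; linarith
    exact (Real.exp_le_exp.2 h1).trans_eq (Real.exp_log hε)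
  have hk0 : (0 : ℝ) ≤ k := k.cast_nonneg
  -- Only three terms of the series of `exp y` are kept. Their successive ratios are `u = y / (2 n -
  -- 1) ≤ 1` and `v = y / (2 n) ≤ 1 / 2`, so `1 + u ≥ 2 u ≥ 4 u v`: the first two are at least four
  -- times the third.
  have hsum : 5 * (y ^ (2 * (k + 1)) / (2 * (k + 1)).factorial) ≤ Real.exp y := by
    have h1 := Real.sum_le_exp_of_nonneg hy0 (2 * k + 3)
    rw [Finset.sum_range_succ, Finset.sum_range_succ, Finset.sum_range_succ] at h1
    have h0 : 0 ≤ ∑ i ∈ Finset.range (2 * k), y ^ i / (i.factorial : ℝ) :=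
      Finset.sum_nonneg fun i _ => by positivity
    have e1 : y ^ (2 * k + 1) / ((2 * k + 1).factorial : ℝ) =
        y ^ (2 * k) / ((2 * k).factorial : ℝ) * (y / (2 * k + 1)) := by
      rw [Nat.factorial_succ, pow_succ]; push_cast; field_simp
    have e2 : y ^ (2 * k + 2) / ((2 * k + 2).factorial : ℝ) =
        y ^ (2 * k) / ((2 * k).factorial : ℝ) * ((y / (2 * k + 1)) * (y / (2 * k + 2))) := by
      rw [Nat.factorial_succ, Nat.factorial_succ, pow_succ, pow_succ]; push_cast; field_simp; ring
    rw [show 2 * (k + 1) = 2 * k + 2 by ring, e2]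
    rw [e1, e2] at h1
    set a := y ^ (2 * k) / ((2 * k).factorial : ℝ) with ha
    have ha0 : 0 ≤ a := by positivity
    set u := y / (2 * k + 1 : ℝ) with hu
    set v := y / (2 * k + 2 : ℝ) with hv
    have hu0 : 0 ≤ u := by positivity
    have hv0 : 0 ≤ v := by positivity
    have hv1 : v ≤ 1 / 2 := by
      rw [hv, div_le_iff₀ (by positivity)]; push_cast at hyn; linarith
    have hu1 : u ≤ 1 := by
      rw [hu, div_le_one (by positivity)]; push_cast at hyn; linarith
    have h2 : u * v ≤ u * (1 / 2) := mul_le_mul_of_nonneg_left hv1 hu0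
    have h3 : 5 * (u * v) ≤ 1 + u + u * v := by linarith
    have h4 := mul_le_mul_of_nonneg_left h3 ha0
    linarith
  have hexp : Real.exp 1 * 2.8 ≤ 2.8 ^ 2 := by
    have := Real.exp_one_lt_d9; norm_num at this ⊢; linarith
  -- `e ≤ 2.8 ^ 2` is used for `k` factors and `e ≤ 2.8` for the last one, which saves a factor
  -- `2.8`. With the `5` of `hsum` this makes `14`, hence `ε / 7` for twice the term.
  have hpow : 2.8 * Real.exp (k + 1 : ℕ) ≤ (2.8 : ℝ) ^ (2 * (k + 1)) := by
    have h1 : Real.exp 1 ≤ 2.8 ^ 2 := by have := Real.exp_one_lt_d9; norm_num at this ⊢; linarith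
    rw [pow_mul, ← Real.exp_one_pow, pow_succ, pow_succ _ k]
    have h2 : Real.exp 1 ^ k ≤ ((2.8 : ℝ) ^ 2) ^ k := pow_le_pow_left₀ (Real.exp_pos _).le h1 k
    have h3 := mul_le_mul h2 hexp (by positivity) (by positivity)
    linarith
  have hy2 : y ^ (2 * (k + 1)) = 2.8 ^ (2 * (k + 1)) * τ ^ (2 * (k + 1)) := by rw [hy, mul_pow]
  have hT0 : 0 ≤ τ ^ (2 * (k + 1)) / ((2 * (k + 1)).factorial : ℝ) := by positivity
  set T := τ ^ (2 * (k + 1)) / ((2 * (k + 1)).factorial : ℝ) with hT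
  rw [hy2, mul_div_assoc, ← hT] at hsum
  have h5 := mul_le_mul_of_nonneg_right hpow hT0
  have h6 : Real.exp y = Real.exp (y - (k + 1 : ℕ)) * Real.exp (k + 1 : ℕ) := by
    rw [← Real.exp_add]; ring_nf
  have h7 : 5 * (2.8 * Real.exp (k + 1 : ℕ) * T) ≤ ε * Real.exp (k + 1 : ℕ) := by
    refine (mul_le_mul_of_nonneg_left h5 (by norm_num)).trans (hsum.trans ?_)
    rw [h6]
    exact mul_le_mul_of_nonneg_right hε' (Real.exp_pos _).le
  have h8 : (14 * T) * Real.exp (k + 1 : ℕ) ≤ ε * Real.exp (k + 1 : ℕ) := by linarith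
  have h9 := le_of_mul_le_mul_right h8 (Real.exp_pos _)
  linarith

/-- The even and the odd part are the half sum and the half difference of the values at `y` and
`-y`. -/
theorem norm_sum_parity_le {y : ℂ} {n : ℕ} {δ : ℝ} (par : Bool)
    (h : ∀ σ : ℂ, σ = y ∨ σ = -y → ‖∑ k ∈ Finset.range (2 * n), σ ^ k / (k.factorial : ℂ)‖ ≤ δ) :
    ‖∑ i ∈ Finset.range n, y ^ (2 * i + par.toNat) / ((2 * i + par.toNat).factorial : ℂ)‖ ≤ δ := by
  have h1 := h y (Or.inl rfl)
  have h2 := h (-y) (Or.inr rfl)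
  rw [sum_range_two_mul] at h1 h2
  have e0 : ∑ i ∈ Finset.range n, (-y) ^ (2 * i) / ((2 * i).factorial : ℂ) =
      ∑ i ∈ Finset.range n, y ^ (2 * i) / ((2 * i).factorial : ℂ) :=
    Finset.sum_congr rfl fun i _ => by rw [pow_mul, neg_sq, pow_mul]
  have e1 : ∑ i ∈ Finset.range n, (-y) ^ (2 * i + 1) / ((2 * i + 1).factorial : ℂ) =
      -∑ i ∈ Finset.range n, y ^ (2 * i + 1) / ((2 * i + 1).factorial : ℂ) := by
    rw [← Finset.sum_neg_distrib]
    exact Finset.sum_congr rfl fun i _ => by rw [pow_succ, pow_mul, neg_sq, ← pow_mul]; ring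
  rw [e0, e1] at h2
  set a := ∑ i ∈ Finset.range n, y ^ (2 * i) / ((2 * i).factorial : ℂ)
  set b := ∑ i ∈ Finset.range n, y ^ (2 * i + 1) / ((2 * i + 1).factorial : ℂ)
  have hh : ∀ z : ℂ, ‖(2 : ℂ) * z‖ ≤ 2 * δ → ‖z‖ ≤ δ := fun z hz => by
    rw [norm_mul, Complex.norm_ofNat] at hz; linarith
  cases par
  · change ‖a‖ ≤ δ
    refine hh a ?_
    rw [show 2 * a = (a + b) + (a + -b) by ring]
    exact (norm_add_le _ _).trans (by linarith)
  · change ‖b‖ ≤ δ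
    refine hh b ?_
    rw [show 2 * b = (a + b) - (a + -b) by ring]
    exact (norm_sub_le _ _).trans (by linarith)

-- On the circle put `w = z ^ 2`. Then `expPoly` is a phase times `s` times one parity part of the
-- truncated series at `-i τ Re z`. The whole truncated series is within `δ` of a number of modulus
-- `1`, hence bounded by `1 + δ`.
open Polynomial in
theorem norm_eval_expPoly_lt {s τ δ : ℝ} {n : ℕ} (hn : 1 ≤ n) (hτ : 0 ≤ τ)
    (hτn : τ / (2 * n + 1 : ℕ) ≤ 1 / 2) (hδ : 2 * (τ ^ (2 * n) / (2 * n).factorial) ≤ δ)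
    (hs0 : 0 ≤ s) (hs : s * (1 + δ) < 1) (par : Bool) {w : ℂ} (hw : ‖w‖ = 1) :
    ‖(expPoly s τ n par.toNat).eval w‖ < 1 := by
  obtain ⟨z, hz⟩ := IsAlgClosed.exists_pow_nat_eq w (n := 2) two_pos
  have hz1 : ‖z‖ = 1 := by
    have h1 := congrArg norm hz
    rw [norm_pow, hw] at h1
    exact (pow_eq_one_iff_of_nonneg (norm_nonneg z) two_ne_zero).1 h1
  have hzz : z * starRingEnd ℂ z = 1 := by
    rw [Complex.mul_conj, Complex.normSq_eq_norm_sq, hz1]; simp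
  set x := z.re with hx
  have hx1 : |x| ≤ 1 := (Complex.abs_re_le_norm z).trans_eq hz1
  -- This identifies the factor `(1 + X) / 2` of `expPoly` with `z x`, for `x = (z + 1 / z) / 2 = Re
  -- z`.
  have hzx : (1 / 2 : ℂ) * (1 + z ^ 2) = z * x := by
    have h1 : (x : ℂ) = (z + starRingEnd ℂ z) / 2 := by
      rw [Complex.add_conj, hx]; push_cast; ring
    rw [h1]; linear_combination (-1 / 2 : ℂ) * hzz
  set y : ℂ := -(Complex.I * τ) * x with hy
  have heval : (expPoly s τ n par.toNat).eval w = z ^ (2 * (n - 1) + par.toNat) *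
      (s * ∑ i ∈ Finset.range n, y ^ (2 * i + par.toNat) / ((2 * i + par.toNat).factorial : ℂ)) := by
    rw [expPoly, eval_finsetSum, Finset.mul_sum, Finset.mul_sum]
    refine Finset.sum_congr rfl fun i hi => ?_
    have hi' := Finset.mem_range.1 hi
    simp only [eval_mul, eval_C, eval_pow, eval_X, eval_add, eval_one]
    rw [← hz, hzx, mul_pow z, ← mul_assoc ((z ^ 2) ^ _), ← pow_mul, ← pow_add,
      show 2 * (n - 1 - i) + (2 * i + par.toNat) = 2 * (n - 1) + par.toNat by omega, hy,
      mul_pow (-(Complex.I * τ))]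
    ring
  have hbound : ∀ σ : ℂ, σ = y ∨ σ = -y →
      ‖∑ k ∈ Finset.range (2 * n), σ ^ k / (k.factorial : ℂ)‖ ≤ 1 + δ := by
    intro σ hσ
    obtain ⟨x', hx', hσ'⟩ : ∃ x' : ℝ, |x'| ≤ 1 ∧ σ = ((τ * x' : ℝ) : ℂ) * Complex.I := by
      rcases hσ with rfl | rfl
      · exact ⟨-x, by simpa using hx1, by rw [hy]; push_cast; ring⟩
      · exact ⟨x, hx1, by rw [hy]; push_cast; ring⟩
    have hnorm : ‖σ‖ ≤ τ := by
      rw [hσ', norm_mul, Complex.norm_I, mul_one, Complex.norm_real, Real.norm_eq_abs, abs_mul,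
        abs_of_nonneg hτ]
      exact mul_le_of_le_one_right hτ hx'
    have h1 := norm_exp_sub_sum_le (A := σ) hnorm (N := 2 * n) (by omega) hτn
    rw [← Complex.exp_eq_exp_ℂ] at h1
    have h2 : ‖Complex.exp σ‖ = 1 := by rw [hσ', Complex.norm_exp_ofReal_mul_I]
    have h3 : ∑ k ∈ Finset.range (2 * n), (k.factorial : ℂ)⁻¹ • σ ^ k =
        ∑ k ∈ Finset.range (2 * n), σ ^ k / (k.factorial : ℂ) :=
      Finset.sum_congr rfl fun k _ => by rw [smul_eq_mul, div_eq_inv_mul]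
    rw [h3] at h1
    have h4 := norm_sub_norm_le (∑ k ∈ Finset.range (2 * n), σ ^ k / (k.factorial : ℂ))
      (Complex.exp σ)
    rw [norm_sub_rev] at h4
    linarith
  rw [heval, norm_mul, norm_pow, hz1, one_pow, one_mul, norm_mul, Complex.norm_real,
    Real.norm_of_nonneg hs0]
  exact (mul_le_mul_of_nonneg_left (norm_sum_parity_le par hbound) hs0).trans_lt hs

end Taylor

/-! ### The evolution operator and its Taylor polynomial -/

section Evolution

theorem evolution_mem_unitaryGroup {s : ℕ} {H : QOp (Fin s)} (hH : H.IsHermitian) (t : ℝ) :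
    evolution H t ∈ Matrix.unitaryGroup (Fin s → Bool) ℂ := by
  rw [Matrix.mem_unitaryGroup_iff']
  have h1 : ((-(Complex.I * (t : ℂ))) • H)ᴴ = -((-(Complex.I * (t : ℂ))) • H) := by
    rw [Matrix.conjTranspose_smul, hH.eq, ← neg_smul]
    simp
  rw [Matrix.star_eq_conjTranspose, evolution, ← Matrix.exp_conjTranspose, h1, Matrix.exp_neg]
  exact Matrix.nonsing_inv_mul _ ((Matrix.isUnit_iff_isUnit_det _).1 (Matrix.isUnit_exp _))

/-- The truncated Taylor series of `exp (-i H t)` with `2 n` terms. -/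
def taylorEvolution {s : ℕ} (H : QOp (Fin s)) (t : ℝ) (n : ℕ) : QOp (Fin s) :=
  ∑ k ∈ Finset.range (2 * n), (k.factorial : ℂ)⁻¹ • ((-(Complex.I * (t : ℂ))) • H) ^ k

theorem norm_evolution_sub_taylor_le {s n : ℕ} {H : QOp (Fin s)} {α t : ℝ} (hα : ‖H‖ ≤ α)
    (ht : 0 ≤ t) (hn : 1 ≤ n) (hτ : α * t / (2 * n + 1 : ℕ) ≤ 1 / 2) :
    ‖evolution H t - taylorEvolution H t n‖ ≤ 2 * ((α * t) ^ (2 * n) / (2 * n).factorial) := by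
  refine norm_exp_sub_sum_le ?_ (by omega) hτ
  rw [norm_smul, norm_neg, norm_mul, Complex.norm_I, one_mul, Complex.norm_real,
    Real.norm_of_nonneg ht, mul_comm]
  exact mul_le_mul_of_nonneg_right hα ht

end Evolution

/-! ### Matrices that map basis states to basis states -/

section Embed

variable {X Y Z : Type} [DecidableEq Y]

/-- The matrix that maps the basis vector `z` to the basis vector `g z`. -/
def embed (g : Z → Y) : Matrix Y Z ℂ := fun y z => if y = g z then 1 else 0

theorem mul_embed [Fintype Y] (A : Matrix X Y ℂ) (g : Z → Y) :
    A * embed g = fun x z => A x (g z) := by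
  ext x z; simp [Matrix.mul_apply, embed]

theorem conjTranspose_embed_mul [Fintype Y] (g : Z → Y) (A : Matrix Y X ℂ) :
    (embed g)ᴴ * A = fun z x => A (g z) x := by
  ext x z
  simp [Matrix.mul_apply, embed, Matrix.conjTranspose_apply, apply_ite (starRingEnd ℂ)]

theorem embed_isometry [Fintype Y] [DecidableEq Z] {g : Z → Y} (hg : Function.Injective g) :
    (embed g)ᴴ * embed g = 1 := by
  rw [mul_embed]
  ext x z
  simp [Matrix.conjTranspose_apply, embed, Matrix.one_apply, hg.eq_iff,
    apply_ite (starRingEnd ℂ), eq_comm]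

theorem embed_mul_embed [Fintype Y] {W : Type} [DecidableEq W] (h : Y → W) (g : Z → Y) :
    embed h * embed g = embed (h ∘ g) := by
  rw [mul_embed]; rfl

end Embed

/-! ### Action of gates on columns, and controlled gates -/

section Registers

theorem unitary_column {n : Type} [Fintype n] [DecidableEq n] (u : Matrix.unitaryGroup n ℂ)
    (i j : n) : ∑ k, star (u.1 k i) * u.1 k j = if i = j then 1 else 0 := by
  have := congrFun (congrFun (Matrix.mem_unitaryGroup_iff'.1 u.2) i) j
  simpa only [Matrix.mul_apply, Matrix.one_apply, Matrix.star_apply] using this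

variable {ι : Type} [Fintype ι] [DecidableEq ι]

theorem one_toOp_apply (q : ι) (u : Matrix.unitaryGroup Bool ℂ) (x y : ι → Bool) :
    (Gate.one q u).toOp x y = if ∀ i, i ≠ q → x i = y i then u.1 (x q) (y q) else 0 := rfl

theorem two_toOp_apply {p q : ι} (hpq : p ≠ q) (u : Matrix.unitaryGroup (Bool × Bool) ℂ)
    (x y : ι → Bool) : (Gate.two p q hpq u).toOp x y =
      if ∀ i, i ≠ p → i ≠ q → x i = y i then u.1 (x p, x q) (y p, y q) else 0 := rfl

/-- A two-qubit gate mixes only four basis states, so a column of `A` times the gate combines four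
columns of `A`. Circuits are evaluated with such column rules. -/
theorem two_column {p q : ι} (hpq : p ≠ q) (u : Matrix.unitaryGroup (Bool × Bool) ℂ) {X : Type}
    (A : Matrix X (ι → Bool) ℂ) (x : X) (z : ι → Bool) :
    (A * (Gate.two p q hpq u).toOp) x z = ∑ e : Bool × Bool,
      u.1 e (z p, z q) * A x (Function.update (Function.update z p e.1) q e.2) := by
  have h : ∀ y, (Gate.two p q hpq u).toOp y z = ∑ e : Bool × Bool,
      if y = Function.update (Function.update z p e.1) q e.2 then u.1 e (z p, z q) else 0 := by
    intro y
    rw [Finset.sum_eq_single (y p, y q)]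
    · simp only [Gate.toOp]
      congr 1
      rw [eq_iff_iff, Function.eq_update_iff]
      refine ⟨fun h => ⟨rfl, fun i hi => ?_⟩, fun h i hip hiq => ?_⟩
      · by_cases hip : i = p
        · subst hip; simp
        · rw [Function.update_of_ne hip, h i hip hi]
      · rw [h.2 i hiq, Function.update_of_ne hip]
    · intro e _ he
      rw [if_neg]
      rintro rfl
      apply he
      simp [Function.update_of_ne hpq]
    · simp
  simp only [Matrix.mul_apply, h, Finset.mul_sum, mul_ite, mul_zero]
  rw [Finset.sum_comm]
  refine Finset.sum_congr rfl fun e _ => ?_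
  rw [Finset.sum_ite_eq' Finset.univ]
  simp [mul_comm]

theorem one_column (q : ι) (u : Matrix.unitaryGroup Bool ℂ) {X : Type}
    (A : Matrix X (ι → Bool) ℂ) (x : X) (z : ι → Bool) :
    (A * (Gate.one q u).toOp) x z = ∑ e : Bool,
      u.1 e (z q) * A x (Function.update z q e) := by
  have h : ∀ y, (Gate.one q u).toOp y z = ∑ e : Bool,
      if y = Function.update z q e then u.1 e (z q) else 0 := by
    intro y
    rw [Finset.sum_eq_single (y q)]
    · simp only [Gate.toOp]
      congr 1
      rw [eq_iff_iff, Function.eq_update_iff]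
      exact ⟨fun h => ⟨rfl, h⟩, fun h => h.2⟩
    · intro e _ he
      rw [if_neg]
      rintro rfl
      apply he
      simp
    · simp
  simp only [Matrix.mul_apply, h, Finset.mul_sum, mul_ite, mul_zero]
  rw [Finset.sum_comm]
  refine Finset.sum_congr rfl fun e _ => ?_
  rw [Finset.sum_ite_eq' Finset.univ]
  simp [mul_comm]

theorem gate_toOp_mem_unitaryGroup (g : Gate ι) :
    g.toOp ∈ Matrix.unitaryGroup (ι → Bool) ℂ := by
  rw [Matrix.mem_unitaryGroup_iff', Matrix.star_eq_conjTranspose]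
  cases g with
  | one q u =>
    ext x z
    rw [one_column]
    have hc : ∀ e, ((Gate.one q u).toOp)ᴴ x (Function.update z q e) =
        if ∀ i, i ≠ q → z i = x i then star (u.1 e (x q)) else 0 := by
      intro e
      rw [Matrix.conjTranspose_apply, one_toOp_apply, Function.update_self]
      have : (∀ i, i ≠ q → Function.update z q e i = x i) ↔ (∀ i, i ≠ q → z i = x i) :=
        forall_congr' fun i => forall_congr' fun hi => by rw [Function.update_of_ne hi]
      simp only [this]
      split_ifs <;> simp
    simp only [hc, mul_ite, mul_zero, Matrix.one_apply]
    by_cases h : ∀ i, i ≠ q → z i = x i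
    · simp only [if_pos h, mul_comm (u.1 _ (z q)), unitary_column]
      congr 1
      rw [eq_iff_iff]
      refine ⟨fun hq => funext fun i => ?_, fun hx => by rw [hx]⟩
      by_cases hi : i = q
      · rw [hi, hq]
      · exact (h i hi).symm
    · simp only [if_neg h, Finset.sum_const_zero]
      rw [if_neg]
      rintro rfl
      exact h fun _ _ => rfl
  | two p q hpq u =>
    ext x z
    rw [two_column]
    have hc : ∀ e : Bool × Bool, ((Gate.two p q hpq u).toOp)ᴴ x
        (Function.update (Function.update z p e.1) q e.2) =
        if ∀ i, i ≠ p → i ≠ q → z i = x i then star (u.1 e (x p, x q)) else 0 := by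
      intro e
      rw [Matrix.conjTranspose_apply, two_toOp_apply, Function.update_self, Function.update_of_ne hpq,
        Function.update_self]
      have : (∀ i, i ≠ p → i ≠ q → Function.update (Function.update z p e.1) q e.2 i = x i) ↔
          (∀ i, i ≠ p → i ≠ q → z i = x i) :=
        forall_congr' fun i => forall_congr' fun hi => forall_congr' fun hi' => by
          rw [Function.update_of_ne hi', Function.update_of_ne hi]
      simp only [this]
      split_ifs <;> simp
    simp only [hc, mul_ite, mul_zero, Matrix.one_apply]
    by_cases h : ∀ i, i ≠ p → i ≠ q → z i = x i
    · simp only [if_pos h, mul_comm (u.1 _ (z p, z q)), unitary_column]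
      congr 1
      rw [eq_iff_iff]
      refine ⟨fun hq => funext fun i => ?_, fun hx => by rw [hx]⟩
      rw [Prod.mk.injEq] at hq
      by_cases hi : i = p
      · rw [hi, hq.1]
      by_cases hi' : i = q
      · rw [hi', hq.2]
      · exact (h i hi hi').symm
    · simp only [if_neg h, Finset.sum_const_zero]
      rw [if_neg]
      rintro rfl
      exact h fun _ _ _ => rfl

/-- The unitary on two qubits that applies `k x` to the second one if the first one is `x`. -/
def controlled (k : Bool → Matrix.unitaryGroup Bool ℂ) : Matrix.unitaryGroup (Bool × Bool) ℂ :=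
  ⟨Matrix.of fun e f => if e.1 = f.1 then (k f.1).1 e.2 f.2 else 0, by
    rw [Matrix.mem_unitaryGroup_iff', Matrix.star_eq_conjTranspose]
    ext ⟨i, j⟩ ⟨i', j'⟩
    simp only [Matrix.mul_apply, Matrix.conjTranspose_apply, Fintype.sum_prod_type,
      Matrix.one_apply, Prod.mk.injEq, Matrix.of_apply]
    by_cases h : i = i'
    · subst h
      rw [Finset.sum_eq_single i]
      · simpa using unitary_column (k i) j j'
      · intro b _ hb; simp [hb]
      · simp
    · rw [if_neg (fun hh => h hh.1)]
      refine Finset.sum_eq_zero fun b _ => Finset.sum_eq_zero fun c _ => ?_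
      by_cases hb : b = i
      · subst hb; simp [h]
      · simp [hb]⟩

/-- The gate that applies `k x` to qubit `t` if qubit `p` is `x`. -/
def ctrl (p t : ι) (k : Bool → Matrix.unitaryGroup Bool ℂ) : Gate ι :=
  -- The case `p = t` is a filler that makes the definition total; the rules for its action assume
  -- `p ≠ t`.
  if h : p = t then .one t 1 else .two p t h (controlled k)

theorem ctrl_column {p t : ι} (hpt : p ≠ t) (k : Bool → Matrix.unitaryGroup Bool ℂ) {X : Type}
    (A : Matrix X (ι → Bool) ℂ) (x : X) (z : ι → Bool) :
    (A * (ctrl p t k).toOp) x z = ∑ e : Bool,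
      (k (z p)).1 e (z t) * A x (Function.update z t e) := by
  rw [ctrl, dif_neg hpt, two_column, Fintype.sum_prod_type, Finset.sum_eq_single (z p)]
  · simp [controlled]
  · intro b _ hb; simp [controlled, hb]
  · simp

theorem ctrl_toOp_apply {p t : ι} (hpt : p ≠ t) (k : Bool → Matrix.unitaryGroup Bool ℂ)
    (y : ι → Bool) (x : ι → Bool) : (ctrl p t k).toOp x y =
      ∑ e : Bool, (k (y p)).1 e (y t) * if x = Function.update y t e then 1 else 0 := by
  have := ctrl_column hpt k (1 : QOp ι) x y
  rw [Matrix.one_mul] at this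
  simpa [Matrix.one_apply] using this

end Registers

/-! ### Particular one-qubit gates -/

section OneQubit

/-- The amplitude `1 / √2`. -/
def sqrtHalf : ℝ := √2 / 2

theorem sqrtHalf_sq : sqrtHalf ^ 2 = 1 / 2 := by
  rw [sqrtHalf, div_pow, Real.sq_sqrt two_pos.le]; norm_num

theorem sqrtHalf_mul_self : (sqrtHalf : ℂ) * sqrtHalf = 1 / 2 := by
  rw [← Complex.ofReal_mul, ← sq, sqrtHalf_sq]; norm_num

/-- The diagonal gate with signs `-1` on the basis states selected by `f`. -/
def signGate (f : Bool → Bool) : Matrix.unitaryGroup Bool ℂ :=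
  ⟨Matrix.diagonal fun b => if f b then -1 else 1, by
    rw [Matrix.mem_unitaryGroup_iff]
    ext i j
    rw [Matrix.star_eq_conjTranspose, Matrix.diagonal_conjTranspose, Matrix.diagonal_mul_diagonal,
      ← Matrix.diagonal_one]
    congr 1
    ext b
    by_cases h : f b <;> simp [h]⟩

/-- The gate with first column `(r, √(1 - r ^ 2))`. -/
def rotation (r : ℝ) (hr : |r| ≤ 1) : Matrix.unitaryGroup Bool ℂ :=
  ⟨columnMatrix r (√(1 - r ^ 2) : ℝ), columnMatrix_mem (by
    have : r ^ 2 ≤ 1 := by rw [← sq_abs]; exact pow_le_one₀ (abs_nonneg r) hr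
    rw [Complex.norm_real, Complex.norm_real, Real.norm_eq_abs, Real.norm_eq_abs, sq_abs, sq_abs,
      Real.sq_sqrt (by linarith)]
    ring)⟩

/-- The bit flip. -/
def bitFlip : Matrix.unitaryGroup Bool ℂ :=
  ⟨columnMatrix 0 1, columnMatrix_mem (by simp)⟩ * signGate id

theorem bitFlip_apply (i j : Bool) : bitFlip.1 i j = if i = !j then 1 else 0 := by
  cases i <;> cases j <;> simp [bitFlip, signGate, columnMatrix]

/-- The Hadamard gate. -/
def hadamard : Matrix.unitaryGroup Bool ℂ :=
  ⟨columnMatrix sqrtHalf sqrtHalf, columnMatrix_mem (by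
    rw [Complex.norm_real, Real.norm_eq_abs, sq_abs, sqrtHalf_sq]; norm_num)⟩ * signGate id

theorem hadamard_apply (i j : Bool) :
    hadamard.1 i j = sqrtHalf * (if i && j then -1 else 1) := by
  cases i <;> cases j <;> simp [hadamard, signGate, columnMatrix, Complex.conj_ofReal]

end OneQubit

/-! ### Composition, adjoints and unitarity of simulation circuits -/

section Programs

variable {b a s : ℕ}

theorem toOp_append (U : QOp (Fin a ⊕ Fin s)) (P Q : Program b a s) :
    Program.toOp U (P ++ Q) = Program.toOp U Q * Program.toOp U P := by
  induction P with
  | nil => simp [Program.toOp]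
  | cons st P ih =>
    change Program.toOp U (P ++ Q) * st.toOp U = _
    rw [ih, Matrix.mul_assoc]; rfl

theorem toOp_singleton (U : QOp (Fin a ⊕ Fin s)) (st : Step b a s) :
    Program.toOp U [st] = st.toOp U := by
  change 1 * _ = _
  rw [Matrix.one_mul]

theorem calls_append (P Q : Program b a s) :
    Program.calls (P ++ Q) = Program.calls P + Program.calls Q := by
  induction P with
  | nil => simp [Program.calls]
  | cons st P ih =>
    cases st
    · exact ih
    · change Program.calls (P ++ Q) + 1 = (Program.calls P + 1) + _
      omega

theorem otherGates_append (P Q : Program b a s) :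
    Program.otherGates (P ++ Q) = Program.otherGates P + Program.otherGates Q := by
  induction P with
  | nil => simp [Program.otherGates]
  | cons st P ih =>
    cases st
    · change Program.otherGates (P ++ Q) + 1 = (Program.otherGates P + 1) + _
      omega
    · exact ih

/-- The adjoint of a step. -/
def Step.inv : Step b a s → Step b a s
  | .gate (.one q u) => .gate (.one q u⁻¹)
  | .gate (.two p q h u) => .gate (.two p q h u⁻¹)
  | .call c adj => .call c (!adj)

/-- The adjoint of a simulation circuit. -/
def Program.inv : Program b a s → Program b a s
  | [] => []
  | st :: P => Program.inv P ++ [st.inv]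

theorem call_toOp_apply (U : QOp (Fin a ⊕ Fin s)) (c : Fin b) (adj : Bool)
    (x y : Wires b a s → Bool) : (Step.call c adj).toOp U x y =
      if ∀ i : Fin b, x (Sum.inl (Sum.inl i)) = y (Sum.inl (Sum.inl i)) then
        (if y (Sum.inl (Sum.inl c)) = true then queryOp U adj else 1) (bePart x) (bePart y)
      else 0 := by
  simp only [Step.toOp, queryOp]
  split_ifs <;> rfl

theorem step_toOp_inv (U : QOp (Fin a ⊕ Fin s)) (st : Step b a s) :
    st.inv.toOp U = (st.toOp U)ᴴ := by
  ext x y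
  rw [Matrix.conjTranspose_apply]
  cases st with
  | gate g =>
    cases g with
    | one q u =>
      simp only [Step.inv, Step.toOp, Gate.toOp]
      rw [apply_ite star, star_zero]
      congr 1
      exact propext (forall_congr' fun i => forall_congr' fun _ => eq_comm)
    | two p q h u =>
      simp only [Step.inv, Step.toOp, Gate.toOp]
      rw [apply_ite star, star_zero]
      congr 1
      exact propext (forall_congr' fun i => forall_congr' fun _ => forall_congr' fun _ => eq_comm)
  | call c adj =>
    rw [Step.inv, call_toOp_apply, call_toOp_apply]
    by_cases h : ∀ i : Fin b, x (Sum.inl (Sum.inl i)) = y (Sum.inl (Sum.inl i))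
    · rw [if_pos h, if_pos fun i => (h i).symm, h c, ← Matrix.conjTranspose_apply]
      split_ifs
      · cases adj <;> simp [queryOp]
      · rw [Matrix.conjTranspose_one]
    · rw [if_neg h, if_neg fun h' => h fun i => (h' i).symm, star_zero]

theorem toOp_inv (U : QOp (Fin a ⊕ Fin s)) (P : Program b a s) :
    Program.toOp U (Program.inv P) = (Program.toOp U P)ᴴ := by
  induction P with
  | nil => simp [Program.inv, Program.toOp]
  | cons st P ih =>
    rw [Program.inv, toOp_append, ih, toOp_singleton, step_toOp_inv, Program.toOp,
      Matrix.conjTranspose_mul]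

theorem calls_inv (P : Program b a s) : Program.calls (Program.inv P) = Program.calls P := by
  induction P with
  | nil => rfl
  | cons st P ih =>
    rw [Program.inv, calls_append, ih]
    rcases st with (_ | _) | _ <;> rfl

theorem otherGates_inv (P : Program b a s) :
    Program.otherGates (Program.inv P) = Program.otherGates P := by
  induction P with
  | nil => rfl
  | cons st P ih =>
    rw [Program.inv, otherGates_append, ih]
    rcases st with (_ | _) | _ <;> rfl

/-- The basis state with further ancillas in the state `f` and the other qubits in the
state `x`. -/
def join (f : Fin b → Bool) (x : Fin a ⊕ Fin s → Bool) : Wires b a s → Bool :=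
  Sum.elim (Sum.elim f fun i => x (Sum.inl i)) fun i => x (Sum.inr i)

theorem eq_join_iff {z : Wires b a s → Bool} {f : Fin b → Bool} {x : Fin a ⊕ Fin s → Bool} :
    z = join f x ↔ (∀ i, z (Sum.inl (Sum.inl i)) = f i) ∧ bePart z = x := by
  constructor
  · rintro rfl
    refine ⟨fun i => rfl, ?_⟩
    ext (i | i) <;> rfl
  · rintro ⟨h, rfl⟩
    ext ((i | i) | i)
    · exact h i
    · rfl
    · rfl

theorem bePart_join (f : Fin b → Bool) (x : Fin a ⊕ Fin s → Bool) :
    bePart (join f x) = x := (eq_join_iff.1 rfl).2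

theorem join_inj {f g : Fin b → Bool} {x y : Fin a ⊕ Fin s → Bool} :
    join f x = join g y ↔ f = g ∧ x = y := by
  rw [eq_join_iff, bePart_join]
  exact (funext_iff (f := f) (g := g)).symm.and Iff.rfl

theorem update_join (f : Fin b → Bool) (x : Fin a ⊕ Fin s → Bool) (t : Fin b) (v : Bool) :
    Function.update (join f x) (Sum.inl (Sum.inl t)) v = join (Function.update f t v) x := by
  rw [eq_join_iff]
  refine ⟨fun i => ?_, ?_⟩
  · by_cases h : i = t
    · subst h; simp
    · rw [Function.update_of_ne (by simpa using h), Function.update_of_ne h]; rfl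
  · ext (i | i) <;> rfl

/-- The isometry that adds further ancillas in the state `f`. -/
def adjoin (a s : ℕ) (f : Fin b → Bool) : Matrix (Wires b a s → Bool) (Fin a ⊕ Fin s → Bool) ℂ :=
  embed (join f)

theorem conjTranspose_adjoin_mul_adjoin (f g : Fin b → Bool) :
    (adjoin a s f)ᴴ * adjoin a s g = if f = g then 1 else 0 := by
  rw [adjoin, adjoin, mul_embed]
  ext x y
  by_cases h : f = g <;>
  simp [Matrix.conjTranspose_apply, embed, join_inj, h, Matrix.one_apply, eq_comm,
    apply_ite (starRingEnd ℂ)]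

/-- On a fixed state of the further ancillas a controlled call is just the query or the identity.
This turns circuit identities into identities on the register of the block-encoding. -/
theorem call_mul_adjoin (U : QOp (Fin a ⊕ Fin s)) (c : Fin b) (adj : Bool) (f : Fin b → Bool) :
    (Step.call c adj).toOp U * adjoin a s f =
      adjoin a s f * if f c = true then queryOp U adj else 1 := by
  rw [adjoin, mul_embed]
  ext x y
  rw [Matrix.mul_apply]
  have hj : ∀ i : Fin b, join f y (Sum.inl (Sum.inl i)) = f i := fun i => rfl
  simp only [embed, eq_join_iff, call_toOp_apply, bePart_join, ite_mul, one_mul, zero_mul, hj,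
    ite_and]
  by_cases h : ∀ i : Fin b, x (Sum.inl (Sum.inl i)) = f i
  · simp only [if_pos h]
    rw [Finset.sum_ite_eq Finset.univ]
    simp
  · simp only [if_neg h, Finset.sum_const_zero]

theorem step_toOp_mem_unitaryGroup {U : QOp (Fin a ⊕ Fin s)}
    (hU : U ∈ Matrix.unitaryGroup (Fin a ⊕ Fin s → Bool) ℂ) (st : Step b a s) :
    st.toOp U ∈ Matrix.unitaryGroup (Wires b a s → Bool) ℂ := by
  cases st with
  | gate g => exact gate_toOp_mem_unitaryGroup g
  | call c adj =>
    rw [Matrix.mem_unitaryGroup_iff', Matrix.star_eq_conjTranspose, ← step_toOp_inv]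
    ext x z
    -- Each basis state is a column of some `adjoin a s f`, so unitarity can be checked on these
    -- isometries.
    have hz : z = join (fun i => z (Sum.inl (Sum.inl i))) (bePart z) :=
      eq_join_iff.2 ⟨fun _ => rfl, rfl⟩
    set f : Fin b → Bool := fun i => z (Sum.inl (Sum.inl i)) with hf
    have h1 : (Step.inv (.call c adj)).toOp U * (Step.call (a := a) (s := s) c adj).toOp U *
        adjoin a s f = adjoin a s f := by
      rw [Matrix.mul_assoc, call_mul_adjoin, ← Matrix.mul_assoc, Step.inv, call_mul_adjoin,
        Matrix.mul_assoc]
      split_ifs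
      · rw [queryOp_not_mul hU, Matrix.mul_one]
      · simp
    have h2 := congrFun (congrFun h1 x) (bePart z)
    rw [adjoin, mul_embed] at h2
    simp only [← hz] at h2
    rw [h2, Matrix.one_apply]
    simp only [embed, ← hz]

theorem toOp_mem_unitaryGroup {U : QOp (Fin a ⊕ Fin s)}
    (hU : U ∈ Matrix.unitaryGroup (Fin a ⊕ Fin s → Bool) ℂ) (P : Program b a s) :
    Program.toOp U P ∈ Matrix.unitaryGroup (Wires b a s → Bool) ℂ := by
  induction P with
  | nil => exact one_mem _
  | cons st P ih => exact mul_mem ih (step_toOp_mem_unitaryGroup hU st)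

end Programs

/-! ### Conjunctions on clean work qubits, from two-qubit gates -/

section Ladder

variable {b a s : ℕ}

/-- Computes the conjunction of qubit `p` and the negation of qubit `q` into the clean qubit `t`. -/
def andNot (p q t : Wires b a s) : Program b a s :=
  [.gate (ctrl p t fun v => if v then hadamard else 1),
   .gate (ctrl q t fun v => if v then 1 else signGate id),
   .gate (ctrl p t fun v => if v then hadamard else 1)]

/-- If `p` is `1`, the Hadamard gates turn the sign flip, made when `q` is `0`, into a bit flip of
`t`. If `p` is `0`, only the sign gate can act, and it fixes `|0⟩`. Cleanness of `t` is what makes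
two-qubit gates sufficient. -/
theorem andNot_mul_embed {p q t : Wires b a s} (hp : p ≠ t) (hq : q ≠ t)
    (U : QOp (Fin a ⊕ Fin s)) {Z : Type} (g : Z → Wires b a s → Bool) (hg : ∀ z, g z t = false) :
    Program.toOp U (andNot p q t) * embed g =
      embed fun z => Function.update (g z) t (g z p && !(g z q)) := by
  rw [mul_embed]
  ext x z
  simp only [andNot, Program.toOp, Step.toOp, Matrix.one_mul]
  simp only [ctrl_column hp, ctrl_column hq, ctrl_toOp_apply hp, Fintype.sum_bool,
    Function.update_self, Function.update_of_ne hp, Function.update_of_ne hq,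
    Function.update_idem, hg z, embed]
  have h2 := sqrtHalf_mul_self
  obtain hpz | hpz := Bool.eq_false_or_eq_true (g z p) <;>
  obtain hqz | hqz := Bool.eq_false_or_eq_true (g z q) <;>
  simp only [hpz, hqz, Bool.not_true, Bool.not_false, Bool.and_true, Bool.and_false] <;>
  generalize (if x = Function.update (g z) t true then (1 : ℂ) else 0) = c1 <;>
  generalize (if x = Function.update (g z) t false then (1 : ℂ) else 0) = c0 <;>
  simp [hadamard_apply, signGate]
  · linear_combination 2 * c0 * h2
  · linear_combination 2 * c1 * h2

/-- Computes the conjunction of qubit `p` and the negations of the qubits `q`, for the pairs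
`(q, t)` of the list, into the last of the clean qubits `t`. -/
def ladder (p : Wires b a s) : List (Wires b a s × Wires b a s) → Program b a s
  | [] => []
  | (q, t) :: L => andNot p q t ++ ladder t L

/-- The qubit that holds the result of `ladder p L`. -/
def ladderFlag (p : Wires b a s) : List (Wires b a s × Wires b a s) → Wires b a s
  | [] => p
  | (_, t) :: L => ladderFlag t L

/-- The action of `ladder p L` on basis states. -/
def ladderEval (p : Wires b a s) :
    List (Wires b a s × Wires b a s) → (Wires b a s → Bool) → Wires b a s → Bool
  | [], y => y
  | (q, t) :: L, y => ladderEval t L (Function.update y t (y p && !(y q)))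

/-- The targets of the ladder are distinct, and different from its controls. -/
structure LadderOK (p : Wires b a s) (L : List (Wires b a s × Wires b a s)) : Prop where
  nodup : (L.map Prod.snd).Nodup
  head : p ∉ L.map Prod.snd
  control : ∀ e ∈ L, e.1 ∉ L.map Prod.snd

theorem LadderOK.tail {p q t : Wires b a s} {L : List (Wires b a s × Wires b a s)}
    (h : LadderOK p ((q, t) :: L)) : LadderOK t L := by
  obtain ⟨h1, h2, h3⟩ := h
  rw [List.map_cons, List.nodup_cons] at h1
  refine ⟨h1.2, h1.1, fun e he => ?_⟩
  have := h3 e (List.mem_cons_of_mem _ he)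
  rw [List.map_cons, List.mem_cons, not_or] at this
  exact this.2

theorem LadderOK.ne {p q t : Wires b a s} {L : List (Wires b a s × Wires b a s)}
    (h : LadderOK p ((q, t) :: L)) : p ≠ t ∧ q ≠ t ∧ ∀ e ∈ L, e.1 ≠ t := by
  obtain ⟨h1, h2, h3⟩ := h
  simp only [List.map_cons, List.mem_cons, not_or] at h2 h3
  exact ⟨h2.1, (h3 (q, t) (Or.inl rfl)).1, fun e he => (h3 e (Or.inr he)).1⟩

theorem ladder_mul_embed (U : QOp (Fin a ⊕ Fin s)) {Z : Type}
    (L : List (Wires b a s × Wires b a s)) :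
    ∀ (p : Wires b a s) (g : Z → Wires b a s → Bool), LadderOK p L →
      (∀ z, ∀ e ∈ L, g z e.2 = false) →
      Program.toOp U (ladder p L) * embed g = embed fun z => ladderEval p L (g z) := by
  induction L with
  | nil => intro p g _ _; simp [ladder, Program.toOp, ladderEval]
  | cons e L ih =>
    obtain ⟨q, t⟩ := e
    intro p g hL hg
    obtain ⟨hp, hq, -⟩ := hL.ne
    have hz := fun z => hg z (q, t) List.mem_cons_self
    rw [ladder, toOp_append, Matrix.mul_assoc, andNot_mul_embed hp hq U g hz]
    refine ih t _ hL.tail fun z e he => ?_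
    have hne : e.2 ≠ t := by
      rintro rfl
      exact hL.tail.head (List.mem_map_of_mem he)
    rw [Function.update_of_ne hne]
    exact hg z e (List.mem_cons_of_mem _ he)

theorem ladderEval_of_notMem (L : List (Wires b a s × Wires b a s)) :
    ∀ (p : Wires b a s) (y : Wires b a s → Bool) (i : Wires b a s), i ∉ L.map Prod.snd →
      ladderEval p L y i = y i := by
  induction L with
  | nil => intros; rfl
  | cons e L ih =>
    intro p y i hi
    rw [List.map_cons, List.mem_cons, not_or] at hi
    rw [ladderEval, ih _ _ _ hi.2, Function.update_of_ne hi.1]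

theorem ladderEval_flag (L : List (Wires b a s × Wires b a s)) :
    ∀ (p : Wires b a s) (y : Wires b a s → Bool), LadderOK p L →
      ladderEval p L y (ladderFlag p L) = (y p && L.all fun e => !(y e.1)) := by
  induction L with
  | nil => intros; simp [ladderEval, ladderFlag]
  | cons e L ih =>
    obtain ⟨q, t⟩ := e
    intro p y hL
    rw [ladderEval, ladderFlag, ih _ _ hL.tail, Function.update_self, List.all_cons, Bool.and_assoc]
    congr 2
    rw [Bool.eq_iff_iff, List.all_eq_true, List.all_eq_true]
    exact forall_congr' fun e => forall_congr' fun he => by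
      rw [Function.update_of_ne (hL.ne.2.2 e he)]

theorem ladderFlag_mem (L : List (Wires b a s × Wires b a s)) :
    ∀ p : Wires b a s, ladderFlag p L = p ∨ ladderFlag p L ∈ L.map Prod.snd := by
  induction L with
  | nil => intro p; exact Or.inl rfl
  | cons e L ih =>
    intro p
    rw [ladderFlag, List.map_cons, List.mem_cons]
    exact Or.inr (ih _)

/-- Flips the sign depending on qubit `t` and the conjunction computed by `ladder p L`. -/
def flagSign (p : Wires b a s) (L : List (Wires b a s × Wires b a s)) (t : Wires b a s)
    (f : Bool → Bool → Bool) : Program b a s :=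
  ladder p L ++ [.gate (ctrl (ladderFlag p L) t fun v => signGate (f v))] ++
    Program.inv (ladder p L)

/-- The ladder sends the given basis states to basis states with the conjunction in the flag, where
the sign gate is diagonal; the adjoint ladder restores the work qubits. As `t` is no target of the
ladder, its value is the original one. -/
theorem flagSign_mul_embed {U : QOp (Fin a ⊕ Fin s)}
    (hU : U ∈ Matrix.unitaryGroup (Fin a ⊕ Fin s → Bool) ℂ) {p t : Wires b a s}
    {L : List (Wires b a s × Wires b a s)} (hL : LadderOK p L) (htp : t ≠ p)
    (ht : t ∉ L.map Prod.snd) (f : Bool → Bool → Bool) {Z : Type} [Fintype Z] [DecidableEq Z]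
    (g : Z → Wires b a s → Bool) (hg : ∀ z, ∀ e ∈ L, g z e.2 = false) :
    Program.toOp U (flagSign p L t f) * embed g = embed g * Matrix.diagonal fun z =>
      if f (g z p && L.all fun e => !(g z e.1)) (g z t) then (-1 : ℂ) else 1 := by
  have hft : ladderFlag p L ≠ t := by
    rcases ladderFlag_mem L p with h | h
    · rw [h]; exact htp.symm
    · rintro rfl; exact ht h
  have hgate : (ctrl (ladderFlag p L) t fun v => signGate (f v)).toOp *
      embed (fun z => ladderEval p L (g z)) = embed (fun z => ladderEval p L (g z)) *
      Matrix.diagonal fun z =>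
        if f (g z p && L.all fun e => !(g z e.1)) (g z t) then (-1 : ℂ) else 1 := by
    rw [mul_embed]
    ext x z
    rw [ctrl_toOp_apply hft, ladderEval_flag L p _ hL, Matrix.mul_diagonal,
      Finset.sum_eq_single (ladderEval p L (g z) t), Function.update_eq_self,
      ladderEval_of_notMem L p _ t ht]
    · simp [signGate, embed, mul_comm]
    · intro e _ he; simp [signGate, he]
    · simp
  have h1 : (Program.toOp U (ladder p L))ᴴ * Program.toOp U (ladder p L) = 1 :=
    Matrix.mem_unitaryGroup_iff'.1 (toOp_mem_unitaryGroup hU _)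
  rw [flagSign, toOp_append, toOp_append, toOp_singleton, toOp_inv, Matrix.mul_assoc,
    Matrix.mul_assoc, ladder_mul_embed U L p g hL hg, Step.toOp, hgate, ← Matrix.mul_assoc,
    ← ladder_mul_embed U L p g hL hg, ← Matrix.mul_assoc, h1, Matrix.one_mul]

theorem calls_ladder (L : List (Wires b a s × Wires b a s)) :
    ∀ p, Program.calls (ladder p L) = 0 := by
  induction L with
  | nil => intro p; rfl
  | cons e L ih => intro p; rw [ladder, calls_append, ih]; rfl

theorem otherGates_ladder (L : List (Wires b a s × Wires b a s)) :
    ∀ p, Program.otherGates (ladder p L) = 3 * L.length := by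
  induction L with
  | nil => intro p; rfl
  | cons e L ih =>
    intro p
    rw [ladder, otherGates_append, ih, List.length_cons]
    simp only [andNot, Program.otherGates]
    omega

theorem calls_flagSign (p : Wires b a s) (L : List (Wires b a s × Wires b a s))
    (t : Wires b a s) (f : Bool → Bool → Bool) : Program.calls (flagSign p L t f) = 0 := by
  rw [flagSign, calls_append, calls_append, calls_inv, calls_ladder]; rfl

theorem otherGates_flagSign (p : Wires b a s) (L : List (Wires b a s × Wires b a s))
    (t : Wires b a s) (f : Bool → Bool → Bool) :
    Program.otherGates (flagSign p L t f) = 6 * L.length + 1 := by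
  rw [flagSign, otherGates_append, otherGates_append, otherGates_inv, otherGates_ladder]
  simp only [Program.otherGates]
  omega

end Ladder

/-! ### The projection onto zero ancillas and its reflection -/

section ZeroBlock

variable {κ σ : Type} [Fintype κ] [DecidableEq κ] [Fintype σ] [DecidableEq σ]

/-- The isometry that adds ancillas in the state `0`. -/
def zeroEmb (κ σ : Type) [Fintype κ] [DecidableEq κ] [Fintype σ] [DecidableEq σ] :
    Matrix (κ ⊕ σ → Bool) (σ → Bool) ℂ :=
  embed fun x => Sum.elim (fun _ => false) x

theorem zeroEmb_isometry : (zeroEmb κ σ)ᴴ * zeroEmb κ σ = 1 :=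
  embed_isometry fun _ _ h => funext fun i => congrFun h (Sum.inr i)

theorem zeroBlock_eq (U : QOp (κ ⊕ σ)) : zeroBlock U = (zeroEmb κ σ)ᴴ * (U * zeroEmb κ σ) := by
  rw [zeroEmb, conjTranspose_embed_mul, mul_embed]; rfl

theorem reflection_zeroEmb : reflection (zeroEmb κ σ) =
    Matrix.diagonal fun x => if ∀ i, x (Sum.inl i) = false then 1 else -1 := by
  have h : zeroEmb κ σ * (zeroEmb κ σ)ᴴ =
      Matrix.diagonal fun x => if ∀ i, x (Sum.inl i) = false then 1 else 0 := by
    ext x y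
    simp only [Matrix.mul_apply, zeroEmb, embed, Matrix.conjTranspose_apply, Matrix.diagonal_apply]
    rw [Finset.sum_eq_single fun i => x (Sum.inr i)]
    · by_cases hx : ∀ i, x (Sum.inl i) = false
      · have hx' : (Sum.elim (fun _ => false) fun i => x (Sum.inr i)) = x := by
          ext (i | i)
          · exact (hx i).symm
          · rfl
        simp only [hx', if_true, one_mul, if_pos hx]
        by_cases hxy : x = y
        · simp [hxy]
        · simp [hxy, Ne.symm hxy]
      · have hx' : x ≠ Sum.elim (fun _ => false) fun i => x (Sum.inr i) := fun h =>
          hx fun i => by rw [h]; rfl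
        rw [if_neg hx', zero_mul, if_neg hx, ite_self]
    · intro z _ hz
      rw [if_neg, zero_mul]
      rintro rfl
      exact hz rfl
    · simp
  rw [reflection, h, ← Matrix.diagonal_one, ← Matrix.diagonal_smul, Matrix.diagonal_sub]
  congr 1
  ext x
  by_cases hx : ∀ i, x (Sum.inl i) = false
  · simp [hx]; norm_num
  · simp [hx]

theorem zeroBlock_wires {b a s : ℕ} (W : QOp (Wires b a s)) :
    zeroBlock W = (zeroEmb (Fin a) (Fin s))ᴴ *
      (((adjoin a s fun _ : Fin b => false)ᴴ * (W * adjoin a s fun _ : Fin b => false)) *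
        zeroEmb (Fin a) (Fin s)) := by
  have h : (zeroEmb (Fin b ⊕ Fin a) (Fin s)) =
      adjoin a s (fun _ : Fin b => false) * zeroEmb (Fin a) (Fin s) := by
    rw [adjoin, zeroEmb, zeroEmb, embed_mul_embed]
    congr 1
    ext x i
    rcases i with (i | i) | i <;> rfl
  rw [zeroBlock_eq, h, Matrix.conjTranspose_mul]
  simp only [Matrix.mul_assoc]

end ZeroBlock

/-! ### Layout of the ancillas and the reflections used -/

section Layout

variable {a s : ℕ}

/-- The number of further ancillas. -/
abbrev numAnc (a : ℕ) : ℕ := a + 2 + 3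

/-- The qubits on which conjunctions are computed. -/
def workQ {a : ℕ} (i : Fin (a + 2)) : Fin (numAnc a) := Fin.castAdd 3 i

/-- The further ancillas that are not work qubits. -/
def extraQ {a : ℕ} (i : Fin 3) : Fin (numAnc a) := Fin.natAdd (a + 2) i

theorem workQ_ne_extraQ (i : Fin (a + 2)) (j : Fin 3) : workQ i ≠ extraQ j := by
  intro h
  have := congrArg Fin.val h
  simp only [workQ, extraQ, Fin.val_castAdd, Fin.val_natAdd] at this
  omega

theorem workQ_inj {i j : Fin (a + 2)} : workQ i = workQ j ↔ i = j :=
  (Fin.castAdd_injective (a + 2) 3).eq_iff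

theorem extraQ_inj {i j : Fin 3} : (extraQ i : Fin (numAnc a)) = extraQ j ↔ i = j :=
  (Fin.natAdd_injective 3 (a + 2)).eq_iff

/-- A further ancilla, as a qubit of the whole register. -/
abbrev ancWire {b a s : ℕ} (i : Fin b) : Wires b a s := Sum.inl (Sum.inl i)

/-- The state of the further ancillas during the simulation: the first work qubit is `1`, the
other work qubits are `0`, the signal processing qubit is `c` and the selection qubit is `l`. -/
def ancState (a : ℕ) (l c : Bool) : Fin (numAnc a) → Bool :=
  Fin.append (fun i : Fin (a + 2) => decide (i = 0)) ![c, l, false]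

theorem ancState_work (l c : Bool) (i : Fin (a + 2)) :
    ancState a l c (workQ i) = decide (i = 0) := Fin.append_left _ _ _

theorem ancState_extra (l c : Bool) (i : Fin 3) :
    ancState a l c (extraQ i) = ![c, l, false] i := Fin.append_right _ _ _

theorem anc_ext {f g : Fin (numAnc a) → Bool} (h1 : ∀ i, f (workQ i) = g (workQ i))
    (h2 : ∀ i, f (extraQ i) = g (extraQ i)) : f = g :=
  funext fun i => Fin.addCases (motive := fun i => f i = g i) h1 h2 i

theorem update_ancState_zero (l c v : Bool) :
    Function.update (ancState a l c) (extraQ 0) v = ancState a l v := by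
  refine anc_ext (fun i => ?_) fun i => ?_
  · rw [Function.update_of_ne (workQ_ne_extraQ _ _), ancState_work, ancState_work]
  · rw [ancState_extra]
    fin_cases i
    · simp
    · rw [Function.update_of_ne (by rw [Ne, extraQ_inj]; decide), ancState_extra]; rfl
    · rw [Function.update_of_ne (by rw [Ne, extraQ_inj]; decide), ancState_extra]; rfl

theorem update_ancState_one (l c v : Bool) :
    Function.update (ancState a l c) (extraQ 1) v = ancState a v c := by
  refine anc_ext (fun i => ?_) fun i => ?_
  · rw [Function.update_of_ne (workQ_ne_extraQ _ _), ancState_work, ancState_work]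
  · rw [ancState_extra]
    fin_cases i
    · rw [Function.update_of_ne (by rw [Ne, extraQ_inj]; decide), ancState_extra]; rfl
    · simp
    · rw [Function.update_of_ne (by rw [Ne, extraQ_inj]; decide), ancState_extra]; rfl

theorem ancState_inj {l c l' c' : Bool} :
    ancState a l c = ancState a l' c' ↔ l = l' ∧ c = c' := by
  refine ⟨fun h => ?_, fun h => by rw [h.1, h.2]⟩
  have h0 := congrFun h (extraQ 0)
  have h1 := congrFun h (extraQ 1)
  rw [ancState_extra, ancState_extra] at h0 h1
  exact ⟨h1, h0⟩

/-- `Step.call` always has a control, so one work qubit is set to `1` as a permanent control; it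
also heads the ladders. -/
theorem update_zero_work :
    Function.update (fun _ => false) (workQ 0) true = ancState a false false := by
  refine anc_ext (fun i => ?_) fun i => ?_
  · rw [ancState_work]
    by_cases h : i = 0
    · subst h; simp
    · rw [Function.update_of_ne (by rwa [Ne, workQ_inj])]; simp [h]
  · rw [Function.update_of_ne (workQ_ne_extraQ _ _).symm, ancState_extra]
    fin_cases i <;> rfl

/-- The pairs of the ladder that tests if the ancillas of the block-encoding are all `0`. -/
def beLadder (a s : ℕ) : List (Wires (numAnc a) a s × Wires (numAnc a) a s) :=
  (List.finRange a).map fun i => (Sum.inl (Sum.inr i), ancWire (workQ i.succ.castSucc))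

/-- The pairs of the ladder that also tests if the signal processing qubit is `0`. -/
def fullLadder (a s : ℕ) : List (Wires (numAnc a) a s × Wires (numAnc a) a s) :=
  beLadder a s ++ [(ancWire (extraQ 0), ancWire (workQ (Fin.last (a + 1))))]

theorem ancWire_inj {b : ℕ} {i j : Fin b} : (ancWire i : Wires b a s) = ancWire j ↔ i = j := by
  simp

theorem mem_beLadder {e : Wires (numAnc a) a s × Wires (numAnc a) a s} (he : e ∈ beLadder a s) :
    ∃ i : Fin a, e = (Sum.inl (Sum.inr i), ancWire (workQ i.succ.castSucc)) := by
  obtain ⟨i, -, rfl⟩ := List.mem_map.1 he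
  exact ⟨i, rfl⟩

theorem mem_fullLadder {e : Wires (numAnc a) a s × Wires (numAnc a) a s}
    (he : e ∈ fullLadder a s) : (∃ i : Fin a, e.1 = Sum.inl (Sum.inr i)) ∨
      e.1 = ancWire (extraQ 0) := by
  rcases List.mem_append.1 he with h | h
  · obtain ⟨i, rfl⟩ := mem_beLadder h
    exact Or.inl ⟨i, rfl⟩
  · rw [List.mem_singleton.1 h]; exact Or.inr rfl

theorem snd_mem_fullLadder {t : Wires (numAnc a) a s}
    (ht : t ∈ (fullLadder a s).map Prod.snd) : ∃ j : Fin (a + 2), j ≠ 0 ∧ t = ancWire (workQ j) := by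
  obtain ⟨e, he, rfl⟩ := List.mem_map.1 ht
  rcases List.mem_append.1 he with h | h
  · obtain ⟨i, rfl⟩ := mem_beLadder h
    exact ⟨_, by simp [Fin.ext_iff], rfl⟩
  · rw [List.mem_singleton.1 h]; exact ⟨_, by simp [Fin.ext_iff], rfl⟩

theorem fullLadder_ok : LadderOK (ancWire (workQ 0)) (fullLadder a s) := by
  refine ⟨?_, ?_, ?_⟩
  · rw [fullLadder, List.map_append, List.nodup_append]
    refine ⟨?_, by simp, ?_⟩
    · rw [beLadder, List.map_map]
      refine (List.nodup_finRange a).map fun i j h => ?_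
      simpa [workQ_inj] using h
    · intro x hx y hy
      obtain ⟨e, he, rfl⟩ := List.mem_map.1 hx
      obtain ⟨i, rfl⟩ := mem_beLadder he
      rw [List.map_singleton, List.mem_singleton] at hy
      subst hy
      rw [Ne, ancWire_inj, workQ_inj]
      exact (Fin.castSucc_lt_last _).ne
  · intro h
    obtain ⟨j, hj, h⟩ := snd_mem_fullLadder h
    rw [ancWire_inj, workQ_inj] at h
    exact hj h.symm
  · intro e he h
    obtain ⟨j, hj, h⟩ := snd_mem_fullLadder h
    rcases mem_fullLadder he with ⟨i, hi⟩ | hi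
    · rw [hi] at h; simp at h
    · rw [hi, ancWire_inj] at h
      exact workQ_ne_extraQ _ _ h.symm

theorem beLadder_ok : LadderOK (ancWire (workQ 0)) (beLadder a s) := by
  obtain ⟨h1, h2, h3⟩ := fullLadder_ok (a := a) (s := s)
  rw [fullLadder, List.map_append] at h1 h2
  refine ⟨(List.nodup_append.1 h1).1, fun h => h2 (List.mem_append_left _ h), fun e he h => ?_⟩
  refine h3 e (List.mem_append_left _ he) ?_
  rw [fullLadder, List.map_append]
  exact List.mem_append_left _ h

theorem extra_notMem_fullLadder (i : Fin 3) :
    (ancWire (extraQ i) : Wires (numAnc a) a s) ∉ (fullLadder a s).map Prod.snd := by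
  intro h
  obtain ⟨j, hj, h⟩ := snd_mem_fullLadder h
  rw [ancWire_inj] at h
  exact workQ_ne_extraQ _ _ h.symm

theorem join_fullLadder (l c : Bool) (x : Fin a ⊕ Fin s → Bool)
    {e : Wires (numAnc a) a s × Wires (numAnc a) a s} (he : e ∈ fullLadder a s) :
    join (ancState a l c) x e.2 = false := by
  obtain ⟨j, hj, h⟩ := snd_mem_fullLadder (List.mem_map_of_mem he)
  rw [h]
  change ancState a l c (workQ j) = false
  rw [ancState_work]; simp [hj]

theorem beLadder_all (l c : Bool) (x : Fin a ⊕ Fin s → Bool) :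
    ((beLadder a s).all fun e => !(join (ancState a l c) x e.1)) =
      decide (∀ i, x (Sum.inl i) = false) := by
  rw [Bool.eq_iff_iff, List.all_eq_true, decide_eq_true_iff]
  constructor
  · intro h i
    have := h _ (List.mem_map_of_mem (List.mem_finRange i))
    simpa [join] using this
  · intro h e he
    obtain ⟨i, rfl⟩ := mem_beLadder he
    simpa [join] using h i

/-- The reflection about the zero state of the ancillas of the block-encoding, controlled by the
state `v` of the signal processing qubit. -/
def signalReflection (a s : ℕ) (v : Bool) : Program (numAnc a) a s :=
  flagSign (ancWire (workQ 0)) (beLadder a s) (ancWire (extraQ 0)) fun w c => !w && (c == v)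

/-- The reflection about the zero state of all ancillas. -/
def fullReflection (a s : ℕ) : Program (numAnc a) a s :=
  flagSign (ancWire (workQ 0)) (fullLadder a s) (ancWire (extraQ 1)) fun w l => !(w && !l)

/-- The first work qubit is `1`, so the flag tells exactly whether all ancillas of the
block-encoding are `0`; the sign changes if they are not and the signal processing qubit is `v`. -/
theorem signalReflection_mul {U : QOp (Fin a ⊕ Fin s)}
    (hU : U ∈ Matrix.unitaryGroup (Fin a ⊕ Fin s → Bool) ℂ) (v l c : Bool) :
    Program.toOp U (signalReflection a s v) * adjoin a s (ancState a l c) =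
      adjoin a s (ancState a l c) *
        if c = v then reflection (zeroEmb (Fin a) (Fin s)) else 1 := by
  rw [adjoin, signalReflection, flagSign_mul_embed hU beLadder_ok
    (by rw [Ne, ancWire_inj]; exact (workQ_ne_extraQ _ _).symm)
    (fun h => extra_notMem_fullLadder 0 (by
      rw [fullLadder, List.map_append]; exact List.mem_append_left _ h)) _ _
    (fun x e he => join_fullLadder l c x (List.mem_append_left _ he))]
  congr 1
  have h0 : ∀ x, join (ancState a l c) x (ancWire (workQ 0) : Wires (numAnc a) a s) = true :=
    fun _ => ancState_work l c (0 : Fin (a + 2))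
  have h1 : ∀ x, join (ancState a l c) x (ancWire (extraQ 0) : Wires (numAnc a) a s) = c :=
    fun _ => ancState_extra l c 0
  simp only [h0, h1, beLadder_all]
  split_ifs with h
  · rw [reflection_zeroEmb]
    congr 1
    ext x
    by_cases hx : ∀ i, x (Sum.inl i) = false <;> simp [h, hx]
  · rw [← Matrix.diagonal_one]
    congr 1
    ext x
    simp [h]

theorem fullReflection_mul {U : QOp (Fin a ⊕ Fin s)}
    (hU : U ∈ Matrix.unitaryGroup (Fin a ⊕ Fin s → Bool) ℂ) (l c : Bool) :
    Program.toOp U (fullReflection a s) * adjoin a s (ancState a l c) =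
      adjoin a s (ancState a l c) *
        if l = false ∧ c = false then reflection (zeroEmb (Fin a) (Fin s)) else -1 := by
  rw [adjoin, fullReflection, flagSign_mul_embed hU fullLadder_ok
    (by rw [Ne, ancWire_inj]; exact (workQ_ne_extraQ _ _).symm)
    (extra_notMem_fullLadder 1) _ _ (fun x e he => join_fullLadder l c x he)]
  congr 1
  have h0 : ∀ x, join (ancState a l c) x (ancWire (workQ 0) : Wires (numAnc a) a s) = true :=
    fun _ => ancState_work l c (0 : Fin (a + 2))
  have h1 : ∀ x, join (ancState a l c) x (ancWire (extraQ 0) : Wires (numAnc a) a s) = c :=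
    fun _ => ancState_extra l c 0
  have h2 : ∀ x, join (ancState a l c) x (ancWire (extraQ 1) : Wires (numAnc a) a s) = l :=
    fun _ => ancState_extra l c 1
  simp only [fullLadder, List.all_append, List.all_cons, List.all_nil, h0, h1, h2, beLadder_all]
  split_ifs with h
  · rw [reflection_zeroEmb]
    congr 1
    ext x
    by_cases hx : ∀ i, x (Sum.inl i) = false <;> simp [h.1, h.2, hx]
  · rw [← Matrix.diagonal_one, Matrix.diagonal_neg]
    congr 1
    ext x
    cases l <;> cases c <;> simp_all

theorem ctrl_mul_adjoin {b : ℕ} {p t : Fin b} (hpt : p ≠ t)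
    (k : Bool → Matrix.unitaryGroup Bool ℂ) (f : Fin b → Bool) :
    (ctrl (ancWire p) (ancWire t) k : Gate (Wires b a s)).toOp * adjoin a s f =
      ∑ e : Bool, (k (f p)).1 e (f t) • adjoin a s (Function.update f t e) := by
  rw [adjoin, mul_embed]
  ext x y
  rw [ctrl_toOp_apply (by rwa [Ne, ancWire_inj]), Matrix.sum_apply]
  refine Finset.sum_congr rfl fun e _ => ?_
  rw [update_join, Matrix.smul_apply]
  rfl

theorem one_mul_adjoin {b : ℕ} (t : Fin b) (u : Matrix.unitaryGroup Bool ℂ) (f : Fin b → Bool) :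
    (Gate.one (ancWire t) u : Gate (Wires b a s)).toOp * adjoin a s f =
      ∑ e : Bool, u.1 e (f t) • adjoin a s (Function.update f t e) := by
  rw [adjoin, mul_embed]
  ext x y
  have := one_column (ancWire t) u (1 : QOp (Wires b a s)) x (join f y)
  rw [Matrix.one_mul] at this
  rw [this, Matrix.sum_apply]
  refine Finset.sum_congr rfl fun e _ => ?_
  rw [update_join, Matrix.smul_apply]
  simp only [Matrix.one_apply]
  rfl

end Layout

/-! ### Action of gates on rows -/

section Rows

variable {b a s : ℕ}

theorem adjoin_mul_one (t : Fin b) (u : Matrix.unitaryGroup Bool ℂ) (f : Fin b → Bool) :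
    (adjoin a s f)ᴴ * (Gate.one (ancWire t) u : Gate (Wires b a s)).toOp =
      ∑ e : Bool, u.1 (f t) e • (adjoin a s (Function.update f t e))ᴴ := by
  have h := congrArg Matrix.conjTranspose (one_mul_adjoin (a := a) (s := s) t u⁻¹ f)
  have h1 : (Gate.one (ancWire t) u⁻¹ : Gate (Wires b a s)).toOp =
      ((Gate.one (ancWire t) u : Gate (Wires b a s)).toOp)ᴴ :=
    -- A gate does not involve the block-encoding, so any operator may stand in for it.
    step_toOp_inv (0 : QOp (Fin a ⊕ Fin s)) (.gate (.one (ancWire t) u))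
  rw [Matrix.conjTranspose_mul, h1, Matrix.conjTranspose_conjTranspose,
    Matrix.conjTranspose_sum] at h
  rw [h]
  refine Finset.sum_congr rfl fun e _ => ?_
  rw [Matrix.conjTranspose_smul]
  congr 1
  exact star_star (u.1 (f t) e)

theorem bitFlip_mul_adjoin (t : Fin b) (f : Fin b → Bool) :
    (Gate.one (ancWire t) bitFlip : Gate (Wires b a s)).toOp * adjoin a s f =
      adjoin a s (Function.update f t (!(f t))) := by
  rw [one_mul_adjoin, Finset.sum_eq_single (!(f t))]
  · simp [bitFlip_apply]
  · intro e _ he; simp [bitFlip_apply, he]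
  · simp

theorem adjoin_mul_bitFlip (t : Fin b) (f : Fin b → Bool) :
    (adjoin a s f)ᴴ * (Gate.one (ancWire t) bitFlip : Gate (Wires b a s)).toOp =
      (adjoin a s (Function.update f t (!(f t))))ᴴ := by
  rw [adjoin_mul_one, Finset.sum_eq_single (!(f t))]
  · simp [bitFlip_apply]
  · intro e _ he
    have : f t ≠ !e := fun h => he (by rw [h, Bool.not_not])
    simp [bitFlip_apply, this]
  · simp

end Rows

/-! ### Signal processing circuits and the sum of the two parities -/

section SignalProcessing

variable {a s : ℕ}

/-- One step of quantum signal processing: a use of the block-encoding, controlled by `ctl`, and a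
gate on the signal processing qubit that is controlled by the selection qubit. -/
def signalStep (a s : ℕ) (ctl : Fin (numAnc a)) (adj : Bool)
    (k : Bool → Matrix.unitaryGroup Bool ℂ) : Program (numAnc a) a s :=
  signalReflection a s false ++ [.call ctl adj] ++ signalReflection a s true ++
    [.gate (ctrl (ancWire (extraQ 1)) (ancWire (extraQ 0)) k)]

theorem signalStep_mul {U : QOp (Fin a ⊕ Fin s)}
    (hU : U ∈ Matrix.unitaryGroup (Fin a ⊕ Fin s → Bool) ℂ) (ctl : Fin (numAnc a)) (adj : Bool)
    (k : Bool → Matrix.unitaryGroup Bool ℂ) (l c : Bool) :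
    Program.toOp U (signalStep a s ctl adj k) * adjoin a s (ancState a l c) =
      ∑ e : Bool, (k l).1 e c • (adjoin a s (ancState a l e) *
        ((if c = true then reflection (zeroEmb (Fin a) (Fin s)) else 1) *
          ((if ancState a l c ctl = true then queryOp U adj else 1) *
            (if c = false then reflection (zeroEmb (Fin a) (Fin s)) else 1)))) := by
  have hne : (extraQ 1 : Fin (numAnc a)) ≠ extraQ 0 := by rw [Ne, extraQ_inj]; decide
  rw [signalStep, toOp_append, toOp_append, toOp_append, toOp_singleton, toOp_singleton,
    Matrix.mul_assoc, Matrix.mul_assoc, Matrix.mul_assoc, signalReflection_mul hU,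
    ← Matrix.mul_assoc ((Step.call ctl adj).toOp U), call_mul_adjoin, Matrix.mul_assoc,
    ← Matrix.mul_assoc (Program.toOp U _), signalReflection_mul hU, Matrix.mul_assoc, Step.toOp,
    ← Matrix.mul_assoc _ (adjoin a s _), ctrl_mul_adjoin hne, ancState_extra, ancState_extra,
    Matrix.sum_mul]
  refine Finset.sum_congr rfl fun e _ => ?_
  rw [update_ancState_zero, Matrix.smul_mul]
  rfl

/-- Quantum signal processing with `n` uses of the block-encoding, for the phase gates `k`. -/
def signalCore (a s : ℕ) (k : ℕ → Bool → Matrix.unitaryGroup Bool ℂ) : ℕ → Program (numAnc a) a s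
  | 0 => [.gate (ctrl (ancWire (extraQ 1)) (ancWire (extraQ 0)) (k 0))]
  | n + 1 => signalCore a s k n ++ signalStep a s (workQ 0) n.bodd (k (n + 1))

/-- If the signal qubit is `0`, the reflection precedes the query and gives the next word; if it is
`1`, the reflection follows and gives the next word times `walkSq`. This is the recursion of
`signalPoly` at `X = walkSq`. The condition on `ctl` says that the call is always made in the branch
`l`. -/
theorem signalStep_mul_sum {U : QOp (Fin a ⊕ Fin s)}
    (hU : U ∈ Matrix.unitaryGroup (Fin a ⊕ Fin s → Bool) ℂ) {ctl : Fin (numAnc a)} {l : Bool}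
    (hctl : ∀ c, ancState a l c ctl = true) (k : ℕ → Bool → Matrix.unitaryGroup Bool ℂ) (n : ℕ) :
    Program.toOp U (signalStep a s ctl n.bodd (k (n + 1))) *
        (∑ e : Bool, adjoin a s (ancState a l e) * (word (zeroEmb (Fin a) (Fin s)) U n *
          Polynomial.aeval (walkSq (zeroEmb (Fin a) (Fin s)) U)
            (signalPoly (fun i => k i l) n e))) =
      ∑ e : Bool, adjoin a s (ancState a l e) * (word (zeroEmb (Fin a) (Fin s)) U (n + 1) *
        Polynomial.aeval (walkSq (zeroEmb (Fin a) (Fin s)) U)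
          (signalPoly (fun i => k i l) (n + 1) e)) := by
  have hJ := zeroEmb_isometry (κ := Fin a) (σ := Fin s)
  set J := zeroEmb (Fin a) (Fin s) with hJdef
  rw [Matrix.mul_sum]
  have h0 : queryOp U n.bodd * reflection J * word J U n = word J U (n + 1) := by
    rw [word, Matrix.mul_assoc]
  have h1 : reflection J * queryOp U n.bodd * word J U n = word J U (n + 1) * walkSq J U := by
    rw [← reflection_queryOp_word hJ hU, Matrix.mul_assoc]
  have hstep : ∀ c, Program.toOp U (signalStep a s ctl n.bodd (k (n + 1))) *
      (adjoin a s (ancState a l c) * (word J U n * Polynomial.aeval (walkSq J U)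
            (signalPoly (fun i => k i l) n c))) =
      ∑ e : Bool, adjoin a s (ancState a l e) * (word J U (n + 1) *
        Polynomial.aeval (walkSq J U) (Polynomial.C ((k (n + 1) l).1 e c) *
          ((if c = true then Polynomial.X else 1) * signalPoly (fun i => k i l) n c))) := by
    intro c
    rw [← Matrix.mul_assoc, signalStep_mul hU, Matrix.sum_mul]
    refine Finset.sum_congr rfl fun e _ => ?_
    rw [hctl, if_pos rfl, map_mul, Polynomial.aeval_C, ← Algebra.smul_def, Matrix.smul_mul,
      Matrix.mul_smul, Matrix.mul_smul, Matrix.mul_assoc, ← hJdef]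
    congr 2
    cases c
    · simp only [Bool.false_eq_true, if_false, if_true, one_mul]
      rw [← Matrix.mul_assoc, h0]
    · simp only [Bool.true_eq_false, if_false, if_true, Matrix.mul_one]
      rw [← Matrix.mul_assoc, h1, map_mul, Polynomial.aeval_X, Matrix.mul_assoc]
  simp only [hstep]
  rw [Finset.sum_comm]
  refine Finset.sum_congr rfl fun e _ => ?_
  rw [← Matrix.mul_sum, ← Matrix.mul_sum, ← map_sum, Fintype.sum_bool, signalPoly]
  simp only [Bool.false_eq_true, if_false, if_true, one_mul]
  congr 3
  exact add_comm _ _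

theorem signalCore_mul {U : QOp (Fin a ⊕ Fin s)}
    (hU : U ∈ Matrix.unitaryGroup (Fin a ⊕ Fin s → Bool) ℂ)
    (k : ℕ → Bool → Matrix.unitaryGroup Bool ℂ) (l : Bool) (n : ℕ) :
    Program.toOp U (signalCore a s k n) * adjoin a s (ancState a l false) =
      ∑ e : Bool, adjoin a s (ancState a l e) * (word (zeroEmb (Fin a) (Fin s)) U n *
        Polynomial.aeval (walkSq (zeroEmb (Fin a) (Fin s)) U)
          (signalPoly (fun i => k i l) n e)) := by
  have hne : (extraQ 1 : Fin (numAnc a)) ≠ extraQ 0 := by rw [Ne, extraQ_inj]; decide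
  induction n with
  | zero =>
    rw [signalCore, toOp_singleton, Step.toOp, ctrl_mul_adjoin hne, ancState_extra,
      ancState_extra]
    refine Finset.sum_congr rfl fun e _ => ?_
    rw [update_ancState_zero, word, signalPoly, Polynomial.aeval_C, Matrix.one_mul,
      Algebra.algebraMap_eq_smul_one, Matrix.mul_smul, Matrix.mul_one]
    rfl
  | succ n ih =>
    rw [signalCore, toOp_append, Matrix.mul_assoc, ih,
      signalStep_mul_sum hU (fun c => ancState_work l c 0)]

/-- The linear combination of an even polynomial, with `n` uses of the block-encoding, and an odd
polynomial, with `n + 1` uses. -/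
def evolutionCore (a s : ℕ) (k : ℕ → Bool → Matrix.unitaryGroup Bool ℂ) (n : ℕ) :
    Program (numAnc a) a s :=
  [.gate (.one (ancWire (extraQ 1)) hadamard)] ++
    (signalCore a s k n ++ signalStep a s (extraQ 1) n.bodd (k (n + 1))) ++
    [.gate (.one (ancWire (extraQ 1)) hadamard)]

/-- In the branch `l = true` the last step is a regular one. In the branch `l = false` its call and
its gate are trivial, and one reflection remains for either value of the signal qubit; `Jᴴ` absorbs
it. So the parities differ by one query. -/
theorem block_signalCore_step {U : QOp (Fin a ⊕ Fin s)}
    (hU : U ∈ Matrix.unitaryGroup (Fin a ⊕ Fin s → Bool) ℂ)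
    {k : ℕ → Bool → Matrix.unitaryGroup Bool ℂ} {n : ℕ} (hk : k (n + 1) false = 1) (l l' : Bool) :
    (zeroEmb (Fin a) (Fin s))ᴴ * ((adjoin a s (ancState a l' false))ᴴ *
      (Program.toOp U (signalCore a s k n ++ signalStep a s (extraQ 1) n.bodd (k (n + 1))) *
        adjoin a s (ancState a l false))) =
      if l' = l then (zeroEmb (Fin a) (Fin s))ᴴ * (word (zeroEmb (Fin a) (Fin s)) U (n + l.toNat) *
        Polynomial.aeval (walkSq (zeroEmb (Fin a) (Fin s)) U)
          (signalPoly (fun i => k i l) (n + l.toNat) false)) else 0 := by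
  have hJ := zeroEmb_isometry (κ := Fin a) (σ := Fin s)
  set J := zeroEmb (Fin a) (Fin s) with hJdef
  have hsum : ∀ B : Bool → QOp (Fin a ⊕ Fin s), (adjoin a s (ancState a l' false))ᴴ *
      (∑ e : Bool, adjoin a s (ancState a l e) * B e) = if l' = l then B false else 0 := by
    intro B
    rw [Matrix.mul_sum]
    simp only [← Matrix.mul_assoc, conjTranspose_adjoin_mul_adjoin, ancState_inj]
    by_cases h : l' = l <;> simp [h]
  rw [toOp_append, Matrix.mul_assoc, signalCore_mul hU]
  cases l
  · have hstep : ∀ c, Program.toOp U (signalStep a s (extraQ 1) n.bodd (k (n + 1))) *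
        (adjoin a s (ancState a false c) * (word J U n * Polynomial.aeval (walkSq J U)
          (signalPoly (fun i => k i false) n c))) = adjoin a s (ancState a false c) *
          (reflection J * (word J U n * Polynomial.aeval (walkSq J U)
            (signalPoly (fun i => k i false) n c))) := by
      intro c
      rw [← Matrix.mul_assoc, signalStep_mul hU, hk, ancState_extra, Finset.sum_eq_single c]
      · cases c <;> simp [Matrix.mul_assoc, hJdef]
      · intro e _ he
        simp [he]
      · simp
    rw [Matrix.mul_sum]
    simp only [← hJdef, hstep]
    rw [hsum]
    by_cases h : l' = false
    · rw [if_pos h, if_pos h, ← Matrix.mul_assoc, conjTranspose_mul_reflection hJ]; rfl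
    · rw [if_neg h, if_neg h, Matrix.mul_zero]
  · rw [signalStep_mul_sum hU (fun c => ancState_extra true c 1), hsum]
    by_cases h : l' = true
    · rw [if_pos h, if_pos h]; rfl
    · rw [if_neg h, if_neg h, Matrix.mul_zero]

/-- The branches do not mix, and the two Hadamard gates give each the weight `(1 / √2) ^ 2`. -/
theorem block_evolutionCore {U : QOp (Fin a ⊕ Fin s)}
    (hU : U ∈ Matrix.unitaryGroup (Fin a ⊕ Fin s → Bool) ℂ)
    {k : ℕ → Bool → Matrix.unitaryGroup Bool ℂ} {n : ℕ} (hk : k (n + 1) false = 1) :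
    (zeroEmb (Fin a) (Fin s))ᴴ * ((adjoin a s (ancState a false false))ᴴ *
      (Program.toOp U (evolutionCore a s k n) * adjoin a s (ancState a false false))) =
      (1 / 2 : ℂ) • ∑ l : Bool, (zeroEmb (Fin a) (Fin s))ᴴ *
        (word (zeroEmb (Fin a) (Fin s)) U (n + l.toNat) *
          Polynomial.aeval (walkSq (zeroEmb (Fin a) (Fin s)) U)
            (signalPoly (fun i => k i l) (n + l.toNat) false)) := by
  rw [evolutionCore, toOp_append, toOp_append, toOp_singleton, Step.toOp, Matrix.mul_assoc,
    Matrix.mul_assoc, one_mul_adjoin, ← Matrix.mul_assoc (adjoin a s _)ᴴ, adjoin_mul_one]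
  simp only [ancState_extra, update_ancState_one]
  simp only [Matrix.mul_sum, Matrix.sum_mul, Matrix.smul_mul, Matrix.mul_smul,
    block_signalCore_step hU hk, Finset.smul_sum]
  refine Finset.sum_congr rfl fun l _ => ?_
  rw [Finset.sum_eq_single l]
  · rw [if_pos rfl, smul_smul]
    congr 1
    have := sqrtHalf_mul_self
    cases l <;> simpa [hadamard_apply] using this
  · intro e _ he; simp [he]
  · simp

/-- The projection onto the states in which all ancillas that stay clean are clean. -/
def cleanProj (a s : ℕ) : QOp (Wires (numAnc a) a s) :=
  ∑ l : Bool, ∑ c : Bool, adjoin a s (ancState a l c) * (adjoin a s (ancState a l c))ᴴ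

theorem cleanProj_mul_adjoin (l c : Bool) :
    cleanProj a s * adjoin a s (ancState a l c) = adjoin a s (ancState a l c) := by
  simp only [cleanProj, Matrix.sum_mul, Matrix.mul_assoc, conjTranspose_adjoin_mul_adjoin,
    ancState_inj]
  rw [Finset.sum_eq_single l, Finset.sum_eq_single c]
  · simp
  · intro e _ he; simp [he]
  · simp
  · intro e _ he; simp [he]
  · simp

theorem conjTranspose_cleanProj : (cleanProj a s)ᴴ = cleanProj a s := by
  simp [cleanProj, Matrix.conjTranspose_mul]

theorem cleanProj_mul_of_column {A : QOp (Wires (numAnc a) a s)}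
    (h : ∀ l c, cleanProj a s * (A * adjoin a s (ancState a l c)) =
      A * adjoin a s (ancState a l c)) :
    cleanProj a s * (A * cleanProj a s) = A * cleanProj a s := by
  have h1 : A * cleanProj a s = ∑ l : Bool, ∑ c : Bool,
      (A * adjoin a s (ancState a l c)) * (adjoin a s (ancState a l c))ᴴ := by
    simp only [cleanProj, Matrix.mul_sum, Matrix.mul_assoc]
  rw [h1]
  simp only [Matrix.mul_sum, ← Matrix.mul_assoc]
  simp only [← Matrix.mul_assoc] at h
  simp only [h]

theorem cleanProj_mul_self : cleanProj a s * cleanProj a s = cleanProj a s := by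
  have := cleanProj_mul_of_column (A := (1 : QOp (Wires (numAnc a) a s))) fun l c => by
    rw [Matrix.one_mul, cleanProj_mul_adjoin]
  simpa using this

theorem cleanProj_mul_append {U : QOp (Fin a ⊕ Fin s)} {P Q : Program (numAnc a) a s}
    (hP : cleanProj a s * (Program.toOp U P * cleanProj a s) = Program.toOp U P * cleanProj a s)
    (hQ : cleanProj a s * (Program.toOp U Q * cleanProj a s) = Program.toOp U Q * cleanProj a s) :
    cleanProj a s * (Program.toOp U (P ++ Q) * cleanProj a s) =
      Program.toOp U (P ++ Q) * cleanProj a s := by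
  have e : Program.toOp U Q * (Program.toOp U P * cleanProj a s) =
      (cleanProj a s * (Program.toOp U Q * cleanProj a s)) *
        (Program.toOp U P * cleanProj a s) := by
    rw [hQ, Matrix.mul_assoc, hP]
  rw [toOp_append, Matrix.mul_assoc, e, ← Matrix.mul_assoc (cleanProj a s),
    ← Matrix.mul_assoc (cleanProj a s) (cleanProj a s), cleanProj_mul_self]

theorem cleanProj_mul_hadamard (U : QOp (Fin a ⊕ Fin s)) :
    cleanProj a s * (Program.toOp U [.gate (.one (ancWire (extraQ 1)) hadamard)] *
      cleanProj a s) = Program.toOp U [.gate (.one (ancWire (extraQ 1)) hadamard)] *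
        cleanProj a s := by
  refine cleanProj_mul_of_column fun l c => ?_
  rw [toOp_singleton, Step.toOp, one_mul_adjoin]
  simp only [update_ancState_one, Matrix.mul_sum, Matrix.mul_smul, cleanProj_mul_adjoin]

theorem cleanProj_mul_signalStep {U : QOp (Fin a ⊕ Fin s)}
    (hU : U ∈ Matrix.unitaryGroup (Fin a ⊕ Fin s → Bool) ℂ) (ctl : Fin (numAnc a)) (adj : Bool)
    (k : Bool → Matrix.unitaryGroup Bool ℂ) :
    cleanProj a s * (Program.toOp U (signalStep a s ctl adj k) * cleanProj a s) =
      Program.toOp U (signalStep a s ctl adj k) * cleanProj a s := by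
  refine cleanProj_mul_of_column fun l c => ?_
  rw [signalStep_mul hU]
  simp only [Matrix.mul_sum, Matrix.mul_smul, ← Matrix.mul_assoc, cleanProj_mul_adjoin]

theorem cleanProj_mul_signalCore {U : QOp (Fin a ⊕ Fin s)}
    (hU : U ∈ Matrix.unitaryGroup (Fin a ⊕ Fin s → Bool) ℂ)
    (k : ℕ → Bool → Matrix.unitaryGroup Bool ℂ) (n : ℕ) :
    cleanProj a s * (Program.toOp U (signalCore a s k n) * cleanProj a s) =
      Program.toOp U (signalCore a s k n) * cleanProj a s := by
  have hne : (extraQ 1 : Fin (numAnc a)) ≠ extraQ 0 := by rw [Ne, extraQ_inj]; decide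
  induction n with
  | zero =>
    refine cleanProj_mul_of_column fun l c => ?_
    rw [signalCore, toOp_singleton, Step.toOp, ctrl_mul_adjoin hne]
    simp only [update_ancState_zero, Matrix.mul_sum, Matrix.mul_smul, cleanProj_mul_adjoin]
  | succ n ih => exact cleanProj_mul_append ih (cleanProj_mul_signalStep hU _ _ _)

/-- `fullReflection` is the desired reflection only on clean states, so amplification must stay in
the range of `cleanProj`. The core preserves that range because each of its pieces does. -/
theorem cleanProj_mul_evolutionCore {U : QOp (Fin a ⊕ Fin s)}
    (hU : U ∈ Matrix.unitaryGroup (Fin a ⊕ Fin s → Bool) ℂ)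
    (k : ℕ → Bool → Matrix.unitaryGroup Bool ℂ) (n : ℕ) :
    cleanProj a s * (Program.toOp U (evolutionCore a s k n) * cleanProj a s) =
      Program.toOp U (evolutionCore a s k n) * cleanProj a s :=
  cleanProj_mul_append (cleanProj_mul_append (cleanProj_mul_hadamard U)
    (cleanProj_mul_append (cleanProj_mul_signalCore hU k n) (cleanProj_mul_signalStep hU _ _ _)))
    (cleanProj_mul_hadamard U)

end SignalProcessing

/-! ### Oblivious amplitude amplification -/

section Amplification

variable {m n : Type} [Fintype m] [DecidableEq m] [Fintype n] [DecidableEq n]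

/-- A unitary that preserves the range of an orthogonal projection commutes with it. -/
theorem commute_of_preserves {W Q : Matrix m m ℂ} (hW : W ∈ Matrix.unitaryGroup m ℂ)
    (hQ : Qᴴ = Q) (hQQ : Q * Q = Q) (h : Q * (W * Q) = W * Q) : Q * W = W * Q := by
  have h1 : Wᴴ * W = 1 := Matrix.mem_unitaryGroup_iff'.1 hW
  have h2 : W * Wᴴ = 1 := Matrix.mem_unitaryGroup_iff.1 hW
  have hA : (W * Q)ᴴ = Q * Wᴴ := by rw [Matrix.conjTranspose_mul, hQ]
  have h3 : (Q * Wᴴ) * Q = Q * Wᴴ := by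
    rw [← hA]
    conv_rhs => rw [← h, Matrix.conjTranspose_mul, hQ]
  -- `M` is `W` on the range of `Q` and the identity on its complement. It is an isometry, hence
  -- unitary by finite dimension, so `W` maps the range of `Q` onto itself: `W Q Wᴴ = Q`.
  set M := W * Q + (1 - Q) with hM
  have hMH : Mᴴ = Q * Wᴴ + (1 - Q) := by
    rw [hM, Matrix.conjTranspose_add, hA, Matrix.conjTranspose_sub, hQ, Matrix.conjTranspose_one]
  have e1 : Q * Wᴴ * (W * Q) = Q := by
    rw [Matrix.mul_assoc, ← Matrix.mul_assoc Wᴴ, h1, Matrix.one_mul, hQQ]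
  have hl : Mᴴ * M = 1 := by
    rw [hMH, hM]
    have e2 : Q * Wᴴ * (1 - Q) = 0 := by rw [Matrix.mul_sub, Matrix.mul_one, h3, sub_self]
    have e3 : (1 - Q) * (W * Q) = 0 := by rw [Matrix.sub_mul, Matrix.one_mul, h, sub_self]
    have e4 : (1 - Q) * (1 - Q) = 1 - Q := by
      rw [Matrix.sub_mul, Matrix.one_mul, Matrix.mul_sub, hQQ, Matrix.mul_one, sub_self, sub_zero]
    rw [Matrix.mul_add, Matrix.add_mul, Matrix.add_mul, e1, e2, e3, e4]
    abel
  have hr : M * Mᴴ = 1 := mul_eq_one_comm.1 hl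
  have e5 : Q * (1 - Q) = 0 := by rw [Matrix.mul_sub, Matrix.mul_one, hQQ, sub_self]
  have e6 : W * Q * Wᴴ = Q := by
    have this : Q * (M * Mᴴ) * Q = Q * 1 * Q := by rw [hr]
    rw [hMH, hM] at this
    have e7 : Q * (W * Q + (1 - Q)) = W * Q := by rw [Matrix.mul_add, h, e5, add_zero]
    have e8 : (Q * Wᴴ + (1 - Q)) * Q = Q * Wᴴ := by
      rw [Matrix.add_mul, h3, Matrix.sub_mul, Matrix.one_mul, hQQ, sub_self, add_zero]
    rw [← Matrix.mul_assoc Q, e7, Matrix.mul_assoc, e8, Matrix.mul_one, hQQ, Matrix.mul_assoc,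
      ← Matrix.mul_assoc Q, hQQ, ← Matrix.mul_assoc] at this
    exact this
  calc Q * W = W * Q * Wᴴ * W := by rw [e6]
    _ = W * Q := by rw [Matrix.mul_assoc, h1, Matrix.mul_one]

/-- Oblivious amplitude amplification with three uses of `W`. -/
theorem amplification_block {W F Q : Matrix m m ℂ} {J : Matrix m n ℂ}
    (hW : W ∈ Matrix.unitaryGroup m ℂ) (hJ : Jᴴ * J = 1) (hQ : Qᴴ = Q)
    (hQJ : Q * J = J) (hQW : Q * W = W * Q) (hF : F * Q = reflection J * Q) :
    Jᴴ * (W * (F * (Wᴴ * (F * (W * J))))) =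
      (4 : ℂ) • (Jᴴ * (W * J) * (Jᴴ * (W * J))ᴴ * (Jᴴ * (W * J))) - (3 : ℂ) • (Jᴴ * (W * J)) := by
  have h1 : Wᴴ * W = 1 := Matrix.mem_unitaryGroup_iff'.1 hW
  have h2 : W * Wᴴ = 1 := Matrix.mem_unitaryGroup_iff.1 hW
  -- `F` is known on the range of `Q` only. All columns it meets below lie there, since `Q` commutes
  -- with `W` and `Wᴴ`.
  have hFm : ∀ X : Matrix m n ℂ, Q * X = X → F * X = reflection J * X := by
    intro X hX
    rw [← hX, ← Matrix.mul_assoc, hF, Matrix.mul_assoc]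
  have hR : ∀ X : Matrix m n ℂ, reflection J * X = (2 : ℂ) • (J * (Jᴴ * X)) - X := by
    intro X
    rw [reflection, Matrix.sub_mul, Matrix.smul_mul, Matrix.one_mul, Matrix.mul_assoc]
  have hQWH : Q * Wᴴ = Wᴴ * Q := by
    have := congrArg Matrix.conjTranspose hQW
    rw [Matrix.conjTranspose_mul, Matrix.conjTranspose_mul, hQ] at this
    exact this.symm
  have hWH : Q * (Wᴴ * J) = Wᴴ * J := by rw [← Matrix.mul_assoc, hQWH, Matrix.mul_assoc, hQJ]
  obtain ⟨B, hB⟩ : ∃ B, B = Jᴴ * (W * J) := ⟨_, rfl⟩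
  rw [← hB]
  have hBH : Jᴴ * (Wᴴ * J) = Bᴴ := by
    rw [hB, Matrix.conjTranspose_mul, Matrix.conjTranspose_mul, Matrix.conjTranspose_conjTranspose,
      Matrix.mul_assoc]
  have hWJ : Q * (W * J) = W * J := by rw [← Matrix.mul_assoc, hQW, Matrix.mul_assoc, hQJ]
  have e1 : Wᴴ * (F * (W * J)) = (2 : ℂ) • (Wᴴ * J * B) - J := by
    rw [hFm _ hWJ, hR, ← hB, Matrix.mul_sub, Matrix.mul_smul, ← Matrix.mul_assoc Wᴴ W, h1,
      Matrix.one_mul, Matrix.mul_assoc]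
  have e2 : Q * ((2 : ℂ) • (Wᴴ * J * B) - J) = (2 : ℂ) • (Wᴴ * J * B) - J := by
    rw [Matrix.mul_sub, hQJ, Matrix.mul_smul, ← Matrix.mul_assoc Q, hWH]
  rw [e1, hFm _ e2, hR]
  have e3 : Jᴴ * ((2 : ℂ) • (Wᴴ * J * B) - J) = (2 : ℂ) • (Bᴴ * B) - 1 := by
    rw [Matrix.mul_sub, hJ, Matrix.mul_smul, ← Matrix.mul_assoc Jᴴ, hBH]
  have e4 : W * (Wᴴ * J * B) = J * B := by
    rw [← Matrix.mul_assoc, ← Matrix.mul_assoc, h2, Matrix.one_mul]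
  rw [e3, Matrix.mul_sub, Matrix.mul_sub W ((2 : ℂ) • _), Matrix.mul_smul, Matrix.mul_smul W, e4,
    Matrix.mul_sub J, Matrix.mul_smul, Matrix.mul_one]
  have e5 : Jᴴ * (W * (J * (Bᴴ * B))) = B * Bᴴ * B := by
    rw [← Matrix.mul_assoc W, ← Matrix.mul_assoc Jᴴ, ← hB, Matrix.mul_assoc]
  have e6 : Jᴴ * (J * B) = B := by rw [← Matrix.mul_assoc, hJ, Matrix.one_mul]
  simp only [Matrix.mul_sub, Matrix.mul_smul, e5, e6, ← hB]
  module

end Amplification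

/-! ### Norm estimates for amplification and normalization -/

section Norms

theorem norm_le_one_of_unitary {m : Type} [Fintype m] [DecidableEq m] [Nonempty m]
    {W : Matrix m m ℂ} (hW : W ∈ Matrix.unitaryGroup m ℂ) : ‖W‖ ≤ 1 :=
  (CStarRing.norm_of_mem_unitary hW).le

theorem norm_le_one_of_isometry {m n : Type} [Fintype m] [DecidableEq m] [Fintype n]
    [DecidableEq n] [Nonempty n] {J : Matrix m n ℂ} (hJ : Jᴴ * J = 1) : ‖J‖ ≤ 1 := by
  have h1 := Matrix.l2_opNorm_conjTranspose_mul_self J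
  rw [hJ, CStarRing.norm_one] at h1
  nlinarith [norm_nonneg J]

theorem norm_zeroBlock_le_one {κ σ : Type} [Fintype κ] [DecidableEq κ] [Fintype σ]
    [DecidableEq σ] {U : QOp (κ ⊕ σ)} (hU : U ∈ Matrix.unitaryGroup (κ ⊕ σ → Bool) ℂ) :
    ‖zeroBlock U‖ ≤ 1 := by
  have hJ := norm_le_one_of_isometry (zeroEmb_isometry (κ := κ) (σ := σ))
  have hJ' : ‖(zeroEmb κ σ)ᴴ‖ ≤ 1 := by rwa [Matrix.l2_opNorm_conjTranspose]
  rw [zeroBlock_eq]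
  refine (Matrix.l2_opNorm_mul _ _).trans (mul_le_one₀ hJ' (norm_nonneg _) ?_)
  exact (Matrix.l2_opNorm_mul _ _).trans
    (mul_le_one₀ (norm_le_one_of_unitary hU) (norm_nonneg _) hJ)

/-- For `B = E / 2` the cubic gives `E` exactly, as `3 sin θ - 4 sin³ θ = sin 3θ` at `30°`. In
powers of `D = 2 B - E`, the first-order part is `(D - E Dᴴ E) / 2`, of norm at most `η`; three
quadratic terms and one cubic term remain, with factor `1 / 2`. -/
theorem norm_amplified_sub_le {n : Type} [Fintype n] [DecidableEq n] [Nonempty n]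
    {E B : Matrix n n ℂ} (hE : E ∈ Matrix.unitaryGroup n ℂ) {η : ℝ}
    (hη : ‖(2 : ℂ) • B - E‖ ≤ η) :
    ‖-((4 : ℂ) • (B * Bᴴ * B) - (3 : ℂ) • B) - E‖ ≤ η + (3 * η ^ 2 + η ^ 3) / 2 := by
  have h1 : Eᴴ * E = 1 := Matrix.mem_unitaryGroup_iff'.1 hE
  have h2 : E * Eᴴ = 1 := Matrix.mem_unitaryGroup_iff.1 hE
  obtain ⟨D, hD⟩ : ∃ D, D = (2 : ℂ) • B - E := ⟨_, rfl⟩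
  rw [← hD] at hη
  have hη0 : 0 ≤ η := (norm_nonneg _).trans hη
  have hEn := norm_le_one_of_unitary hE
  have hEn' : ‖Eᴴ‖ ≤ 1 := by rwa [Matrix.l2_opNorm_conjTranspose]
  have hDn' : ‖Dᴴ‖ ≤ η := by rwa [Matrix.l2_opNorm_conjTranspose]
  have hB : B = (1 / 2 : ℂ) • (E + D) := by rw [hD]; module
  have key : -((4 : ℂ) • (B * Bᴴ * B) - (3 : ℂ) • B) - E =
      (1 / 2 : ℂ) • (D - E * Dᴴ * E - (E * Dᴴ * D + D * Eᴴ * D + D * Dᴴ * E + D * Dᴴ * D)) := by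
    have e1 : E * Eᴴ * E = E := by rw [h2, Matrix.one_mul]
    have e2 : E * Eᴴ * D = D := by rw [h2, Matrix.one_mul]
    have e3 : D * Eᴴ * E = D := by rw [Matrix.mul_assoc, h1, Matrix.mul_one]
    have hs : star (1 / 2 : ℂ) = 1 / 2 := by simp
    rw [hB, Matrix.conjTranspose_smul, Matrix.conjTranspose_add, hs]
    simp only [Matrix.smul_mul, Matrix.mul_smul, Matrix.add_mul, Matrix.mul_add, e1, e2, e3]
    module
  have t3 : ∀ X Y Z : Matrix n n ℂ, ∀ x y z : ℝ, 0 ≤ x → 0 ≤ y → ‖X‖ ≤ x → ‖Y‖ ≤ y → ‖Z‖ ≤ z →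
      ‖X * Y * Z‖ ≤ x * y * z := by
    intro X Y Z x y z hx hy hX hY hZ
    exact (norm_mul_le _ _).trans (mul_le_mul ((norm_mul_le _ _).trans
      (mul_le_mul hX hY (norm_nonneg _) hx)) hZ (norm_nonneg _) (mul_nonneg hx hy))
  rw [key, norm_smul]
  have hn : ‖(1 / 2 : ℂ)‖ = 1 / 2 := by simp
  have b1 := t3 E Dᴴ E 1 η 1 zero_le_one hη0 hEn hDn' hEn
  have b2 := t3 E Dᴴ D 1 η η zero_le_one hη0 hEn hDn' hη
  have b3 := t3 D Eᴴ D η 1 η hη0 zero_le_one hη hEn' hη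
  have b4 := t3 D Dᴴ E η η 1 hη0 hη0 hη hDn' hEn
  have b5 := t3 D Dᴴ D η η η hη0 hη0 hη hDn' hη
  have c1 := norm_sub_le (D - E * Dᴴ * E) (E * Dᴴ * D + D * Eᴴ * D + D * Dᴴ * E + D * Dᴴ * D)
  have c2 := norm_sub_le D (E * Dᴴ * E)
  have c3 := norm_add_le (E * Dᴴ * D + D * Eᴴ * D + D * Dᴴ * E) (D * Dᴴ * D)
  have c4 := norm_add_le (E * Dᴴ * D + D * Eᴴ * D) (D * Dᴴ * E)
  have c5 := norm_add_le (E * Dᴴ * D) (D * Eᴴ * D)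
  rw [hn]
  nlinarith

theorem norm_toEuclideanLin_le {n : Type} [Fintype n] [DecidableEq n] (A : Matrix n n ℂ)
    (x : EuclideanSpace ℂ n) : ‖Matrix.toEuclideanLin A x‖ ≤ ‖A‖ * ‖x‖ :=
  Matrix.l2_opNorm_mulVec A x

theorem norm_toEuclideanLin_unitary {n : Type} [Fintype n] [DecidableEq n] [Nonempty n]
    {W : Matrix n n ℂ} (hW : W ∈ Matrix.unitaryGroup n ℂ) (x : EuclideanSpace ℂ n) :
    ‖Matrix.toEuclideanLin W x‖ = ‖x‖ := by
  refine le_antisymm ((norm_toEuclideanLin_le _ _).trans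
    (mul_le_of_le_one_left (norm_nonneg _) (norm_le_one_of_unitary hW))) ?_
  have h1 : Wᴴ * W = 1 := Matrix.mem_unitaryGroup_iff'.1 hW
  have h2 : Matrix.toEuclideanLin Wᴴ (Matrix.toEuclideanLin W x) = x := by
    rw [← LinearMap.comp_apply, ← Matrix.toLpLin_mul_same, h1]
    simp
  have hW' : ‖Wᴴ‖ ≤ 1 := by
    rw [Matrix.l2_opNorm_conjTranspose]; exact norm_le_one_of_unitary hW
  calc ‖x‖ = ‖Matrix.toEuclideanLin Wᴴ (Matrix.toEuclideanLin W x)‖ := by rw [h2]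
    _ ≤ ‖Wᴴ‖ * ‖Matrix.toEuclideanLin W x‖ := norm_toEuclideanLin_le _ _
    _ ≤ ‖Matrix.toEuclideanLin W x‖ := mul_le_of_le_one_left (norm_nonneg _) hW'

/-- A vector close to a unit vector is almost normalized, and close to it after normalization. -/
theorem normalize_close {E : Type*} [NormedAddCommGroup E] [NormedSpace ℂ E] {φ χ : E}
    {κ ε : ℝ} (hχ : ‖χ‖ = 1) (h : ‖φ - χ‖ ≤ κ) (hκ : 2 * κ ≤ ε) (hε : ε < 1) :
    1 - ε ≤ ‖φ‖ ^ 2 ∧ ‖((‖φ‖⁻¹ : ℝ) : ℂ) • φ - χ‖ ≤ ε := by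
  have h1 : |‖φ‖ - 1| ≤ κ := by
    rw [← hχ]; exact (abs_norm_sub_norm_le _ _).trans h
  have h2 := abs_le.1 h1
  have hpos : 0 < ‖φ‖ := by linarith
  refine ⟨by nlinarith, ?_⟩
  have h3 : ‖((‖φ‖⁻¹ : ℝ) : ℂ) • φ - φ‖ ≤ κ := by
    have : ((‖φ‖⁻¹ : ℝ) : ℂ) • φ - φ = ((‖φ‖⁻¹ - 1 : ℝ) : ℂ) • φ := by
      rw [Complex.ofReal_sub, sub_smul, Complex.ofReal_one, one_smul]
    rw [this, norm_smul, Complex.norm_real, Real.norm_eq_abs]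
    calc |‖φ‖⁻¹ - 1| * ‖φ‖ = |(‖φ‖⁻¹ - 1) * ‖φ‖| := by rw [abs_mul, abs_of_pos hpos]
      _ = |‖φ‖ - 1| := by
        rw [sub_mul, inv_mul_cancel₀ hpos.ne', one_mul, abs_sub_comm]
      _ ≤ κ := h1
  have h4 := norm_sub_le_norm_sub_add_norm_sub (((‖φ‖⁻¹ : ℝ) : ℂ) • φ) φ χ
  linarith

end Norms

/-! ### The block of the core, and the two circuits built on it -/

section Simulation

variable {a s : ℕ}

/-- The state with all ancillas `0`, except the first work qubit. -/
def startEmb (a s : ℕ) : Matrix (Wires (numAnc a) a s → Bool) (Fin s → Bool) ℂ :=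
  adjoin a s (ancState a false false) * zeroEmb (Fin a) (Fin s)

theorem startEmb_isometry : (startEmb a s)ᴴ * startEmb a s = 1 := by
  rw [startEmb, Matrix.conjTranspose_mul, Matrix.mul_assoc, ← Matrix.mul_assoc (adjoin a s _)ᴴ,
    conjTranspose_adjoin_mul_adjoin, if_pos rfl, Matrix.one_mul, zeroEmb_isometry]

/-- The truncated series is bounded by `1 + ε / 7`, and the scale `1 / (1 + ε / 6)` brings it
strictly below `1`, as `exists_signalPoly` requires. -/
theorem exists_phases {τ ε : ℝ} {n : ℕ} (hτ : 0 ≤ τ) (hε : 0 < ε) (hε1 : ε < 1) (hn : 1 ≤ n)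
    (h : 2.8 * τ + Real.log (1 / ε) ≤ n) :
    ∃ k : ℕ → Bool → Matrix.unitaryGroup Bool ℂ, k (2 * (n - 1) + 1) false = 1 ∧
      ∀ l : Bool, signalPoly (fun i => k i l) (2 * (n - 1) + l.toNat) false =
        expPoly ((1 / (1 + ε / 6) : ℝ) : ℂ) τ n l.toNat := by
  have hlog : 0 < Real.log (1 / ε) := Real.log_pos ((one_lt_div hε).2 hε1)
  have hn0 : (1 : ℝ) ≤ n := by exact_mod_cast hn
  have hτn : τ / (2 * n + 1 : ℕ) ≤ 1 / 2 := by
    rw [div_le_iff₀ (by positivity)]; push_cast; linarith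
  have hA : ∀ l : Bool, ∃ A : ℕ → Matrix.unitaryGroup Bool ℂ,
      signalPoly A (2 * (n - 1) + l.toNat) false =
        expPoly ((1 / (1 + ε / 6) : ℝ) : ℂ) τ n l.toNat := fun l =>
    exists_signalPoly (natDegree_expPoly_le _ _ _ _) fun w hw =>
      norm_eval_expPoly_lt hn hτ hτn (taylor_remainder_le hτ hε hε1 hn h) (by positivity) (by
        rw [one_div_mul_eq_div, div_lt_one (by positivity)]; linarith) l hw
  choose A hA using hA
  -- The even polynomial uses the gates up to `2 (n - 1)` only, so its gate in the extra last step
  -- is free to be `1`.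
  refine ⟨fun i l => if l = false ∧ i = 2 * (n - 1) + 1 then 1 else A l i, by simp, fun l => ?_⟩
  rw [← hA l]
  refine congrFun (signalPoly_congr fun i hi => if_neg ?_) false
  rintro ⟨rfl, rfl⟩
  simp at hi

/-- Hermiticity of `H` gives `U` and `Uᴴ` the same block; hence alternating queries yield powers of
`H`. -/
theorem smul_block_queryOp {U : QOp (Fin a ⊕ Fin s)} {H : QOp (Fin s)} (hH : H.IsHermitian)
    {α : ℝ} (hBE : IsBlockEncoding α 0 H U) (b : Bool) :
    (α : ℂ) • ((zeroEmb (Fin a) (Fin s))ᴴ * (queryOp U b * zeroEmb (Fin a) (Fin s))) = H := by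
  have h1 : (α : ℂ) • zeroBlock U = H :=
    (sub_eq_zero.1 (norm_le_zero_iff.1 hBE.error_le)).symm
  rw [zeroBlock_eq] at h1
  cases b
  · exact h1
  · have h2 := congrArg Matrix.conjTranspose h1
    rw [hH.eq, Matrix.conjTranspose_smul, Matrix.conjTranspose_mul, Matrix.conjTranspose_mul,
      Matrix.conjTranspose_conjTranspose, Matrix.mul_assoc] at h2
    rw [← h2]
    congr 1
    exact (Complex.conj_ofReal α).symm

theorem evolutionCore_block {U : QOp (Fin a ⊕ Fin s)} {H : QOp (Fin s)} (hH : H.IsHermitian)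
    {α : ℝ} (hBE : IsBlockEncoding α 0 H U) {c t : ℝ} {n : ℕ}
    {k : ℕ → Bool → Matrix.unitaryGroup Bool ℂ} (hk : k (2 * (n - 1) + 1) false = 1)
    (hp : ∀ l : Bool, signalPoly (fun i => k i l) (2 * (n - 1) + l.toNat) false =
        expPoly (c : ℂ) ((α * t : ℝ) : ℂ) n l.toNat) :
    (startEmb a s)ᴴ * (Program.toOp U (evolutionCore a s k (2 * (n - 1))) * startEmb a s) =
      (c / 2 : ℂ) • taylorEvolution H t n := by
  have hJ := zeroEmb_isometry (κ := Fin a) (σ := Fin s)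
  have h1 := block_evolutionCore hBE.unitary hk
  have h2 := fun l : Bool => block_expPoly hJ hBE.unitary
    (smul_block_queryOp hH hBE) (c : ℂ) (t : ℂ) n l.toNat
  simp only [hp, Complex.ofReal_mul, h2] at h1
  have h3 := congrArg (fun X => X * zeroEmb (Fin a) (Fin s)) h1
  rw [startEmb, Matrix.conjTranspose_mul]
  simp only [Matrix.mul_assoc] at h3 ⊢
  rw [h3, Fintype.sum_bool]
  simp only [Matrix.smul_mul, Matrix.add_mul, Matrix.mul_assoc, hJ, Matrix.mul_one]
  rw [taylorEvolution, sum_range_two_mul]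
  simp only [Bool.toNat_true, Bool.toNat_false, add_zero]
  module

/-- The scale costs at most `ε / 6` and the truncation at most `ε / 7`; the sum is `13 ε / 42`. -/
theorem norm_evolutionCore_block_le {U : QOp (Fin a ⊕ Fin s)} {H : QOp (Fin s)}
    (hH : H.IsHermitian) {α : ℝ} (hBE : IsBlockEncoding α 0 H U) {ε t : ℝ} {n : ℕ} (ht : 0 ≤ t)
    (hε : 0 < ε) (hε1 : ε < 1) (hn : 1 ≤ n) (h : 2.8 * (α * t) + Real.log (1 / ε) ≤ n)
    {B : QOp (Fin s)}
    (hB : B = (((1 / (1 + ε / 6) : ℝ) : ℂ) / 2) • taylorEvolution H t n) :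
    ‖(2 : ℂ) • B - evolution H t‖ ≤ 13 / 42 * ε := by
  have hE := norm_le_one_of_unitary (evolution_mem_unitaryGroup hH t)
  have hα := hBE.alpha_nonneg
  have hτ : 0 ≤ α * t := mul_nonneg hα ht
  have hlog : 0 < Real.log (1 / ε) := Real.log_pos ((one_lt_div hε).2 hε1)
  have hn0 : (1 : ℝ) ≤ n := by exact_mod_cast hn
  have hτn : α * t / (2 * n + 1 : ℕ) ≤ 1 / 2 := by
    rw [div_le_iff₀ (by positivity)]; push_cast; linarith
  have hHn : ‖H‖ ≤ α := by
    have h1 : (α : ℂ) • zeroBlock U = H :=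
      (sub_eq_zero.1 (norm_le_zero_iff.1 hBE.error_le)).symm
    rw [← h1, norm_smul, Complex.norm_real, Real.norm_of_nonneg hα]
    exact mul_le_of_le_one_right hα (norm_zeroBlock_le_one hBE.unitary)
  have hT := (norm_evolution_sub_taylor_le hHn ht hn hτn).trans
    (taylor_remainder_le hτ hε hε1 hn h)
  set E := evolution H t
  set T := taylorEvolution H t n
  set c : ℝ := 1 / (1 + ε / 6) with hc
  have hc0 : 0 ≤ c := by positivity
  have hc1 : c ≤ 1 := by rw [hc, div_le_one (by positivity)]; linarith
  have hc2 : 1 - c ≤ ε / 6 := by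
    have h3 : c * (1 + ε / 6) = 1 := by rw [hc]; field_simp
    nlinarith
  have e : (2 : ℂ) • B - E = -((c : ℂ) • (E - T) + ((1 - c : ℝ) : ℂ) • E) := by
    rw [hB]; push_cast; module
  rw [e, norm_neg]
  refine (norm_add_le _ _).trans ?_
  rw [norm_smul, norm_smul, Complex.norm_real, Complex.norm_real, Real.norm_of_nonneg hc0,
    Real.norm_of_nonneg (sub_nonneg.2 hc1)]
  have h4 := mul_le_mul hc1 hT (norm_nonneg _) zero_le_one
  have h5 := mul_le_mul hc2 hE (norm_nonneg _) (by positivity)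
  linarith

theorem cleanProj_mul_core_adjoin {U : QOp (Fin a ⊕ Fin s)}
    (hU : U ∈ Matrix.unitaryGroup (Fin a ⊕ Fin s → Bool) ℂ)
    (k : ℕ → Bool → Matrix.unitaryGroup Bool ℂ) (n : ℕ) :
    cleanProj a s * (Program.toOp U (evolutionCore a s k n) * adjoin a s (ancState a false false)) =
      Program.toOp U (evolutionCore a s k n) * adjoin a s (ancState a false false) := by
  have h := congrArg (fun X => X * adjoin a s (ancState a false false))
    (cleanProj_mul_evolutionCore hU k n)
  simpa only [Matrix.mul_assoc, cleanProj_mul_adjoin] using h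

/-- The block-encoding of the evolution operator. The last gate reduces the amplitude by `r`. -/
def evolutionProgram (a s : ℕ) (k : ℕ → Bool → Matrix.unitaryGroup Bool ℂ) (n : ℕ)
    (u : Matrix.unitaryGroup Bool ℂ) : Program (numAnc a) a s :=
  [.gate (.one (ancWire (workQ 0)) bitFlip)] ++ (evolutionCore a s k n ++
    ([.gate (.one (ancWire (workQ 0)) bitFlip)] ++ [.gate (.one (ancWire (extraQ 2)) u)]))

theorem bitFlip_mul_zero_column :
    (Gate.one (ancWire (workQ 0)) bitFlip : Gate (Wires (numAnc a) a s)).toOp *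
      ((adjoin a s fun _ : Fin (numAnc a) => false) * zeroEmb (Fin a) (Fin s)) = startEmb a s := by
  have hwork : Function.update (fun _ : Fin (numAnc a) => false) (workQ 0) (!false) =
      ancState a false false := update_zero_work
  rw [← Matrix.mul_assoc, bitFlip_mul_adjoin, hwork, startEmb]

/-- The core leaves `extraQ 2` at `0`, so the gate `u` contributes only its amplitude for staying at
`0`; the branch with `extraQ 2` at `1` is orthogonal to all clean states (`horth`). -/
theorem zeroBlock_evolutionProgram {U : QOp (Fin a ⊕ Fin s)}
    (hU : U ∈ Matrix.unitaryGroup (Fin a ⊕ Fin s → Bool) ℂ)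
    (k : ℕ → Bool → Matrix.unitaryGroup Bool ℂ) (n : ℕ) (u : Matrix.unitaryGroup Bool ℂ) :
    zeroBlock (Program.toOp U (evolutionProgram a s k n u)) = u.1 false false •
      ((startEmb a s)ᴴ * (Program.toOp U (evolutionCore a s k n) * startEmb a s)) := by
  have hwork : Function.update (fun _ : Fin (numAnc a) => false) (workQ 0) (!false) =
      ancState a false false := update_zero_work
  have horth : (adjoin a s (Function.update (Function.update (fun _ : Fin (numAnc a) => false)
      (extraQ 2) true) (workQ 0) true))ᴴ * cleanProj a s = 0 := by
    simp only [cleanProj, Matrix.mul_sum, ← Matrix.mul_assoc, conjTranspose_adjoin_mul_adjoin]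
    refine Finset.sum_eq_zero fun l _ => Finset.sum_eq_zero fun c _ => ?_
    rw [if_neg, Matrix.zero_mul]
    intro h
    have := congrFun h (extraQ 2)
    rw [Function.update_of_ne (workQ_ne_extraQ _ _).symm, Function.update_self,
      ancState_extra] at this
    simp at this
  have hzero : Function.update (fun _ : Fin (numAnc a) => false) (extraQ 2) false =
      fun _ => false := Function.update_eq_self (extraQ 2) _
  have hrow : (adjoin a s fun _ : Fin (numAnc a) => false)ᴴ *
      ((Gate.one (ancWire (extraQ 2)) u : Gate (Wires (numAnc a) a s)).toOp *
        ((Gate.one (ancWire (workQ 0)) bitFlip : Gate (Wires (numAnc a) a s)).toOp *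
          cleanProj a s)) =
      u.1 false false • ((adjoin a s (ancState a false false))ᴴ * cleanProj a s) := by
    rw [← Matrix.mul_assoc, adjoin_mul_one, Fintype.sum_bool, hzero, Matrix.add_mul,
      Matrix.smul_mul, Matrix.smul_mul, ← Matrix.mul_assoc (adjoin a s _)ᴴ,
      ← Matrix.mul_assoc (adjoin a s _)ᴴ, adjoin_mul_bitFlip, adjoin_mul_bitFlip, hwork,
      Function.update_of_ne (workQ_ne_extraQ _ _), Bool.not_false, horth, smul_zero, zero_add]
  have hclean : cleanProj a s * (Program.toOp U (evolutionCore a s k n) * startEmb a s) =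
      Program.toOp U (evolutionCore a s k n) * startEmb a s := by
    have h := congrArg (fun X => X * zeroEmb (Fin a) (Fin s)) (cleanProj_mul_core_adjoin hU k n)
    simpa only [Matrix.mul_assoc, startEmb] using h
  rw [zeroBlock_wires, evolutionProgram, toOp_append, toOp_append, toOp_append, toOp_singleton,
    toOp_singleton]
  simp only [Step.toOp, Matrix.mul_assoc]
  rw [bitFlip_mul_zero_column, ← hclean]
  have h := congrArg (fun X => (zeroEmb (Fin a) (Fin s))ᴴ *
    (X * (Program.toOp U (evolutionCore a s k n) * startEmb a s))) hrow
  simp only [Matrix.mul_assoc, Matrix.smul_mul, Matrix.mul_smul] at h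
  rw [h, startEmb, Matrix.conjTranspose_mul, Matrix.mul_assoc]

theorem fullReflection_mul_cleanProj {U : QOp (Fin a ⊕ Fin s)}
    (hU : U ∈ Matrix.unitaryGroup (Fin a ⊕ Fin s → Bool) ℂ) :
    Program.toOp U (fullReflection a s) * cleanProj a s =
      reflection (startEmb a s) * cleanProj a s := by
  have h : ∀ l c, Program.toOp U (fullReflection a s) * adjoin a s (ancState a l c) =
      reflection (startEmb a s) * adjoin a s (ancState a l c) := by
    intro l c
    rw [fullReflection_mul hU, show reflection (startEmb a s) =
      (2 : ℂ) • (startEmb a s * (startEmb a s)ᴴ) - 1 from rfl, startEmb,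
      Matrix.conjTranspose_mul, Matrix.sub_mul, Matrix.smul_mul, Matrix.one_mul]
    simp only [Matrix.mul_assoc, conjTranspose_adjoin_mul_adjoin, ancState_inj]
    by_cases hlc : l = false ∧ c = false
    · rw [if_pos hlc, if_pos ⟨hlc.1.symm, hlc.2.symm⟩, hlc.1, hlc.2, reflection]
      simp only [Matrix.mul_sub, Matrix.mul_smul, Matrix.mul_one]
    · rw [if_neg hlc, if_neg fun h => hlc ⟨h.1.symm, h.2.symm⟩]
      simp
  simp only [cleanProj, Matrix.mul_sum, ← Matrix.mul_assoc, h]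

/-- The uses of the block-encoding that only serve to make up their number. -/
def idleCalls (a s m : ℕ) : Program (numAnc a) a s := List.replicate m (.call (extraQ 2) false)

theorem idleCalls_mul (U : QOp (Fin a ⊕ Fin s)) (m : ℕ) {f : Fin (numAnc a) → Bool}
    (hf : f (extraQ 2) = false) :
    Program.toOp U (idleCalls a s m) * adjoin a s f = adjoin a s f := by
  induction m with
  | zero => exact Matrix.one_mul _
  | succ m ih =>
    rw [idleCalls, List.replicate_succ, Program.toOp, Matrix.mul_assoc, call_mul_adjoin, hf]
    simpa [idleCalls] using ih

/-- The amplified simulation. -/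
def amplifiedProgram (a s : ℕ) (k : ℕ → Bool → Matrix.unitaryGroup Bool ℂ) (n m : ℕ) :
    Program (numAnc a) a s :=
  idleCalls a s m ++ ([.gate (.one (ancWire (workQ 0)) bitFlip)] ++ (evolutionCore a s k n ++
    (fullReflection a s ++ (Program.inv (evolutionCore a s k n) ++ (fullReflection a s ++
      (evolutionCore a s k n ++ ([.gate (.one (ancWire (workQ 0)) bitFlip)] ++
        [.gate (.one (ancWire (extraQ 2)) (signGate fun _ => true))])))))))

/-- The idle calls come first, while their control is still `0`. The final gate is the scalar `-1`,
which corrects the sign left by amplification. -/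
theorem zeroBlock_amplifiedProgram {U : QOp (Fin a ⊕ Fin s)}
    (hU : U ∈ Matrix.unitaryGroup (Fin a ⊕ Fin s → Bool) ℂ)
    (k : ℕ → Bool → Matrix.unitaryGroup Bool ℂ) (n m : ℕ) {B : QOp (Fin s)}
    (hB : (startEmb a s)ᴴ * (Program.toOp U (evolutionCore a s k n) * startEmb a s) = B) :
    zeroBlock (Program.toOp U (amplifiedProgram a s k n m)) =
      -((4 : ℂ) • (B * Bᴴ * B) - (3 : ℂ) • B) := by
  have hzero : Function.update (fun _ : Fin (numAnc a) => false) (extraQ 2) false =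
      fun _ => false := Function.update_eq_self (extraQ 2) _
  have hneg : (adjoin a s fun _ : Fin (numAnc a) => false)ᴴ *
      (Gate.one (ancWire (extraQ 2)) (signGate fun _ => true) :
        Gate (Wires (numAnc a) a s)).toOp = -(adjoin a s fun _ : Fin (numAnc a) => false)ᴴ := by
    rw [adjoin_mul_one, Fintype.sum_bool, hzero]
    simp [signGate]
  have hQW := commute_of_preserves (toOp_mem_unitaryGroup hU (evolutionCore a s k n))
    conjTranspose_cleanProj cleanProj_mul_self (cleanProj_mul_evolutionCore hU k n)
  have hQJ : cleanProj a s * startEmb a s = startEmb a s := by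
    rw [startEmb, ← Matrix.mul_assoc, cleanProj_mul_adjoin]
  have h := amplification_block (toOp_mem_unitaryGroup hU (evolutionCore a s k n))
    startEmb_isometry conjTranspose_cleanProj hQJ hQW (fullReflection_mul_cleanProj hU)
  rw [hB] at h
  have hidle : Program.toOp U (idleCalls a s m) *
      ((adjoin a s fun _ : Fin (numAnc a) => false) * zeroEmb (Fin a) (Fin s)) =
      (adjoin a s fun _ : Fin (numAnc a) => false) * zeroEmb (Fin a) (Fin s) := by
    rw [← Matrix.mul_assoc, idleCalls_mul U m rfl]
  have hrow : (zeroEmb (Fin a) (Fin s))ᴴ * ((adjoin a s fun _ : Fin (numAnc a) => false)ᴴ *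
      ((Gate.one (ancWire (extraQ 2)) (signGate fun _ => true) :
        Gate (Wires (numAnc a) a s)).toOp *
      (Gate.one (ancWire (workQ 0)) bitFlip : Gate (Wires (numAnc a) a s)).toOp)) =
      -(startEmb a s)ᴴ := by
    rw [← Matrix.mul_assoc (adjoin a s fun _ : Fin (numAnc a) => false)ᴴ, hneg, Matrix.neg_mul,
      adjoin_mul_bitFlip, show Function.update (fun _ : Fin (numAnc a) => false) (workQ 0)
      (!false) = ancState a false false from update_zero_work, Matrix.mul_neg, startEmb,
      Matrix.conjTranspose_mul]
  have h' := congrArg (fun X => X * (Program.toOp U (evolutionCore a s k n) *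
    (Program.toOp U (fullReflection a s) * ((Program.toOp U (evolutionCore a s k n))ᴴ *
    (Program.toOp U (fullReflection a s) * (Program.toOp U (evolutionCore a s k n) *
    startEmb a s)))))) hrow
  simp only [Matrix.mul_assoc, Matrix.neg_mul] at h'
  rw [← h, ← h', zeroBlock_wires, amplifiedProgram]
  simp only [toOp_append, toOp_singleton, toOp_inv, Matrix.mul_assoc, Step.toOp]
  rw [hidle, bitFlip_mul_zero_column]

end Simulation

/-! ### Numbers of calls and of other gates -/

section Counting

variable {a s : ℕ}

theorem calls_signalStep (ctl : Fin (numAnc a)) (adj : Bool)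
    (k : Bool → Matrix.unitaryGroup Bool ℂ) :
    Program.calls (signalStep a s ctl adj k) = 1 := by
  simp only [signalStep, signalReflection, calls_append, calls_flagSign, Program.calls]

theorem otherGates_signalReflection (v : Bool) :
    Program.otherGates (signalReflection a s v) = 6 * a + 1 := by
  rw [signalReflection, otherGates_flagSign, beLadder, List.length_map, List.length_finRange]

theorem otherGates_fullReflection :
    Program.otherGates (fullReflection a s) = 6 * a + 7 := by
  rw [fullReflection, otherGates_flagSign, fullLadder, beLadder, List.length_append,
    List.length_map, List.length_finRange, List.length_singleton]
  ring

theorem otherGates_signalStep (ctl : Fin (numAnc a)) (adj : Bool)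
    (k : Bool → Matrix.unitaryGroup Bool ℂ) :
    Program.otherGates (signalStep a s ctl adj k) = 12 * a + 3 := by
  simp only [signalStep, otherGates_append, otherGates_signalReflection, Program.otherGates]
  ring

theorem calls_signalCore (k : ℕ → Bool → Matrix.unitaryGroup Bool ℂ) (n : ℕ) :
    Program.calls (signalCore a s k n) = n := by
  induction n with
  | zero => rfl
  | succ n ih => rw [signalCore, calls_append, ih, calls_signalStep]

theorem otherGates_signalCore (k : ℕ → Bool → Matrix.unitaryGroup Bool ℂ) (n : ℕ) :
    Program.otherGates (signalCore a s k n) = n * (12 * a + 3) + 1 := by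
  induction n with
  | zero => simp [signalCore, Program.otherGates]
  | succ n ih => rw [signalCore, otherGates_append, ih, otherGates_signalStep]; ring

theorem calls_evolutionCore (k : ℕ → Bool → Matrix.unitaryGroup Bool ℂ) (n : ℕ) :
    Program.calls (evolutionCore a s k n) = n + 1 := by
  simp only [evolutionCore, calls_append, calls_signalCore, calls_signalStep, Program.calls]
  ring

theorem otherGates_evolutionCore (k : ℕ → Bool → Matrix.unitaryGroup Bool ℂ) (n : ℕ) :
    Program.otherGates (evolutionCore a s k n) = (n + 1) * (12 * a + 3) + 3 := by
  simp only [evolutionCore, otherGates_append, otherGates_signalCore, otherGates_signalStep,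
    Program.otherGates]
  ring

theorem calls_evolutionProgram (k : ℕ → Bool → Matrix.unitaryGroup Bool ℂ) (n : ℕ)
    (u : Matrix.unitaryGroup Bool ℂ) :
    Program.calls (evolutionProgram a s k n u) = n + 1 := by
  simp only [evolutionProgram, calls_append, calls_evolutionCore, Program.calls]
  ring

theorem otherGates_evolutionProgram_le (k : ℕ → Bool → Matrix.unitaryGroup Bool ℂ) (n : ℕ)
    (u : Matrix.unitaryGroup Bool ℂ) :
    Program.otherGates (evolutionProgram a s k n u) ≤
      16 * (a + 1) * Program.calls (evolutionProgram a s k n u) := by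
  rw [calls_evolutionProgram]
  simp only [evolutionProgram, otherGates_append, otherGates_evolutionCore, Program.otherGates]
  nlinarith [Nat.zero_le (n * a)]

theorem calls_idleCalls (m : ℕ) : Program.calls (idleCalls a s m) = m := by
  induction m with
  | zero => rfl
  | succ m ih => exact congrArg (· + 1) ih

theorem otherGates_idleCalls (m : ℕ) : Program.otherGates (idleCalls a s m) = 0 := by
  induction m with
  | zero => rfl
  | succ m ih => exact ih

theorem calls_amplifiedProgram (k : ℕ → Bool → Matrix.unitaryGroup Bool ℂ) (n m : ℕ) :
    Program.calls (amplifiedProgram a s k n m) = 3 * (n + 1) + m := by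
  simp only [amplifiedProgram, fullReflection, calls_append, calls_evolutionCore, calls_inv,
    calls_idleCalls, calls_flagSign, Program.calls]
  ring

theorem otherGates_amplifiedProgram_le (k : ℕ → Bool → Matrix.unitaryGroup Bool ℂ) (n m : ℕ) :
    Program.otherGates (amplifiedProgram a s k n m) ≤
      16 * (a + 1) * Program.calls (amplifiedProgram a s k n m) := by
  rw [calls_amplifiedProgram]
  simp only [amplifiedProgram, otherGates_append, otherGates_evolutionCore, otherGates_inv,
    otherGates_idleCalls, otherGates_fullReflection, Program.otherGates]
  nlinarith [Nat.zero_le (n * a), Nat.zero_le (m * a)]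

end Counting

/-! ### Choice of the parameters and assembly -/

variable {a s : ℕ}

/-- The circuit `V` block-encodes the evolution for the time `t`. -/
structure EncodesEvolution (αH αHS ε t : ℝ) (V : Program (numAnc a) a s) : Prop where
  calls_eq : (V.calls : ℤ) = evolutionCalls αH ε t
  otherGates_le : V.otherGates ≤ 16 * (a + 1) * V.calls
  isBlockEncoding {H : QOp (Fin s)} {U : QOp (Fin a ⊕ Fin s)} (hH : H.IsHermitian)
    (hBE : IsBlockEncoding αH 0 H U) : IsBlockEncoding αHS ε (evolution H t) (V.toOp U)

/-- The circuit `S` simulates the evolution for the time `t`, for initial states of norm `ν`. -/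
structure SimulatesEvolution (αH αHS ε ν t : ℝ) (S : Program (numAnc a) a s) : Prop where
  calls_eq : (S.calls : ℤ) = amplificationCalls αHS ν * evolutionCalls αH ε t
  otherGates_le : S.otherGates ≤ 16 * (a + 1) * S.calls
  unitary {H : QOp (Fin s)} {U : QOp (Fin a ⊕ Fin s)} (hBE : IsBlockEncoding αH 0 H U) :
    S.toOp U ∈ Matrix.unitaryGroup (Wires (numAnc a) a s → Bool) ℂ
  close {H : QOp (Fin s)} {U : QOp (Fin a ⊕ Fin s)} (hH : H.IsHermitian)
    (hBE : IsBlockEncoding αH 0 H U) {ψ : QVec (Fin s)} (hψ : ‖ψ‖ = 1) :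
    1 - ε ≤ ‖postselect (S.toOp U) ψ‖ ^ 2 ∧
      ‖((‖postselect (S.toOp U) ψ‖⁻¹ : ℝ) : ℂ) • postselect (S.toOp U) ψ -
        Matrix.toEuclideanLin (evolution H t) ψ‖ ≤ ε

/-- `n` is the ceiling in `evolutionCalls`. It is positive because `ε < 1`, so the subtraction `n -
1` is not truncated. -/
theorem exists_queryCount {αH ε t : ℝ} (hα : 0 ≤ αH) (hε : 0 < ε) (hε1 : ε < 1) (ht : 0 ≤ t) :
    ∃ n : ℕ, 1 ≤ n ∧ 2.8 * (αH * t) + Real.log (1 / ε) ≤ n ∧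
      (((2 * (n - 1) + 1 : ℕ)) : ℤ) = evolutionCalls αH ε t := by
  have hlog : 0 < Real.log (1 / ε) := Real.log_pos ((one_lt_div hε).2 hε1)
  have hpos : 0 < 2.8 * αH * t + Real.log (1 / ε) := by positivity
  obtain ⟨n, hn⟩ := Int.eq_ofNat_of_zero_le (Int.ceil_pos.2 hpos).le
  have h1 : 1 ≤ n := by
    have := Int.ceil_pos.2 hpos
    omega
  refine ⟨n, h1, ?_, ?_⟩
  · have h2 := Int.le_ceil (2.8 * αH * t + Real.log (1 / ε))
    rw [hn] at h2
    rw [← mul_assoc]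
    exact_mod_cast h2
  · rw [evolutionCalls, hn]
    omega

/-- The ceiling is at least `1`, so at least three uses are prescribed; `m` is the surplus over the
three that amplification needs. -/
theorem exists_amplificationCalls {αHS ν : ℝ} (hα : 2 ≤ αHS) (hν : 0 < ν) :
    ∃ m : ℕ, ((m + 3 : ℕ) : ℤ) = amplificationCalls αHS ν := by
  have h : 0 < ⌈|αHS| / ν⌉ := Int.ceil_pos.2 (div_pos (abs_pos.2 (by linarith)) hν)
  refine ⟨(2 * ⌈|αHS| / ν⌉ - 2).toNat, ?_⟩
  rw [amplificationCalls]
  omega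

theorem exists_encodesEvolution {αH αHS ε t : ℝ} (hα : 0 ≤ αH) (hαHS : 2 ≤ αHS) (hε : 0 < ε)
    (hε1 : ε < 1) (ht : 0 ≤ t) :
    ∃ V : Program (numAnc a) a s, EncodesEvolution αH αHS ε t V := by
  obtain ⟨n, hn, hle, hcalls⟩ := exists_queryCount hα hε hε1 ht
  obtain ⟨k, hk, hp⟩ := exists_phases (mul_nonneg hα ht) hε hε1 hn hle
  have hr : |2 / αHS| ≤ 1 := by
    rw [abs_of_nonneg (by positivity), div_le_one (by linarith)]; exact hαHS
  -- The amplitude of the core is about `1 / 2`; the rotation multiplies it by `2 / αHS`, so that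
  -- scaling by `αHS` leaves twice the block of the core.
  refine ⟨evolutionProgram a s k (2 * (n - 1)) (rotation (2 / αHS) hr), ?_,
    otherGates_evolutionProgram_le _ _ _, fun {H U} hH hBE => ⟨by linarith, hε.le,
      toOp_mem_unitaryGroup hBE.unitary _, ?_⟩⟩
  · rw [calls_evolutionProgram, hcalls]
  have hB := norm_evolutionCore_block_le hH hBE ht hε hε1 hn hle
    (evolutionCore_block hH hBE hk hp)
  have h0 : (αHS : ℂ) ≠ 0 := by
    rw [Ne, Complex.ofReal_eq_zero]; linarith
  have hrot : (rotation (2 / αHS) hr).1 false false = ((2 / αHS : ℝ) : ℂ) := rfl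
  rw [zeroBlock_evolutionProgram hBE.unitary, smul_smul, hrot, Complex.ofReal_div,
    mul_div_cancel₀ _ h0, norm_sub_rev, Complex.ofReal_ofNat]
  linarith

theorem exists_simulatesEvolution {αH αHS ε ν t : ℝ} (hα : 0 ≤ αH) (hαHS : 2 ≤ αHS) (hε : 0 < ε)
    (hε1 : ε < 1) (hν : 0 < ν) (ht : 0 ≤ t) :
    ∃ S : Program (numAnc a) a s, SimulatesEvolution αH αHS ε ν t S := by
  obtain ⟨n, hn, hle, hcalls⟩ := exists_queryCount hα hε hε1 ht
  obtain ⟨m, hm⟩ := exists_amplificationCalls hαHS hν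
  obtain ⟨k, hk, hp⟩ := exists_phases (mul_nonneg hα ht) hε hε1 hn hle
  -- The surplus of `m` evolution blocks, with `2 n - 1` calls each, is made up of idle calls.
  refine ⟨amplifiedProgram a s k (2 * (n - 1)) (m * (2 * (n - 1) + 1)), ?_,
    otherGates_amplifiedProgram_le _ _ _, fun hBE => toOp_mem_unitaryGroup hBE.unitary _,
    fun {H U} hH hBE {ψ} hψ => ?_⟩
  · rw [calls_amplifiedProgram, ← hm, ← hcalls]
    push_cast
    ring
  have hcore := evolutionCore_block hH hBE hk hp
  obtain ⟨B, hBdef⟩ : ∃ B : QOp (Fin s),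
      B = (((1 / (1 + ε / 6) : ℝ) : ℂ) / 2) • taylorEvolution H t n := ⟨_, rfl⟩
  rw [← hBdef] at hcore
  have hE := evolution_mem_unitaryGroup hH t
  have hB := norm_evolutionCore_block_le hH hBE ht hε hε1 hn hle hBdef
  -- With `η = 13 ε / 42` and `ε < 1` the estimate stays below `ε / 2`; normalization may double it.
  have hA : ‖-((4 : ℂ) • (B * Bᴴ * B) - (3 : ℂ) • B) - evolution H t‖ ≤ ε / 2 := by
    refine (norm_amplified_sub_le hE hB).trans ?_
    have h2 : ε ^ 2 ≤ ε := by nlinarith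
    have h3 : ε ^ 3 ≤ ε := by nlinarith
    have e2 : (13 / 42 * ε) ^ 2 = 169 / 1764 * ε ^ 2 := by ring
    have e3 : (13 / 42 * ε) ^ 3 = 2197 / 74088 * ε ^ 3 := by ring
    rw [e2, e3]
    linarith
  refine normalize_close ((norm_toEuclideanLin_unitary hE ψ).trans hψ) ?_
    (mul_div_cancel₀ ε two_ne_zero).le hε1
  rw [postselect, zeroBlock_amplifiedProgram hBE.unitary k _ _ hcore, ← LinearMap.sub_apply,
    ← map_sub]
  refine (norm_toEuclideanLin_le _ _).trans ?_
  rwa [hψ, mul_one]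

theorem sum_calls_eq_costSim {b M : ℕ} {αH αHS ε ν ti Δt : ℝ} {S : Fin (M + 1) → Program b a s}
    (h : ∀ j, ((S j).calls : ℤ) =
      amplificationCalls αHS ν * evolutionCalls αH ε (ti + (j : ℕ) * Δt)) (G : ℕ) :
    ∑ j, (G : ℤ) * ((S j).calls : ℤ) = costSim αH αHS ε ν G ti Δt M := by
  rw [costSim, Finset.sum_range]
  refine Finset.sum_congr rfl fun j _ => ?_
  rw [h, costHSAA, mul_comm]

theorem sum_gateComplexity_le {b M : ℕ} {αH αHS ε ν ti Δt : ℝ} {S : Fin (M + 1) → Program b a s}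
    {C : ℕ} (h : ∀ j, ((S j).calls : ℤ) =
      amplificationCalls αHS ν * evolutionCalls αH ε (ti + (j : ℕ) * Δt))
    (hC : ∀ j, (S j).otherGates ≤ C * (a + 1) * (S j).calls) (G : ℕ) :
    ∑ j, ((S j).gateComplexity G : ℤ) ≤ costSim αH αHS ε ν G ti Δt M +
      (C : ℤ) * ((a : ℤ) + 1) * costSim αH αHS ε ν 1 ti Δt M := by
  rw [← sum_calls_eq_costSim h, ← sum_calls_eq_costSim h, Finset.mul_sum,
    ← Finset.sum_add_distrib]
  refine Finset.sum_le_sum fun j _ => ?_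
  have := hC j
  rw [Program.gateComplexity, Nat.cast_one, one_mul]
  exact_mod_cast Nat.add_le_add_left this _

end OscSim

end

theorem corollary1 :
    -- an absolute constant, for the gates outside of the block-encoding of the Hamiltonian
    ∃ C : ℕ, ∀ (s a M : ℕ) (αH αHS ε ν ti tf Δt : ℝ),
      0 ≤ αH → 2 ≤ αHS → 0 < ε → ε < 1 → 0 < ν → 0 ≤ ti → 0 < Δt → (M : ℝ) = (tf - ti) / Δt →
      -- circuits that depend on these numbers only, not on the Hamiltonian or the initial state:
      -- `V j` encodes the evolution up to the time `ti + j Δt`, `S j` is the amplified simulation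
      ∃ (b : ℕ) (V S : Fin (M + 1) → OscSim.Program b a s),
        (∀ j : Fin (M + 1),
          ((V j).calls : ℤ) = OscSim.evolutionCalls αH ε (ti + (j : ℕ) * Δt) ∧
          ((S j).calls : ℤ) = OscSim.amplificationCalls αHS ν * ((V j).calls : ℤ) ∧
          (V j).otherGates ≤ C * (a + 1) * (V j).calls ∧
          (S j).otherGates ≤ C * (a + 1) * (S j).calls) ∧
        ∀ (H : OscSim.QOp (Fin s)) (UH : List (OscSim.Gate (Fin a ⊕ Fin s))),
          H.IsHermitian →
          OscSim.IsBlockEncoding αH 0 H (OscSim.circuitOp UH) →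
          -- `V j` is a block-encoding of the evolution operator with sub-normalization `αHS`
          (∀ j : Fin (M + 1),
            OscSim.IsBlockEncoding αHS ε (OscSim.evolution H (ti + (j : ℕ) * Δt))
              ((V j).toOp (OscSim.circuitOp UH))) ∧
          -- `S j` is an `ε`-close simulation at the time `ti + j Δt`, with high probability
          (∀ ψ₀ : OscSim.QVec (Fin s), ‖ψ₀‖ = ν → ∀ j : Fin (M + 1),
            let ψ : OscSim.QVec (Fin s) := ((‖ψ₀‖⁻¹ : ℝ) : ℂ) • ψ₀
            let φ := OscSim.postselect ((S j).toOp (OscSim.circuitOp UH)) ψ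
            (S j).toOp (OscSim.circuitOp UH) ∈
              Matrix.unitaryGroup (OscSim.Wires b a s → Bool) ℂ ∧
            1 - ε ≤ ‖φ‖ ^ 2 ∧
            ‖((‖φ‖⁻¹ : ℝ) : ℂ) • φ -
              Matrix.toEuclideanLin (OscSim.evolution H (ti + (j : ℕ) * Δt)) ψ‖ ≤ ε) ∧
          -- the total cost, and the gates outside of the uses of the block-encoding
          (∑ j : Fin (M + 1), (UH.length : ℤ) * ((S j).calls : ℤ)) =
            OscSim.costSim αH αHS ε ν UH.length ti Δt M ∧
          (∑ j : Fin (M + 1), ((S j).gateComplexity UH.length : ℤ)) ≤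
            OscSim.costSim αH αHS ε ν UH.length ti Δt M +
              (C : ℤ) * ((a : ℤ) + 1) * OscSim.costSim αH αHS ε ν 1 ti Δt M := by
  -- The constant comes from `S`: without idle calls and with one call per core it has `48 a + 35`
  -- other gates for three calls, and `48 a + 35 ≤ 16 (a + 1) * 3`.
  refine ⟨16, fun s a M αH αHS ε ν ti tf Δt hα hαHS hε hε1 hν hti hΔ _ => ?_⟩
  have ht : ∀ j : Fin (M + 1), 0 ≤ ti + (j : ℕ) * Δt := fun j =>
    add_nonneg hti (mul_nonneg (Nat.cast_nonneg _) hΔ.le)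
  choose V hV using fun j => OscSim.exists_encodesEvolution (a := a) (s := s) hα hαHS hε hε1 (ht j)
  choose S hS using fun j =>
    OscSim.exists_simulatesEvolution (a := a) (s := s) hα hαHS hε hε1 hν (ht j)
  refine ⟨_, V, S, fun j => ⟨(hV j).calls_eq, ?_, (hV j).otherGates_le, (hS j).otherGates_le⟩,
    fun H UH hH hBE => ⟨fun j => (hV j).isBlockEncoding hH hBE, fun ψ₀ hψ₀ j => ?_,
      OscSim.sum_calls_eq_costSim (fun j => (hS j).calls_eq) _,
      OscSim.sum_gateComplexity_le (fun j => (hS j).calls_eq) (fun j => (hS j).otherGates_le) _⟩⟩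
  · rw [(hV j).calls_eq, (hS j).calls_eq]
  · have hψ : ‖((‖ψ₀‖⁻¹ : ℝ) : ℂ) • ψ₀‖ = 1 := by
      rw [norm_smul, Complex.norm_real, norm_inv, norm_norm, hψ₀, inv_mul_cancel₀ hν.ne']
    exact ⟨(hS j).unitary hBE, (hS j).close hH hBE hψ⟩
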